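/- Let $\mathsf{J}$ be the first-order theory in the language with one binary relation symbol $\mathsf{E}$ with the following axioms: $\mathsf{E}$ is an equivalence relation; for each $n$, there is at most one equivalence class of size precisely $n$; for each $n$, there are at least $n$ equivalence classes with at least $n$ elements. Let $\mathsf{A}_n$ be the sentence "there is an equivalence class of size precisely $n+1$". For $\mathcal X\subseteq\mathbb N$, a $\mathsf{J},\mathcal X$-theory is a theory $W$ in the language of $\mathsf{J}$ that is axiomatised over $\mathsf{J}$ by a set of boolean combinations of sentences $\mathsf{A}_s$ with $s\in\mathcal X$. A recursively enumerable (RE) theory is a one-sorted first-order theory in a finite signature given by an RE set of axioms; an index of it consists of its signature and an index of that RE set. A theory is essentially undecidable if all its consistent extensions in the same language are undecidable. Interpretations are piecewise and multidimensional (with finitely many pieces, whose dimensions may differ), relative, not necessarily identity preserving, and may have parameters: $W$ interprets $U$ if there is such a translation $\tau$, with a formula $\alpha(\vec p\,)$ describing the admissible parameters, such that $W\vdash\exists\vec p\,\alpha(\vec p\,)$ and $W\vdash\alpha(\vec p\,)\to\varphi^{\tau,\vec p}$ for each sentence $\varphi$ with $U\vdash\varphi$. Theorem. For every essentially undecidable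 RE theory $U$ one can effectively find, from an index of $U$, (an index of the characteristic function of) an infinite recursive set $\mathcal X\subseteq\mathbb N$ such that no consistent $\mathsf{J},\mathcal X$-theory interprets $U$. That is, there is a total computable function $F$ such that, whenever $e$ is an index of an essentially undecidable RE theory $U$, $F(e)$ is an index of the characteristic function of such a set $\mathcal X$. -/

import Mathlib

open FirstOrder FirstOrder.Language

noncomputable section

namespace EssUndec

/-! ### Finite signatures, Gödel numbers, recursively enumerable theories -/

/-- A finite one-sorted signature: the list of the arities of its function symbols (constants have
arity `0`) and the list of the arities of its relation symbols. -/
abbrev Sig : Type := List ℕ × List ℕ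

/-- The first-order language of a finite signature: the symbols of arity `n` are the positions
at which `n` occurs in the respective list. -/
def lang (S : Sig) : FirstOrder.Language.{0, 0} :=
  ⟨fun n => {i : Fin S.1.length // S.1.get i = n}, fun n => {i : Fin S.2.length // S.2.get i = n}⟩

/-- Gödel numbers of terms with variables `x₀, …, xₙ₋₁`. -/
def termCode {S : Sig} {n : ℕ} : (lang S).Term (Empty ⊕ Fin n) → ℕ
  | .var (.inl e) => e.elim
  | .var (.inr i) => 2 * i
  | .func (l := l) f ts =>
      2 * Nat.pair f.1 (Encodable.encode (List.ofFn fun i : Fin l => termCode (ts i))) + 1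

/-- Gödel numbers of formulas with free variables among `x₀, …, xₙ₋₁`. -/
def formulaCode {S : Sig} : {n : ℕ} → (lang S).BoundedFormula Empty n → ℕ
  | _, .falsum => 0
  | _, .equal t u => 4 * Nat.pair (termCode t) (termCode u) + 1
  | _, .rel (l := l) R ts =>
      4 * Nat.pair R.1 (Encodable.encode (List.ofFn fun i : Fin l => termCode (ts i))) + 2
  | _, .imp φ ψ => 4 * Nat.pair (formulaCode φ) (formulaCode ψ) + 3
  | _, .all φ => 4 * formulaCode φ + 4

theorem termCode_injective {S : Sig} {n : ℕ} :
    Function.Injective (termCode : (lang S).Term (Empty ⊕ Fin n) → ℕ) := by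
  intro t
  induction t with
  | var x =>
    rintro (y | ⟨g, us⟩) h
    · rcases x with ⟨⟨⟩⟩ | x
      rcases y with ⟨⟨⟩⟩ | y
      simp only [termCode] at h
      exact congrArg _ (congrArg _ (Fin.ext (by omega)))
    · rcases x with ⟨⟨⟩⟩ | x
      simp only [termCode] at h
      omega
  | @func l f ts ih =>
    rintro (y | @⟨l', g, us⟩) h
    · rcases y with ⟨⟨⟩⟩ | y
      simp only [termCode] at h
      omega
    · simp only [termCode] at h
      have h' := Nat.pair_eq_pair.1 (Nat.eq_of_mul_eq_mul_left (by norm_num) (Nat.add_right_cancel h))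
      obtain ⟨f, hf⟩ := f
      obtain ⟨g, hg⟩ := g
      obtain rfl : f = g := Fin.ext h'.1
      subst hf
      obtain rfl := hg
      have h2 := List.ofFn_injective (Encodable.encode_injective h'.2)
      exact congrArg _ (funext fun i => ih i (congrFun h2 i))

/-- Distinct formulas have distinct Gödel numbers. -/
theorem formulaCode_injective {S : Sig} {n : ℕ} :
    Function.Injective (formulaCode : (lang S).BoundedFormula Empty n → ℕ) := by
  intro φ
  induction φ with
  | falsum => intro ψ h; cases ψ <;> simp only [formulaCode] at h <;> first | rfl | omega
  | equal t u =>
    intro ψ h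
    cases ψ <;> simp only [formulaCode] at h <;> try omega
    have h' := Nat.pair_eq_pair.1 (Nat.eq_of_mul_eq_mul_left (by norm_num) (Nat.add_right_cancel h))
    rw [termCode_injective h'.1, termCode_injective h'.2]
  | rel R ts =>
    rintro (_ | _ | @⟨_, _, R', ts'⟩ | _ | _) h <;> simp only [formulaCode] at h <;> try omega
    have h' := Nat.pair_eq_pair.1 (Nat.eq_of_mul_eq_mul_left (by norm_num) (Nat.add_right_cancel h))
    obtain ⟨R, hR⟩ := R
    obtain ⟨R', hR'⟩ := R'
    obtain rfl : R = R' := Fin.ext h'.1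
    subst hR
    obtain rfl := hR'
    have h2 := List.ofFn_injective (Encodable.encode_injective h'.2)
    exact congrArg _ (funext fun i => termCode_injective (congrFun h2 i))
  | imp φ₁ φ₂ ih₁ ih₂ =>
    intro ψ h
    cases ψ <;> simp only [formulaCode] at h <;> try omega
    have h' := Nat.pair_eq_pair.1 (Nat.eq_of_mul_eq_mul_left (by norm_num) (Nat.add_right_cancel h))
    rw [ih₁ h'.1, ih₂ h'.2]
  | all φ ih =>
    intro ψ h
    cases ψ <;> simp only [formulaCode] at h <;> try omega
    rw [ih (Nat.eq_of_mul_eq_mul_left (by norm_num) (Nat.add_right_cancel h))]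

/-- The RE theory with index `e` in the signature `S`: its axioms are the sentences whose Gödel
number lies in the domain of the partial recursive function with code `e`. -/
def reTheory (S : Sig) (e : Nat.Partrec.Code) : (lang S).Theory :=
  {φ | (e.eval (formulaCode φ)).Dom}

/-- A theory is decidable if some algorithm decides, from Gödel numbers, which sentences are
theorems. -/
def IsDecidable {S : Sig} (T : (lang S).Theory) : Prop :=
  ∃ f : ℕ → Bool, Computable f ∧ ∀ φ : (lang S).Sentence, f (formulaCode φ) = true ↔ T ⊨ᵇ φ

/-- All consistent extensions of `U` in the same language are undecidable. -/
def EssentiallyUndecidable {S : Sig} (U : (lang S).Theory) : Prop :=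
  ∀ V : (lang S).Theory, (∀ φ : (lang S).Sentence, U ⊨ᵇ φ → V ⊨ᵇ φ) → V.IsSatisfiable →
    ¬ IsDecidable V

/-- `c` is an index of the recursive set `X`: it computes the characteristic function of `X`. -/
def IsRecursiveIndex (c : Nat.Partrec.Code) (X : Set ℕ) : Prop :=
  ∀ n, (n ∈ X → c.eval n = Part.some 1) ∧ (n ∉ X → c.eval n = Part.some 0)

/-! ### Interpretations: piecewise, multidimensional with dimensions varying over the pieces,
relative, not necessarily identity preserving, with parameters -/

/-- A translation from the language `L` into the language `L'`. -/
structure Translation (L L' : FirstOrder.Language.{0, 0}) where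
  /-- the number of parameters -/
  params : ℕ
  /-- the condition on the parameters -/
  param : L'.Formula (Fin params)
  /-- the number of pieces of the domain -/
  pieces : ℕ
  /-- the dimension of each piece -/
  dim : Fin pieces → ℕ
  /-- the domain formula of each piece -/
  dom (a : Fin pieces) : L'.Formula (Fin params ⊕ Fin (dim a))
  /-- the translation of identity between elements of two pieces -/
  eq (a b : Fin pieces) : L'.Formula (Fin params ⊕ (Fin (dim a) ⊕ Fin (dim b)))
  /-- the translation of a relation symbol, for each choice of the pieces of its arguments -/
  rel {n : ℕ} (R : L.Relations n) (a : Fin n → Fin pieces) :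
    L'.Formula (Fin params ⊕ (Σ i, Fin (dim (a i))))
  /-- the translation of the graph of a function symbol, for each choice of the pieces of its
  arguments and of its value -/
  graph {n : ℕ} (f : L.Functions n) (a : Fin n → Fin pieces) (b : Fin pieces) :
    L'.Formula (Fin params ⊕ ((Σ i, Fin (dim (a i))) ⊕ Fin (dim b)))

namespace Translation

variable {L L' : FirstOrder.Language.{0, 0}} (τ : Translation L L')

/-- What stands for one variable of `L`: a piece and a tuple of variables of `L'`, from `β`, whose
length is the dimension of that piece. -/
abbrev Tup (β : Type) : Type := Σ a : Fin τ.pieces, (Fin (τ.dim a) → β)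

variable {τ}

/-- The same tuple, its variables read in a larger set of variables. -/
def Tup.map {β γ : Type} (g : β → γ) (u : τ.Tup β) : τ.Tup γ := ⟨u.1, g ∘ u.2⟩

variable (τ) {β : Type}

/-- `u` lies in the domain (here and below, `p` are the variables for the parameters). -/
def domF (p : Fin τ.params → β) (u : τ.Tup β) : L'.Formula β :=
  (τ.dom u.1).relabel (Sum.elim p u.2)

/-- `u` and `v` are identified by the translation. -/
def eqF (p : Fin τ.params → β) (u v : τ.Tup β) : L'.Formula β :=
  (τ.eq u.1 v.1).relabel (Sum.elim p (Sum.elim u.2 v.2))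

/-- The relation symbol `R` holds of the tuples `u i`. -/
def relF (p : Fin τ.params → β) {n : ℕ} (R : L.Relations n) (u : Fin n → τ.Tup β) :
    L'.Formula β :=
  (τ.rel R fun i => (u i).1).relabel (Sum.elim p fun x => (u x.1).2 x.2)

/-- The function symbol `f` takes the value `v` at the tuples `u i`. -/
def graphF (p : Fin τ.params → β) {n : ℕ} (f : L.Functions n) (u : Fin n → τ.Tup β)
    (v : τ.Tup β) : L'.Formula β :=
  (τ.graph f (fun i => (u i).1) v.1).relabel
    (Sum.elim p (Sum.elim (fun x => (u x.1).2 x.2) v.2))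

/-- `u` and `v` are literally the same tuple of the same piece. -/
def sameF (u v : τ.Tup β) : L'.Formula β :=
  if h : u.1 = v.1 then
    Formula.iInf fun j : Fin (τ.dim u.1) =>
      Term.equal (Term.var (u.2 j)) (Term.var (v.2 (Fin.cast (congrArg τ.dim h) j)))
  else ⊥

/-- There are `n` elements of the domain, each of any piece, that satisfy `K`. -/
def exF (p : Fin τ.params → β) (n : ℕ)
    (K : (γ : Type) → (β → γ) → (Fin n → τ.Tup γ) → L'.Formula γ) : L'.Formula β :=
  Formula.iSup fun a : Fin n → Fin τ.pieces =>
    Formula.iExs (Σ i, Fin (τ.dim (a i)))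
      ((Formula.iInf fun i => τ.domF (Sum.inl ∘ p) ⟨a i, fun j => Sum.inr ⟨i, j⟩⟩) ⊓
        K (β ⊕ Σ i, Fin (τ.dim (a i))) Sum.inl fun i => ⟨a i, fun j => Sum.inr ⟨i, j⟩⟩)

/-- Every element of the domain, of any piece, satisfies `K`. -/
def allF (p : Fin τ.params → β)
    (K : (γ : Type) → (β → γ) → τ.Tup γ → L'.Formula γ) : L'.Formula β :=
  Formula.iInf fun a : Fin τ.pieces =>
    Formula.iAlls (Fin (τ.dim a))
      ((τ.domF (Sum.inl ∘ p) ⟨a, Sum.inr⟩).imp (K (β ⊕ Fin (τ.dim a)) Sum.inl ⟨a, Sum.inr⟩))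

/-- `v` is a value of the term `t` when the variables of `t` are interpreted by the tuples `x`;
compound terms are unravelled. -/
def termF {n : ℕ} : L.Term (Empty ⊕ Fin n) → (β : Type) → (Fin τ.params → β) →
    (Fin n → τ.Tup β) → τ.Tup β → L'.Formula β
  | .var (.inl e), _, _, _, _ => e.elim
  | .var (.inr i), _, _, x, v => τ.sameF (x i) v
  | .func (l := l) f ts, _, p, x, v =>
      τ.exF p l fun γ g w =>
        (Formula.iInf fun i => termF (ts i) γ (g ∘ p) (fun k => (x k).map g) (w i)) ⊓
          τ.graphF (g ∘ p) f w (v.map g)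

/-- The translation of a formula whose free variables are interpreted by the tuples `x`. -/
def formulaF : {n : ℕ} → L.BoundedFormula Empty n → (β : Type) → (Fin τ.params → β) →
    (Fin n → τ.Tup β) → L'.Formula β
  | _, .falsum, _, _, _ => ⊥
  | _, .equal t u, _, p, x =>
      τ.exF p 2 fun γ g w =>
        τ.termF t γ (g ∘ p) (fun k => (x k).map g) (w 0) ⊓
          (τ.termF u γ (g ∘ p) (fun k => (x k).map g) (w 1) ⊓ τ.eqF (g ∘ p) (w 0) (w 1))
  | _, .rel (l := l) R ts, _, p, x =>
      τ.exF p l fun γ g w =>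
        (Formula.iInf fun i => τ.termF (ts i) γ (g ∘ p) (fun k => (x k).map g) (w i)) ⊓
          τ.relF (g ∘ p) R w
  | _, .imp φ ψ, β, p, x => (formulaF φ β p x).imp (formulaF ψ β p x)
  | n, .all φ, _, p, x =>
      τ.allF p fun γ g u =>
        formulaF φ γ (g ∘ p) (Fin.snoc (α := fun _ : Fin (n + 1) => τ.Tup γ)
          (fun k => (x k).map g) u)

/-- The translation of a sentence; its free variables are the parameters. -/
def sentenceF (φ : L.Sentence) : L'.Formula (Fin τ.params) :=
  τ.formulaF φ (Fin τ.params) id Fin.elim0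

end Translation

/-- `W` interprets `U`: for some translation, `W` proves that there are parameters as required, and
that for all such parameters the translation of each theorem of `U` holds. (The theorems of `U`
include the laws of identity, the totality of the functions and the non-emptiness of the domain.) -/
def Interprets {L L' : FirstOrder.Language.{0, 0}} (W : L'.Theory) (U : L.Theory) : Prop :=
  ∃ τ : Translation L L',
    W ⊨ᵇ (Formula.iExs (Fin τ.params) (τ.param.relabel Sum.inr) : L'.Sentence) ∧
      ∀ φ : L.Sentence, U ⊨ᵇ φ → W ⊨ᵇ τ.param.imp (τ.sentenceF φ)

/-! ### The theory `J` of an equivalence relation -/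

/-- The only symbol of the language of `J`: a binary relation symbol. -/
inductive JRel : ℕ → Type
  | E : JRel 2

/-- The language of `J`. -/
def langJ : FirstOrder.Language.{0, 0} := ⟨fun _ => Empty, JRel⟩

/-- The binary relation symbol of `J`. -/
def symE : langJ.Relations 2 := JRel.E

/-- `x E y`. -/
def eF {α : Type} (x y : α) : langJ.Formula α := symE.formula₂ (Term.var x) (Term.var y)

/-- The class of `x` has at least `n` elements. -/
def classGe {α : Type} (n : ℕ) (x : α) : langJ.Formula α :=
  Formula.iExs (Fin n)
    ((Formula.iInf fun i : Fin n => eF (Sum.inl x) (Sum.inr i)) ⊓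
      Formula.iInf fun q : {q : Fin n × Fin n // q.1 ≠ q.2} =>
        (Term.equal (Term.var (Sum.inr q.1.1)) (Term.var (Sum.inr q.1.2))).not)

/-- The class of `x` has precisely `n` elements. -/
def classEq {α : Type} (n : ℕ) (x : α) : langJ.Formula α :=
  classGe n x ⊓ (classGe (n + 1) x).not

/-- There is at most one class of size precisely `n`. -/
def axJ2 (n : ℕ) : langJ.Sentence :=
  Formula.iAlls (Fin 2)
    ((classEq n (Sum.inr 0)).imp ((classEq n (Sum.inr 1)).imp (eF (Sum.inr 0) (Sum.inr 1))))

/-- There are at least `n` classes with at least `n` elements. -/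
def axJ3 (n : ℕ) : langJ.Sentence :=
  Formula.iExs (Fin n)
    ((Formula.iInf fun i : Fin n => classGe n (Sum.inr i)) ⊓
      Formula.iInf fun q : {q : Fin n × Fin n // q.1 ≠ q.2} =>
        (eF (Sum.inr q.1.1) (Sum.inr q.1.2)).not)

/-- The theory `J`. -/
def J : langJ.Theory :=
  {symE.reflexive, symE.symmetric, symE.transitive} ∪ Set.range axJ2 ∪ Set.range axJ3

/-- The sentence `A n`: there is a class of size precisely `n + 1`. -/
def A (n : ℕ) : langJ.Sentence := Formula.iExs (Fin 1) (classEq (n + 1) (Sum.inr 0))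

/-- Boolean combinations of the sentences `A s` with `s ∈ X` (the other connectives are defined from
`⊥` and implication). -/
inductive IsBoolComb (X : Set ℕ) : langJ.Sentence → Prop
  | atom {s : ℕ} (hs : s ∈ X) : IsBoolComb X (A s)
  | falsum : IsBoolComb X BoundedFormula.falsum
  | imp {φ ψ : langJ.Sentence} (hφ : IsBoolComb X φ) (hψ : IsBoolComb X ψ) :
      IsBoolComb X (BoundedFormula.imp φ ψ)

/-- `W` is axiomatised over `J` by boolean combinations of the sentences `A s` with `s ∈ X`: it has
the same theorems as `J` together with some set of such combinations. -/
def IsJTheory (X : Set ℕ) (W : langJ.Theory) : Prop :=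
  ∃ B : Set langJ.Sentence, (∀ φ ∈ B, IsBoolComb X φ) ∧
    ∀ φ : langJ.Sentence, W ⊨ᵇ φ ↔ (J ∪ B : langJ.Theory) ⊨ᵇ φ

end EssUndec

end

/-! The set `X` is so sparse that any given interpretation sees only a finite part of it before it
has already gone wrong.

Every consistent theory in question has a standard model `Pt Z` with `Z ⊆ X`: infinitely many
infinite classes, and one class of size `s + 1` for each `s ∈ Z` (`exists_standard_model`). By a
back-and-forth argument (`IsPartialIso.extend`), the truth of a formula at a tuple of `Pt Z` depends
only on the equalities, the equivalences and the class sizes up to some bound. Hence a translation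
together with parameters in `Pt Z` is captured by a finite object, a description `δ`
(`exists_describes`): a bound, the finite table of the isomorphism types at which atomic formulas
hold, and the parameters. A description no longer mentions `Z` and can be read over `points Z'` for
any other `Z'`.

The same game shows that a sentence has the same truth value in the structure described by `δ` over
`points Z` and over a finite truncation whose size is computed from `δ` and the sentence
(`fm_truncation_iff`). For finite `Z` this decides the full theory of the described structure. If
that structure satisfied the axioms of `U` and the laws of identity, its quotient
(`exists_structure_of_laws`) would be a model of `U` with a decidable theory, against essential
undecidability. So for every finite `Z` and every `δ` a search finds a failure: invalid parameters,
or an axiom or law that is false in a sufficiently large truncation (`exists_fails`).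

Now enumerate `X` as `x₀ < x₁ < ⋯`, with `xₖ₊₁` beyond the failures for all subsets of `{0, …, xₖ}`
and all descriptions numbered at most `xₖ`. If `W` interpreted `U`, take a standard model `Pt Z` of
`W`, the description `δ` of the interpretation and a large `k`. The failure found for `Z ∩ {0, …,
xₖ}` and `δ` concerns a truncation of size below `xₖ₊₁`, where `Z` has no further elements; so it is
a failure over `Z` itself, and a theorem of `U` is false in the interpreted structure
(`not_interprets`). The sequence is computed uniformly from the index of `U` (`exists_partrec_char`,
`exists_computable_curry`). -/

open FirstOrder FirstOrder.Language

noncomputable section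

namespace EssUndec

/-! ### Automation for primitive recursive functions -/

attribute [fun_prop] Primrec
attribute [fun_prop] Primrec.id Primrec.const Primrec.comp Primrec.fst Primrec.snd Primrec.pair

section PrimrecRules

variable {α β σ : Type*} [Primcodable α] [Primcodable β] [Primcodable σ]

-- The rules are stated for composed functions of one argument `a`, the shape in which `fun_prop`
-- applies them once the definitions are unfolded.
@[fun_prop] theorem primrec_add {f g : α → ℕ} (hf : Primrec f) (hg : Primrec g) :
    Primrec fun a => f a + g a := Primrec.nat_add.comp hf hg

@[fun_prop] theorem primrec_sub {f g : α → ℕ} (hf : Primrec f) (hg : Primrec g) :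
    Primrec fun a => f a - g a := Primrec.nat_sub.comp hf hg

@[fun_prop] theorem primrec_mul {f g : α → ℕ} (hf : Primrec f) (hg : Primrec g) :
    Primrec fun a => f a * g a := Primrec.nat_mul.comp hf hg

@[fun_prop] theorem primrec_div {f g : α → ℕ} (hf : Primrec f) (hg : Primrec g) :
    Primrec fun a => f a / g a := Primrec.nat_div.comp hf hg

@[fun_prop] theorem primrec_mod {f g : α → ℕ} (hf : Primrec f) (hg : Primrec g) :
    Primrec fun a => f a % g a := Primrec.nat_mod.comp hf hg

@[fun_prop] theorem primrec_pow {f g : α → ℕ} (hf : Primrec f) (hg : Primrec g) :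
    Primrec fun a => f a ^ g a :=
  (Primrec₂.unpaired'.1 Nat.Primrec.pow).comp hf hg

@[fun_prop] theorem primrec_pair {f g : α → ℕ} (hf : Primrec f) (hg : Primrec g) :
    Primrec fun a => Nat.pair (f a) (g a) := Primrec₂.natPair.comp hf hg

@[fun_prop] theorem primrec_unpair {f : α → ℕ} (hf : Primrec f) :
    Primrec fun a => Nat.unpair (f a) := Primrec.unpair.comp hf

@[fun_prop] theorem primrec_map {f : α → List β} {g : α → β → σ} (hf : Primrec f)
    (hg : Primrec fun q : α × β => g q.1 q.2) : Primrec fun a => (f a).map (g a) :=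
  Primrec.list_map hf hg

@[fun_prop] theorem primrec_flatMap {f : α → List β} {g : α → β → List σ} (hf : Primrec f)
    (hg : Primrec fun q : α × β => g q.1 q.2) : Primrec fun a => (f a).flatMap (g a) :=
  Primrec.list_flatMap hf hg

@[fun_prop] theorem primrec_foldr {f : α → List β} {g : α → β → σ → σ} {s : α → σ} (hf : Primrec f)
    (hs : Primrec s) (hg : Primrec fun q : α × (β × σ) => g q.1 q.2.1 q.2.2) :
    Primrec fun a => (f a).foldr (g a) (s a) :=
  Primrec.list_foldr (h := fun a (q : β × σ) => g a q.1 q.2) hf hs hg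

@[fun_prop] theorem primrec_range {f : α → ℕ} (hf : Primrec f) :
    Primrec fun a => List.range (f a) := Primrec.list_range.comp hf

@[fun_prop] theorem primrec_length {f : α → List β} (hf : Primrec f) :
    Primrec fun a => (f a).length := Primrec.list_length.comp hf

@[fun_prop] theorem primrec_append {f g : α → List β} (hf : Primrec f) (hg : Primrec g) :
    Primrec fun a => f a ++ g a := Primrec.list_append.comp hf hg

@[fun_prop] theorem primrec_cons {f : α → β} {g : α → List β} (hf : Primrec f) (hg : Primrec g) :
    Primrec fun a => f a :: g a := Primrec.list_cons.comp hf hg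

@[fun_prop] theorem primrec_getElem? {f : α → List β} {g : α → ℕ} (hf : Primrec f)
    (hg : Primrec g) : Primrec fun a => (f a)[g a]? := Primrec.list_getElem?.comp hf hg

@[fun_prop] theorem primrec_getD {f : α → Option β} {g : α → β} (hf : Primrec f)
    (hg : Primrec g) : Primrec fun a => (f a).getD (g a) := Primrec.option_getD.comp hf hg

@[fun_prop] theorem primrec_toList {f : α → Option β} (hf : Primrec f) :
    Primrec fun a => (f a).toList := Primrec.optionToList.comp hf

@[fun_prop] theorem primrec_some {f : α → β} (hf : Primrec f) :
    Primrec fun a => some (f a) := Primrec.option_some.comp hf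

@[fun_prop] theorem primrec_isSome {f : α → Option β} (hf : Primrec f) :
    Primrec fun a => (f a).isSome := Primrec.option_isSome.comp hf

@[fun_prop] theorem primrec_encode {f : α → β} (hf : Primrec f) :
    Primrec fun a => Encodable.encode (f a) := Primrec.encode.comp hf

@[fun_prop] theorem primrec_ofNat_list {f : α → ℕ} (hf : Primrec f) :
    Primrec fun a => Denumerable.ofNat (List ℕ) (f a) := (Primrec.ofNat _).comp hf

@[fun_prop] theorem primrec_decide_eq [DecidableEq β] {f g : α → β} (hf : Primrec f)
    (hg : Primrec g) : Primrec fun a => decide (f a = g a) := Primrec.eq.decide.comp hf hg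

@[fun_prop] theorem primrec_decide_lt {f g : α → ℕ} (hf : Primrec f)
    (hg : Primrec g) : Primrec fun a => decide (f a < g a) := Primrec.nat_lt.decide.comp hf hg

@[fun_prop] theorem primrec_decide_le {f g : α → ℕ} (hf : Primrec f)
    (hg : Primrec g) : Primrec fun a => decide (f a ≤ g a) := Primrec.nat_le.decide.comp hf hg

@[fun_prop] theorem primrec_not {f : α → Bool} (hf : Primrec f) :
    Primrec fun a => !f a := Primrec.not.comp hf

@[fun_prop] theorem primrec_and {f g : α → Bool} (hf : Primrec f) (hg : Primrec g) :
    Primrec fun a => f a && g a := Primrec.and.comp hf hg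

@[fun_prop] theorem primrec_or {f g : α → Bool} (hf : Primrec f) (hg : Primrec g) :
    Primrec fun a => f a || g a := Primrec.or.comp hf hg

@[fun_prop] theorem primrec_cond {c : α → Bool} {f g : α → β} (hc : Primrec c) (hf : Primrec f)
    (hg : Primrec g) : Primrec fun a => bif c a then f a else g a := Primrec.cond hc hf hg

@[fun_prop] theorem primrec_any {f : α → List β} {p : α → β → Bool} (hf : Primrec f)
    (hp : Primrec fun q : α × β => p q.1 q.2) : Primrec fun a => (f a).any (p a) :=
  (Primrec.list_foldr (h := fun a (q : β × Bool) => p a q.1 || q.2) hf (Primrec.const false)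
    (show Primrec fun q : α × (β × Bool) => p q.1 q.2.1 || q.2.2 from
      Primrec.or.comp (hp.comp (Primrec.fst.pair (Primrec.fst.comp Primrec.snd)))
        (Primrec.snd.comp Primrec.snd))).of_eq fun a => by
    induction f a <;> simp_all

@[fun_prop] theorem primrec_all {f : α → List β} {p : α → β → Bool} (hf : Primrec f)
    (hp : Primrec fun q : α × β => p q.1 q.2) : Primrec fun a => (f a).all (p a) :=
  (primrec_not (primrec_any hf (p := fun a b => !p a b) (primrec_not hp))).of_eq fun a => by
    simp [List.all_eq_not_any_not]

/-- Membership of a list, as a truth value. -/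
def inList {β : Type*} [DecidableEq β] (b : β) (l : List β) : Bool := l.any fun c => decide (c = b)

@[simp] theorem inList_iff {β : Type*} [DecidableEq β] {b : β} {l : List β} :
    inList b l = true ↔ b ∈ l := by
  simp [inList]

@[fun_prop] theorem primrec_inList [DecidableEq β] {f : α → β} {g : α → List β}
    (hf : Primrec f) (hg : Primrec g) : Primrec fun a => inList (f a) (g a) := by
  unfold inList
  fun_prop

@[fun_prop] theorem primrec_filter {f : α → List β} {p : α → β → Bool} (hf : Primrec f)
    (hp : Primrec fun q : α × β => p q.1 q.2) : Primrec fun a => (f a).filter (p a) :=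
  (primrec_flatMap hf (g := fun a b => bif p a b then [b] else [])
    (by fun_prop)).of_eq fun a => by
    induction f a with
    | nil => rfl
    | cons b l ih => cases h : p a b <;> simp_all

@[fun_prop] theorem primrec_sections {f : α → List (List β)} (hf : Primrec f) :
    Primrec fun a => (f a).sections :=
  (primrec_foldr hf (Primrec.const [([] : List β)])
    (g := fun _ l s => s.flatMap fun t => l.map fun b => b :: t) (by fun_prop)).of_eq fun a => by
    induction f a <;> simp_all [List.sections]

end PrimrecRules

/-! ### Course-of-values recursion -/

section CourseOfValues

variable {σ : Type*}

/-- The first `n` values of the function whose value at `k` is `g` of the list of its first `k`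
values. -/
def firstVals (g : List σ → σ) : ℕ → List σ
  | 0 => []
  | n + 1 => firstVals g n ++ [g (firstVals g n)]

/-- The function defined from `g` by course-of-values recursion. -/
def covRec (g : List σ → σ) (n : ℕ) : σ := g (firstVals g n)

@[simp] theorem length_firstVals (g : List σ → σ) (n : ℕ) : (firstVals g n).length = n := by
  induction n <;> simp_all [firstVals]

theorem getElem?_firstVals (g : List σ → σ) {n k : ℕ} (h : k < n) :
    (firstVals g n)[k]? = some (covRec g k) := by
  induction n with
  | zero => omega
  | succ n ih =>
    rw [firstVals]
    rcases Nat.lt_succ_iff_lt_or_eq.1 h with h | rfl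
    · rw [List.getElem?_append_left (by simpa), ih h]
    · rw [List.getElem?_append_right (by simp)]; simp [covRec]

-- The list of earlier values is itself obtained by plain primitive recursion, each step appending
-- one value.
@[fun_prop] theorem primrec_covRec {α : Type*} [Primcodable α] [Primcodable σ]
    {g : α → List σ → σ} {f : α → ℕ}
    (hg : Primrec fun q : α × List σ => g q.1 q.2) (hf : Primrec f) :
    Primrec fun a => covRec (g a) (f a) := by
  have h : Primrec fun a => firstVals (g a) (f a) :=
    (Primrec.nat_rec' (h := fun a (q : ℕ × List σ) => q.2 ++ [g a q.2]) hf (Primrec.const [])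
      (show Primrec fun q : α × (ℕ × List σ) => q.2.2 ++ [g q.1 q.2.2] by fun_prop)).of_eq
      fun a => by
        induction f a with
        | zero => rfl
        | succ n ih => simp only [firstVals, ← ih]
  unfold covRec
  fun_prop

end CourseOfValues

/-! ### Relational semantics of formulas -/

section RelationalSemantics

variable {E : Type} (Dom : E → Prop) (At : ℕ → List E → Prop) {S : Sig}

/-- `v` is a value of the term `t` at the assignment `x`, in the structure with domain `Dom` and
whose atomic relations are given by `At` (`At 1` is equality, `At (2 * i + 2)` the `i`-th relation,
`At (2 * i + 3)` the graph of the `i`-th function, with the value in front). -/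
def Tm {n : ℕ} : (lang S).Term (Empty ⊕ Fin n) → List E → E → Prop
  | .var (.inl e), _, _ => e.elim
  | .var (.inr i), x, v => x[(i : ℕ)]? = some v
  | .func (l := l) f ts, x, v => ∃ w : Fin l → E, (∀ i, Dom (w i)) ∧ (∀ i, Tm (ts i) x (w i)) ∧
      At (2 * f.1 + 3) (v :: List.ofFn w)

/-- The formula `φ` holds at the assignment `x`; see `Tm`. -/
def Fm : {n : ℕ} → (lang S).BoundedFormula Empty n → List E → Prop
  | _, .falsum, _ => False
  | _, .equal t u, x => ∃ v w, Dom v ∧ Dom w ∧ Tm Dom At t x v ∧ Tm Dom At u x w ∧ At 1 [v, w]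
  | _, .rel (l := l) R ts, x => ∃ w : Fin l → E, (∀ i, Dom (w i)) ∧
      (∀ i, Tm Dom At (ts i) x (w i)) ∧ At (2 * R.1 + 2) (List.ofFn w)
  | _, .imp φ ψ, x => Fm φ x → Fm ψ x
  | _, .all φ, x => ∀ u, Dom u → Fm φ (x ++ [u])

end RelationalSemantics

/-! ### Bounds for Gödel numbers -/

/-- This makes the Gödel numbers of arguments smaller than that of the compound expression, as
course-of-values recursion requires. -/
theorem lt_encode_of_mem {a : ℕ} {l : List ℕ} (h : a ∈ l) : a < Encodable.encode l := by
  induction l with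
  | nil => simp at h
  | cons b l ih =>
    rw [Encodable.encode_list_cons]
    rcases List.mem_cons.1 h with rfl | h
    · exact Nat.lt_succ_of_le (Nat.left_le_pair _ _)
    · exact (ih h).trans_le ((Nat.right_le_pair _ _).trans (Nat.le_succ _))

/-- Bounds arities by Gödel numbers, and so the number of rounds that a compound term or an atomic
formula costs in the game. -/
theorem length_le_encode (l : List ℕ) : l.length ≤ Encodable.encode l := by
  induction l with
  | nil => simp
  | cons b l ih =>
    rw [Encodable.encode_list_cons]
    exact Nat.succ_le_succ (ih.trans (Nat.right_le_pair _ _))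

/-! ### Structures described by finite tables -/

/-- The number of the class of an element. -/
def cls (x : ℕ) : ℕ := (Nat.unpair x).1

/-- The size of the class of an element; `0` stands for the sizes greater than `T`. -/
def clsSize (T x : ℕ) : ℕ :=
  bif decide (cls x % 2 = 1) && decide (cls x / 2 < T) then cls x / 2 + 1 else 0

/-- The isomorphism type of a list of elements, with the sizes of the classes up to `T`. -/
def pattern (T : ℕ) (l : List ℕ) : List (List (Bool × Bool) × ℕ) :=
  l.map fun x => (l.map fun y => (decide (x = y), decide (cls x = cls y)), clsSize T x)

/-- An element of an interpreted structure: the number of the piece and the coordinates. -/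
abbrev El : Type := ℕ × List ℕ

/-- What the truth of an atomic formula at a list of elements of an interpreted structure depends
on: the symbol, the pieces, and the isomorphism type of the parameters and the coordinates. -/
abbrev Key : Type := List ℕ × List (List (Bool × Bool) × ℕ)

/-- The description of an interpreted structure: a bound, the table of the true atomic formulas,
and the parameters. -/
abbrev Desc : Type := ℕ × List Key × List ℕ

/-- The parameters stand in front, so that the pattern also records how the coordinates relate to
them. Only the concatenation of the coordinates is recorded: for genuine tuples the pieces determine
where it is to be cut. -/
def key (T : ℕ) (p : List ℕ) (s : ℕ) (us : List El) : Key :=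
  (s :: us.map fun u => u.1, pattern T (p ++ us.flatMap fun u => u.2))

/-- The truth value of an atomic formula in the described structure. -/
def atom (δ : Desc) (s : ℕ) (us : List El) : Bool := inList (key δ.1 δ.2.2 s us) δ.2.1

section Computability

variable {α : Type*} [Primcodable α]

@[fun_prop] theorem primrec_cls {x : α → ℕ} (hx : Primrec x) : Primrec fun a => cls (x a) := by
  unfold cls
  fun_prop

@[fun_prop] theorem primrec_pattern {T : α → ℕ} {l : α → List ℕ} (hT : Primrec T)
    (hl : Primrec l) : Primrec fun a => pattern (T a) (l a) := by
  unfold pattern clsSize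
  fun_prop

@[fun_prop] theorem primrec_atom {δ : α → Desc} {s : α → ℕ} {us : α → List El} (hδ : Primrec δ)
    (hs : Primrec s) (hus : Primrec us) : Primrec fun a => atom (δ a) (s a) (us a) := by
  unfold atom key
  fun_prop

end Computability

/-! ### Evaluation of formulas, given by their Gödel numbers, over a finite domain -/

/-- The lists of length at most `K` with entries from `L`. -/
def assignments {E : Type} (L : List E) (K : ℕ) : List (List E) :=
  (List.range (K + 1)).flatMap fun j => ((List.range j).map fun _ => L).sections

theorem mem_sections_ofFn {n : ℕ} {E : Type} {f : Fin n → List E} {ws : List E} :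
    ws ∈ (List.ofFn f).sections ↔ ∃ w : Fin n → E, (∀ i, w i ∈ f i) ∧ ws = List.ofFn w := by
  rw [List.mem_sections, List.forall₂_iff_get]
  constructor
  · rintro ⟨h, h'⟩
    obtain rfl : ws.length = n := by simpa using h
    exact ⟨ws.get, fun i => by simpa using h' i i.2 (by simp), (List.ofFn_get ws).symm⟩
  · rintro ⟨w, hw, rfl⟩
    exact ⟨by simp, fun i hi hi' => by simpa using hw ⟨i, by simpa using hi⟩⟩

theorem mem_assignments {E : Type} {L : List E} {K : ℕ} {x : List E} :
    x ∈ assignments L K ↔ x.length ≤ K ∧ ∀ u ∈ x, u ∈ L := by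
  simp only [assignments, List.mem_flatMap, List.mem_range, List.mem_sections]
  constructor
  · rintro ⟨j, hj, h⟩
    have := h.length_eq
    refine ⟨by simp at this; omega, fun u hu => ?_⟩
    rw [List.forall₂_iff_get] at h
    obtain ⟨i, hi, rfl⟩ := List.getElem_of_mem hu
    simpa using h.2 i hi (by omega)
  · rintro ⟨h, h'⟩
    refine ⟨x.length, by omega, ?_⟩
    rw [List.forall₂_iff_get]
    exact ⟨by simp, fun i hi hi' => by simpa using h' _ (List.getElem_mem hi)⟩

section Evaluation

variable (L : List El) (δ : Desc)

/-- The values of a term at the assignment `x`, from the values of the terms with smaller Gödel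
numbers. -/
def termValsStep (x : List El) (IH : List (List El)) : List El :=
  bif decide (IH.length % 2 = 0) then (x[IH.length / 2]?).toList else
    L.filter fun v =>
      ((Denumerable.ofNat (List ℕ) (Nat.unpair (IH.length / 2)).2).map fun c =>
        (IH[c]?).getD []).sections.any fun ws =>
          atom δ (2 * (Nat.unpair (IH.length / 2)).1 + 3) (v :: ws)

/-- The values in `L` of the term with Gödel number `c` at the assignment `x`. -/
def termVals (x : List El) (c : ℕ) : List El := covRec (termValsStep L δ x) c

/-- The assignments of length at most `K` satisfying a formula, from those of the formulas with
smaller Gödel numbers. -/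
def satStep (K : ℕ) (IH : List (List (List El))) : List (List El) :=
  bif decide (IH.length = 0) then [] else
  bif decide ((IH.length - 1) % 4 = 0) then
    (assignments L K).filter fun x =>
      (termVals L δ x (Nat.unpair ((IH.length - 1) / 4)).1).any fun v =>
        (termVals L δ x (Nat.unpair ((IH.length - 1) / 4)).2).any fun w => atom δ 1 [v, w]
  else bif decide ((IH.length - 1) % 4 = 1) then
    (assignments L K).filter fun x =>
      ((Denumerable.ofNat (List ℕ) (Nat.unpair ((IH.length - 1) / 4)).2).map fun c =>
        termVals L δ x c).sections.any fun ws =>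
          atom δ (2 * (Nat.unpair ((IH.length - 1) / 4)).1 + 2) ws
  else bif decide ((IH.length - 1) % 4 = 2) then
    (assignments L K).filter fun x =>
      !(inList x ((IH[(Nat.unpair ((IH.length - 1) / 4)).1]?).getD [])) ||
        inList x ((IH[(Nat.unpair ((IH.length - 1) / 4)).2]?).getD [])
  else
    (assignments L K).filter fun x =>
      L.all fun u => inList (x ++ [u]) ((IH[(IH.length - 1) / 4]?).getD [])

/-- The assignments of length at most `K` that satisfy the formula with Gödel number `c`. -/
def sat (K c : ℕ) : List (List El) := covRec (satStep L δ K) c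

variable {S : Sig}

/-! ### Correctness of the evaluation -/

theorem termCode_lt {n l : ℕ} (f : (lang S).Functions l)
    (ts : Fin l → (lang S).Term (Empty ⊕ Fin n)) (i : Fin l) :
    termCode (ts i) < termCode (Term.func f ts) := by
  have h : termCode (ts i) ∈ List.ofFn fun i => termCode (ts i) := by simp [List.mem_ofFn]
  have := lt_encode_of_mem h
  have := Nat.right_le_pair f.1 (Encodable.encode (List.ofFn fun i => termCode (ts i)))
  rw [termCode]
  omega

/-- Arguments have smaller Gödel numbers, so their values are found in the list of earlier results.
The hypothesis on `x` is needed for variables, whose value is read off `x` without a test. -/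
theorem mem_termVals {n : ℕ} (t : (lang S).Term (Empty ⊕ Fin n)) {x : List El}
    (hx : ∀ u ∈ x, u ∈ L) {v : El} :
    v ∈ termVals L δ x (termCode t) ↔ v ∈ L ∧ Tm (· ∈ L) (fun s us => atom δ s us = true) t x v := by
  induction t generalizing v with
  | var y =>
    rcases y with ⟨⟨⟩⟩ | i
    simp only [termVals, covRec, termValsStep, length_firstVals, termCode, Tm]
    simp only [Nat.mul_mod_right, decide_true, cond_true, Nat.mul_div_right _ (Nat.zero_lt_two),
      Option.mem_toList, iff_and_self]
    exact fun h => hx _ (List.mem_of_getElem? h)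
  | @func l f ts ih =>
    have key : termVals L δ x (termCode (Term.func f ts)) = L.filter fun v =>
        (List.ofFn fun i => termVals L δ x (termCode (ts i))).sections.any fun ws =>
          atom δ (2 * f.1 + 3) (v :: ws) := by
      have hF : ∀ i, (firstVals (termValsStep L δ x) (termCode (Term.func f ts)))[termCode (ts i)]?
          = some (termVals L δ x (termCode (ts i))) :=
        fun i => getElem?_firstVals _ (termCode_lt f ts i)
      rw [termVals, covRec, termValsStep, length_firstVals]
      have h1 : termCode (Term.func f ts) % 2 = 1 := by rw [termCode]; omega
      have h2 : termCode (Term.func f ts) / 2 =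
          Nat.pair f.1 (Encodable.encode (List.ofFn fun i : Fin l => termCode (ts i))) := by
        rw [termCode]; omega
      simp only [h1, h2, Nat.unpair_pair, Denumerable.ofNat_encode, List.map_ofFn,
        Function.comp_def, hF]
      rfl
    simp only [key, List.mem_filter, List.any_eq_true, mem_sections_ofFn, Tm, ih]
    refine and_congr_right fun _ => ⟨?_, ?_⟩
    · rintro ⟨_, ⟨w, hw, rfl⟩, h⟩
      exact ⟨w, fun i => (hw i).1, fun i => (hw i).2, h⟩
    · rintro ⟨w, h, h', h''⟩
      exact ⟨_, ⟨w, fun i => ⟨h i, h' i⟩, rfl⟩, h''⟩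

theorem sat_eq (K c : ℕ) : sat L δ K c = satStep L δ K (firstVals (satStep L δ K) c) := rfl

theorem getD_firstVals_satStep {K c c' : ℕ} (h : c < c') :
    (firstVals (satStep L δ K) c')[c]?.getD [] = sat L δ K c := by
  rw [getElem?_firstVals _ h]; rfl

/-- The bound `n + formulaCode φ ≤ K` passes to subformulas: a quantifier lengthens the assignment
by one, but removing it lowers the Gödel number by more. -/
theorem mem_sat {n K : ℕ} (φ : (lang S).BoundedFormula Empty n) {x : List El}
    (hx : ∀ u ∈ x, u ∈ L) (hn : x.length = n) (hK : n + formulaCode φ ≤ K) :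
    x ∈ sat L δ K (formulaCode φ) ↔ Fm (· ∈ L) (fun s us => atom δ s us = true) φ x := by
  have hxK : x ∈ assignments L K := mem_assignments.2 ⟨by omega, hx⟩
  induction φ generalizing x with
  | falsum => simp [sat_eq, satStep, formulaCode, Fm]
  | equal t u =>
    have h1 : formulaCode (BoundedFormula.equal t u) - 1 = 4 * Nat.pair (termCode t) (termCode u) :=
      by rw [formulaCode]; omega
    have h0 : formulaCode (BoundedFormula.equal t u) ≠ 0 := by rw [formulaCode]; omega
    rw [sat_eq, satStep, length_firstVals, h1]
    simp only [h0, decide_false, cond_false, Nat.mul_mod_right, decide_true, cond_true,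
      Nat.mul_div_right _ (Nat.zero_lt_succ 3), Nat.unpair_pair, List.mem_filter, hxK, true_and,
      List.any_eq_true, mem_termVals L δ _ hx, Fm]
    constructor
    · rintro ⟨v, ⟨h1, h2⟩, w, ⟨h3, h4⟩, h⟩; exact ⟨v, w, h1, h3, h2, h4, h⟩
    · rintro ⟨v, w, h1, h3, h2, h4, h⟩; exact ⟨v, ⟨h1, h2⟩, w, ⟨h3, h4⟩, h⟩
  | @rel n l R ts =>
    have h1 : formulaCode (BoundedFormula.rel R ts) - 1 = 4 * Nat.pair R.1
        (Encodable.encode (List.ofFn fun i : Fin l => termCode (ts i))) + 1 := by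
      rw [formulaCode]; omega
    have h0 : formulaCode (BoundedFormula.rel R ts) ≠ 0 := by rw [formulaCode]; omega
    have h2 : ∀ m, (4 * m + 1) % 4 = 1 := by omega
    have h3 : ∀ m, (4 * m + 1) / 4 = m := by omega
    rw [sat_eq, satStep, length_firstVals, h1]
    simp only [h0, h2, h3, decide_false, cond_false, one_ne_zero, decide_true, cond_true,
      Nat.unpair_pair, Denumerable.ofNat_encode, List.map_ofFn, Function.comp_def,
      List.mem_filter, hxK, true_and, List.any_eq_true, mem_sections_ofFn,
      mem_termVals L δ _ hx, Fm]
    constructor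
    · rintro ⟨_, ⟨w, hw, rfl⟩, h⟩
      exact ⟨w, fun i => (hw i).1, fun i => (hw i).2, h⟩
    · rintro ⟨w, h, h', h''⟩
      exact ⟨_, ⟨w, fun i => ⟨h i, h' i⟩, rfl⟩, h''⟩
  | imp φ ψ ih₁ ih₂ =>
    have h1 : formulaCode (BoundedFormula.imp φ ψ) - 1 =
        4 * Nat.pair (formulaCode φ) (formulaCode ψ) + 2 := by rw [formulaCode]; omega
    have h0 : formulaCode (BoundedFormula.imp φ ψ) ≠ 0 := by rw [formulaCode]; omega
    have h2 : ∀ m, (4 * m + 2) % 4 = 2 := by omega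
    have h3 : ∀ m, (4 * m + 2) / 4 = m := by omega
    have hl := Nat.left_le_pair (formulaCode φ) (formulaCode ψ)
    have hr := Nat.right_le_pair (formulaCode φ) (formulaCode ψ)
    have e₁ := ih₁ hx hn (by omega) hxK
    have e₂ := ih₂ hx hn (by omega) hxK
    rw [sat_eq, satStep, length_firstVals, h1]
    simp only [h0, h2, h3, decide_false, cond_false, decide_true, cond_true,
      Nat.unpair_pair, List.mem_filter, hxK, true_and, Fm, Bool.or_eq_true, Bool.not_eq_true',
      ← Bool.not_eq_true, inList_iff, OfNat.ofNat_ne_zero, OfNat.ofNat_ne_one]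
    rw [getD_firstVals_satStep _ _ (by omega), getD_firstVals_satStep _ _ (by omega)]
    exact (or_congr (not_congr e₁) e₂).trans imp_iff_not_or.symm
  | @all n φ ih =>
    have h1 : formulaCode (BoundedFormula.all φ) - 1 = 4 * formulaCode φ + 3 := by
      rw [formulaCode]; omega
    have h0 : formulaCode (BoundedFormula.all φ) ≠ 0 := by rw [formulaCode]; omega
    have h2 : ∀ m, (4 * m + 3) % 4 = 3 := by omega
    have h3 : ∀ m, (4 * m + 3) / 4 = m := by omega
    rw [sat_eq, satStep, length_firstVals, h1]
    simp only [h0, h2, h3, decide_false, cond_false,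
      List.mem_filter, hxK, true_and, Fm, List.all_eq_true,
      inList_iff, OfNat.ofNat_ne_zero, OfNat.ofNat_ne_one, Nat.reduceEqDiff]
    rw [getD_firstVals_satStep _ _ (by omega)]
    refine forall₂_congr fun u hu => ?_
    have hx' : ∀ v ∈ x ++ [u], v ∈ L := by
      intro v hv
      rcases List.mem_append.1 hv with h | h
      · exact hx v h
      · rwa [List.mem_singleton.1 h]
    have hl : (x ++ [u]).length = n + 1 := by simp [hn]
    exact ih hx' hl (by omega) (mem_assignments.2 ⟨by omega, hx'⟩)

section Computability

variable {α : Type*} [Primcodable α] {L : α → List El} {δ : α → Desc}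

@[fun_prop] theorem primrec_termVals {x : α → List El} {c : α → ℕ} (hL : Primrec L)
    (hδ : Primrec δ) (hx : Primrec x) (hc : Primrec c) :
    Primrec fun a => termVals (L a) (δ a) (x a) (c a) := by
  unfold termVals termValsStep
  fun_prop

@[fun_prop] theorem primrec_assignments {E : Type} [Primcodable E] {L : α → List E} {K : α → ℕ}
    (hL : Primrec L) (hK : Primrec K) :
    Primrec fun a => assignments (L a) (K a) := by
  unfold assignments
  fun_prop

@[fun_prop] theorem primrec_sat {K c : α → ℕ} (hL : Primrec L) (hδ : Primrec δ) (hK : Primrec K)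
    (hc : Primrec c) : Primrec fun a => sat (L a) (δ a) (K a) (c a) := by
  unfold sat satStep
  fun_prop

end Computability

end Evaluation

/-! ### Recognition of Gödel numbers -/

section Recognition

variable (S : Sig)

def isTermStep (n : ℕ) (IH : List Bool) : Bool :=
  bif decide (IH.length % 2 = 0) then decide (IH.length / 2 < n) else
    decide (S.1[(Nat.unpair (IH.length / 2)).1]? =
      some (Denumerable.ofNat (List ℕ) (Nat.unpair (IH.length / 2)).2).length) &&
    (Denumerable.ofNat (List ℕ) (Nat.unpair (IH.length / 2)).2).all fun c => (IH[c]?).getD false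

/-- Whether `c` is the Gödel number of a term in `n` variables. -/
def isTerm (n c : ℕ) : Bool := covRec (isTermStep S n) c

/-- A Gödel number does not determine the number of free variables (`⊥` has number `0` for every
`n`), so all admissible values up to `K` are computed together. -/
def formulaAritiesStep (K : ℕ) (IH : List (List ℕ)) : List ℕ :=
  bif decide (IH.length = 0) then List.range (K + 1) else
  bif decide ((IH.length - 1) % 4 = 0) then
    (List.range (K + 1)).filter fun n => isTerm S n (Nat.unpair ((IH.length - 1) / 4)).1 &&
      isTerm S n (Nat.unpair ((IH.length - 1) / 4)).2
  else bif decide ((IH.length - 1) % 4 = 1) then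
    (List.range (K + 1)).filter fun n =>
      decide (S.2[(Nat.unpair ((IH.length - 1) / 4)).1]? =
        some (Denumerable.ofNat (List ℕ) (Nat.unpair ((IH.length - 1) / 4)).2).length) &&
      (Denumerable.ofNat (List ℕ) (Nat.unpair ((IH.length - 1) / 4)).2).all fun c => isTerm S n c
  else bif decide ((IH.length - 1) % 4 = 2) then
    (List.range (K + 1)).filter fun n =>
      inList n ((IH[(Nat.unpair ((IH.length - 1) / 4)).1]?).getD []) &&
        inList n ((IH[(Nat.unpair ((IH.length - 1) / 4)).2]?).getD [])
  else
    (List.range (K + 1)).filter fun n => inList (n + 1) ((IH[(IH.length - 1) / 4]?).getD [])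

/-- The numbers `n ≤ K` such that `c` is the Gödel number of a formula in `n` free variables. -/
def formulaArities (K c : ℕ) : List ℕ := covRec (formulaAritiesStep S K) c

/-- Whether `c` is the Gödel number of a sentence. -/
def isSentence (c : ℕ) : Bool := inList 0 (formulaArities S c c)

variable {S}

/-! ### Correctness of the recognition of Gödel numbers -/

theorem isTerm_termCode {n : ℕ} (t : (lang S).Term (Empty ⊕ Fin n)) :
    isTerm S n (termCode t) = true := by
  induction t with
  | var y =>
    rcases y with ⟨⟨⟩⟩ | i
    simp [isTerm, covRec, isTermStep, termCode]
  | @func l f ts ih =>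
    have hF : ∀ i, (firstVals (isTermStep S n) (termCode (Term.func f ts)))[termCode (ts i)]?
        = some (isTerm S n (termCode (ts i))) :=
      fun i => getElem?_firstVals _ (termCode_lt f ts i)
    rw [isTerm, covRec, isTermStep, length_firstVals]
    have h1 : termCode (Term.func f ts) % 2 = 1 := by rw [termCode]; omega
    have h2 : termCode (Term.func f ts) / 2 =
        Nat.pair f.1 (Encodable.encode (List.ofFn fun i : Fin l => termCode (ts i))) := by
      rw [termCode]; omega
    have hf := f.2
    simp only [List.get_eq_getElem] at hf
    simp only [h1, h2, Nat.unpair_pair, Denumerable.ofNat_encode]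
    simp [List.mem_ofFn, hF, ih, hf]

theorem exists_term_of_isTerm {n c : ℕ} (h : isTerm S n c = true) :
    ∃ t : (lang S).Term (Empty ⊕ Fin n), termCode t = c := by
  induction c using Nat.strong_induction_on with
  | _ c ih =>
    rw [isTerm, covRec, isTermStep, length_firstVals] at h
    rcases Nat.mod_two_eq_zero_or_one c with h0 | h1
    · simp only [h0, decide_true, cond_true, decide_eq_true_eq] at h
      exact ⟨.var (.inr ⟨c / 2, h⟩), by simp only [termCode]; omega⟩
    · simp only [h1, one_ne_zero, decide_false, cond_false, Bool.and_eq_true, decide_eq_true_eq,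
        List.all_eq_true] at h
      obtain ⟨h2, h3⟩ := h
      obtain ⟨hi, h4⟩ := List.getElem?_eq_some_iff.1 h2
      set cs := Denumerable.ofNat (List ℕ) (Nat.unpair (c / 2)).2 with hcs
      have hlt : ∀ a ∈ cs, a < c := fun a ha => by
        have h5 := lt_encode_of_mem ha
        rw [hcs, Denumerable.encode_ofNat] at h5
        have := Nat.unpair_right_le (c / 2)
        omega
      have h6 : ∀ i : Fin cs.length, ∃ t : (lang S).Term (Empty ⊕ Fin n),
          termCode t = cs[i] := fun i => by
        refine ih _ (hlt _ (List.getElem_mem i.2)) ?_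
        have := h3 _ (List.getElem_mem i.2)
        rw [getElem?_firstVals _ (hlt _ (List.getElem_mem i.2))] at this
        exact this
      choose ts hts using h6
      refine ⟨.func (l := cs.length) ⟨⟨_, hi⟩, h4⟩ ts, ?_⟩
      change 2 * Nat.pair (Nat.unpair (c / 2)).1
        (Encodable.encode (List.ofFn fun i : Fin cs.length => termCode (ts i))) + 1 = c
      simp only [hts]
      have h7 : (List.ofFn fun i : Fin cs.length => cs[i]) = cs := List.ofFn_getElem
      rw [h7, hcs, Denumerable.encode_ofNat, Nat.pair_unpair]
      omega

theorem formulaArities_eq (K c : ℕ) : formulaArities S K c =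
    formulaAritiesStep S K (firstVals (formulaAritiesStep S K) c) := rfl

theorem getD_firstVals_formulaAritiesStep {K c c' : ℕ} (h : c < c') :
    (firstVals (formulaAritiesStep S K) c')[c]?.getD [] = formulaArities S K c := by
  rw [getElem?_firstVals _ h]; rfl

theorem mem_formulaArities {n K : ℕ} (φ : (lang S).BoundedFormula Empty n)
    (hK : n + formulaCode φ ≤ K) : n ∈ formulaArities S K (formulaCode φ) := by
  have hn : n < K + 1 := by omega
  induction φ with
  | falsum => simp [formulaArities_eq, formulaAritiesStep, formulaCode, hn]
  | equal t u =>
    have h1 : formulaCode (BoundedFormula.equal t u) - 1 = 4 * Nat.pair (termCode t) (termCode u) :=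
      by rw [formulaCode]; omega
    have h0 : formulaCode (BoundedFormula.equal t u) ≠ 0 := by rw [formulaCode]; omega
    rw [formulaArities_eq, formulaAritiesStep, length_firstVals, h1]
    simp [h0, hn, isTerm_termCode]
  | @rel n l R ts =>
    have h1 : formulaCode (BoundedFormula.rel R ts) - 1 = 4 * Nat.pair R.1
        (Encodable.encode (List.ofFn fun i : Fin l => termCode (ts i))) + 1 := by
      rw [formulaCode]; omega
    have h0 : formulaCode (BoundedFormula.rel R ts) ≠ 0 := by rw [formulaCode]; omega
    have h2 : ∀ m, (4 * m + 1) % 4 = 1 := by omega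
    have h3 : ∀ m, (4 * m + 1) / 4 = m := by omega
    have hR := R.2
    simp only [List.get_eq_getElem] at hR
    rw [formulaArities_eq, formulaAritiesStep, length_firstVals, h1]
    simp [h0, h2, h3, hn, isTerm_termCode, hR, List.mem_ofFn]
  | imp φ ψ ih₁ ih₂ =>
    have h1 : formulaCode (BoundedFormula.imp φ ψ) - 1 =
        4 * Nat.pair (formulaCode φ) (formulaCode ψ) + 2 := by rw [formulaCode]; omega
    have h0 : formulaCode (BoundedFormula.imp φ ψ) ≠ 0 := by rw [formulaCode]; omega
    have h2 : ∀ m, (4 * m + 2) % 4 = 2 := by omega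
    have h3 : ∀ m, (4 * m + 2) / 4 = m := by omega
    have hl := Nat.left_le_pair (formulaCode φ) (formulaCode ψ)
    have hr := Nat.right_le_pair (formulaCode φ) (formulaCode ψ)
    rw [formulaArities_eq, formulaAritiesStep, length_firstVals, h1]
    simp only [h2, h3, Nat.unpair_pair]
    rw [getD_firstVals_formulaAritiesStep (by omega), getD_firstVals_formulaAritiesStep (by omega)]
    simp [h0, hn, ih₁ (by omega) hn, ih₂ (by omega) hn]
  | @all n φ ih =>
    have h1 : formulaCode (BoundedFormula.all φ) - 1 = 4 * formulaCode φ + 3 := by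
      rw [formulaCode]; omega
    have h0 : formulaCode (BoundedFormula.all φ) ≠ 0 := by rw [formulaCode]; omega
    have h2 : ∀ m, (4 * m + 3) % 4 = 3 := by omega
    have h3 : ∀ m, (4 * m + 3) / 4 = m := by omega
    rw [formulaArities_eq, formulaAritiesStep, length_firstVals, h1]
    simp only [h2, h3]
    have h4 : formulaCode (BoundedFormula.all φ) = 4 * formulaCode φ + 4 := by rw [formulaCode]
    rw [getD_firstVals_formulaAritiesStep (c := formulaCode φ) (by omega)]
    simp [h0, hn, ih (by omega) (by omega)]

theorem exists_formula_of_mem_formulaArities {n K c : ℕ} (h : n ∈ formulaArities S K c) :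
    ∃ φ : (lang S).BoundedFormula Empty n, formulaCode φ = c := by
  induction c using Nat.strong_induction_on generalizing n with
  | _ c ih =>
    rcases Nat.eq_zero_or_pos c with rfl | hc
    · exact ⟨.falsum, rfl⟩
    rw [formulaArities_eq, formulaAritiesStep, length_firstVals] at h
    have hl := Nat.unpair_left_le ((c - 1) / 4)
    have hr := Nat.unpair_right_le ((c - 1) / 4)
    have h4 : (c - 1) % 4 < 4 := Nat.mod_lt _ (by norm_num)
    have hp := Nat.pair_unpair ((c - 1) / 4)
    rw [getD_firstVals_formulaAritiesStep (by omega), getD_firstVals_formulaAritiesStep (by omega),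
      getD_firstVals_formulaAritiesStep (by omega)] at h
    interval_cases h5 : (c - 1) % 4
    · simp only [hc.ne', decide_false, cond_false, decide_true, cond_true, List.mem_filter,
        Bool.and_eq_true] at h
      obtain ⟨t, ht⟩ := exists_term_of_isTerm h.2.1
      obtain ⟨u, hu⟩ := exists_term_of_isTerm h.2.2
      exact ⟨.equal t u, by rw [formulaCode, ht, hu, hp]; omega⟩
    · simp only [hc.ne', decide_false, cond_false, decide_true, cond_true, List.mem_filter,
        Bool.and_eq_true, one_ne_zero, decide_eq_true_eq, List.all_eq_true] at h
      obtain ⟨_, h2, h3⟩ := h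
      obtain ⟨hi, h4⟩ := List.getElem?_eq_some_iff.1 h2
      set cs := Denumerable.ofNat (List ℕ) (Nat.unpair ((c - 1) / 4)).2 with hcs
      have h6 : ∀ i : Fin cs.length, ∃ t : (lang S).Term (Empty ⊕ Fin n),
          termCode t = cs[i] := fun i => exists_term_of_isTerm (h3 _ (List.getElem_mem i.2))
      choose ts hts using h6
      refine ⟨.rel (l := cs.length) ⟨⟨_, hi⟩, h4⟩ ts, ?_⟩
      change 4 * Nat.pair (Nat.unpair ((c - 1) / 4)).1
        (Encodable.encode (List.ofFn fun i : Fin cs.length => termCode (ts i))) + 2 = c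
      simp only [hts]
      have h7 : (List.ofFn fun i : Fin cs.length => cs[i]) = cs := List.ofFn_getElem
      rw [h7, hcs, Denumerable.encode_ofNat, Nat.pair_unpair]
      omega
    · simp only [hc.ne', decide_false, cond_false, decide_true, cond_true, List.mem_filter,
        Bool.and_eq_true, OfNat.ofNat_ne_zero, OfNat.ofNat_ne_one, inList_iff] at h
      obtain ⟨φ, hφ⟩ := ih _ (by omega) h.2.1
      obtain ⟨ψ, hψ⟩ := ih _ (by omega) h.2.2
      exact ⟨.imp φ ψ, by rw [formulaCode, hφ, hψ, hp]; omega⟩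
    · simp only [hc.ne', decide_false, cond_false, List.mem_filter,
        OfNat.ofNat_ne_zero, OfNat.ofNat_ne_one, inList_iff, Nat.reduceEqDiff] at h
      obtain ⟨φ, hφ⟩ := ih _ (by omega) h.2
      exact ⟨.all φ, by rw [formulaCode, hφ]; omega⟩

theorem isSentence_iff {c : ℕ} :
    isSentence S c = true ↔ ∃ φ : (lang S).Sentence, formulaCode φ = c := by
  rw [isSentence, inList_iff]
  refine ⟨exists_formula_of_mem_formulaArities, ?_⟩
  rintro ⟨φ, rfl⟩
  exact mem_formulaArities φ (by omega)

section Computability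

variable {α : Type*} [Primcodable α] {S : α → Sig}

@[fun_prop] theorem primrec_isTerm {n c : α → ℕ} (hS : Primrec S) (hn : Primrec n)
    (hc : Primrec c) : Primrec fun a => isTerm (S a) (n a) (c a) := by
  unfold isTerm isTermStep
  fun_prop

@[fun_prop] theorem primrec_isSentence {c : α → ℕ} (hS : Primrec S) (hc : Primrec c) :
    Primrec fun a => isSentence (S a) (c a) := by
  unfold isSentence formulaArities formulaAritiesStep
  fun_prop

end Computability

end Recognition

/-! ### Back and forth between equivalence relations -/

/-- The number of an element within its class. -/
def idx (x : ℕ) : ℕ := (Nat.unpair x).2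

@[simp] theorem cls_pair (c i : ℕ) : cls (Nat.pair c i) = c := by simp [cls]

@[simp] theorem idx_pair (c i : ℕ) : idx (Nat.pair c i) = i := by simp [idx]

theorem eq_of_cls_of_idx {x y : ℕ} (h : cls x = cls y) (h' : idx x = idx y) : x = y := by
  rw [← Nat.pair_unpair x, ← Nat.pair_unpair y]
  exact congrArg₂ _ h h'

/-- The universe of the equivalence relation with infinitely many infinite classes and, for each
`s ∈ Z`, one class with `s + 1` elements; its classes are the fibres of `cls`. -/
def points (Z : Set ℕ) : Set ℕ :=
  {x | cls x % 2 = 0 ∨ (cls x / 2 ∈ Z ∧ idx x ≤ cls x / 2)}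

/-- The part of the universe with `T` elements of `T` infinite classes, and the classes with at most
`T` elements. -/
def truncation (Z : Set ℕ) (T : ℕ) : Set ℕ := {x | x ∈ points Z ∧ cls x < 2 * T ∧ idx x < T}

/-- `V` is large enough to play at most `T` rounds. -/
structure IsRich (Z : Set ℕ) (T : ℕ) (V : Set ℕ) : Prop where
  sub : ∀ {x}, x ∈ V → x ∈ points Z
  mem : ∀ {x}, x ∈ truncation Z T → x ∈ V
  mem_of_cls : ∀ {x y}, y ∈ V → x ∈ points Z → cls x = cls y → idx x < T → x ∈ V

theorem isRich_points (Z : Set ℕ) (T : ℕ) : IsRich Z T (points Z) :=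
  ⟨id, fun h => h.1, fun _ h _ _ => h⟩

theorem isRich_truncation (Z : Set ℕ) (T : ℕ) : IsRich Z T (truncation Z T) :=
  ⟨fun h => h.1, id, fun h h' e hi => ⟨h', e ▸ h.2.1, hi⟩⟩

/-- `m` is the graph of a partial isomorphism, for class sizes up to `T`. -/
def IsPartialIso (T : ℕ) (m : List (ℕ × ℕ)) : Prop :=
  ∀ q ∈ m, clsSize T q.1 = clsSize T q.2 ∧
    ∀ r ∈ m, (q.1 = r.1 ↔ q.2 = r.2) ∧ (cls q.1 = cls r.1 ↔ cls q.2 = cls r.2)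

theorem IsPartialIso.swap {T : ℕ} {m : List (ℕ × ℕ)} (h : IsPartialIso T m) :
    IsPartialIso T (m.map Prod.swap) := by
  intro q hq
  obtain ⟨q', hq', rfl⟩ := List.mem_map.1 hq
  refine ⟨(h q' hq').1.symm, fun r hr => ?_⟩
  obtain ⟨r', hr', rfl⟩ := List.mem_map.1 hr
  exact ⟨((h q' hq').2 r' hr').1.symm, ((h q' hq').2 r' hr').2.symm⟩

theorem IsPartialIso.cons {T : ℕ} {m : List (ℕ × ℕ)} (h : IsPartialIso T m) {x x' : ℕ}
    (hs : clsSize T x = clsSize T x')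
    (hx : ∀ r ∈ m, (x = r.1 ↔ x' = r.2) ∧ (cls x = cls r.1 ↔ cls x' = cls r.2)) :
    IsPartialIso T ((x, x') :: m) := by
  intro q hq
  rcases List.mem_cons.1 hq with rfl | hq
  · refine ⟨hs, fun r hr => ?_⟩
    rcases List.mem_cons.1 hr with rfl | hr
    · simp
    · exact hx r hr
  · refine ⟨(h q hq).1, fun r hr => ?_⟩
    rcases List.mem_cons.1 hr with rfl | hr
    · have := hx q hq
      simp only [eq_comm] at this ⊢
      exact this
    · exact (h q hq).2 r hr

theorem isPartialIso_diag (T : ℕ) (p : List ℕ) : IsPartialIso T (p.map fun x => (x, x)) := by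
  intro q hq
  obtain ⟨q, hq, rfl⟩ := List.mem_map.1 hq
  refine ⟨rfl, fun r hr => ?_⟩
  obtain ⟨r, hr, rfl⟩ := List.mem_map.1 hr
  simp

/-- Even class numbers belong to infinite classes, and `2 * s + 1` to the class of size `s + 1`. The
value `0` merges the infinite classes with the finite ones of more than `T` elements, which `T`
rounds cannot tell apart. -/
theorem clsSize_eq_zero {T x : ℕ} : clsSize T x = 0 ↔ cls x % 2 = 0 ∨ T ≤ cls x / 2 := by
  rw [clsSize]
  by_cases h : cls x % 2 = 1 <;> by_cases h' : cls x / 2 < T <;> simp [h, h'] <;> omega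

theorem clsSize_eq_succ {T x s : ℕ} : clsSize T x = s + 1 ↔ cls x = 2 * s + 1 ∧ s < T := by
  rw [clsSize]
  by_cases h : cls x % 2 = 1 <;> by_cases h' : cls x / 2 < T <;> simp [h, h'] <;> omega

theorem clsSize_congr {T x y : ℕ} (h : cls x = cls y) : clsSize T x = clsSize T y := by
  rw [clsSize, clsSize, h]

theorem exists_lt_notMem {T : ℕ} {l : List ℕ} (h : l.length < T) (f : ℕ → ℕ)
    (hf : Function.Injective f) : ∃ i < T, f i ∉ l := by
  have h' : l.toFinset.card < ((Finset.range T).image f).card := by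
    rw [Finset.card_image_of_injective _ hf, Finset.card_range]
    exact (List.toFinset_card_le l).trans_lt h
  obtain ⟨y, hy, hy'⟩ := Finset.exists_mem_notMem_of_card_lt_card h'
  obtain ⟨i, hi, rfl⟩ := Finset.mem_image.1 hy
  exact ⟨i, Finset.mem_range.1 hi, by simpa using hy'⟩

/-- The back-and-forth step. An element already played is answered by its partner, and a new element
of a class already met by an unused element of the partner class. For a new class, a large one is
answered by an unused infinite class, a small one by itself, because `V'` contains all classes of
size at most `T`. -/
theorem IsPartialIso.extend {Z : Set ℕ} {T : ℕ} {V V' : Set ℕ} (hV : IsRich Z T V)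
    (hV' : IsRich Z T V') {m : List (ℕ × ℕ)} (h : IsPartialIso T m)
    (hm : ∀ q ∈ m, q.1 ∈ V ∧ q.2 ∈ V') (hT : m.length < T) {x : ℕ} (hx : x ∈ V) :
    ∃ x' ∈ V', IsPartialIso T ((x, x') :: m) := by
  by_cases h1 : ∃ q ∈ m, q.1 = x
  · obtain ⟨q, hq, rfl⟩ := h1
    exact ⟨q.2, (hm q hq).2, h.cons (h q hq).1 (h q hq).2⟩
  by_cases h2 : ∃ q ∈ m, cls q.1 = cls x
  · obtain ⟨q, hq, hqx⟩ := h2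
    suffices ∃ x' ∈ V', cls x' = cls q.2 ∧ ∀ r ∈ m, r.2 ≠ x' by
      obtain ⟨x', hx', hc, hne⟩ := this
      refine ⟨x', hx', h.cons ?_ fun r hr => ⟨?_, ?_⟩⟩
      · rw [clsSize_congr hc, clsSize_congr hqx.symm, (h q hq).1]
      · exact ⟨fun e => (h1 ⟨r, hr, e.symm⟩).elim, fun e => (hne r hr e.symm).elim⟩
      · rw [hc, ← hqx]
        exact ((h q hq).2 r hr).2
    have hqs : clsSize T q.2 = clsSize T x := by rw [← (h q hq).1, clsSize_congr hqx]
    -- A large partner class has at least `T` elements with index below `T`, more than the number of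
    -- moves so far.
    rcases hs : clsSize T x with _ | s
    · obtain ⟨i, hi, hne⟩ := exists_lt_notMem (l := m.map Prod.snd) (by simpa using hT)
        (Nat.pair (cls q.2)) fun i j e => (Nat.pair_eq_pair.1 e).2
      have hu : Nat.pair (cls q.2) i ∈ points Z := by
        rw [hs, clsSize_eq_zero] at hqs
        rcases hqs with hqs | hqs
        · left; simpa using hqs
        · rcases hV'.sub (hm q hq).2 with h3 | h3
          · left; simpa using h3
          · right; simpa using ⟨h3.1, by omega⟩
      refine ⟨_, hV'.mem_of_cls (hm q hq).2 hu (by simp) (by simpa), by simp, fun r hr e => ?_⟩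
      exact hne (e ▸ List.mem_map_of_mem hr)
    · have hsx := clsSize_eq_succ.1 hs
      have hsq := clsSize_eq_succ.1 (hqs.trans hs)
      have hmem : ∀ {y}, y ∈ points Z → cls y = 2 * s + 1 → s ∈ Z ∧ idx y ≤ s := by
        intro y hy hc
        rcases hy with hy | hy
        · omega
        · rw [hc, show (2 * s + 1) / 2 = s by omega] at hy
          exact hy
      have hsZ := (hmem (hV.sub hx) hsx.1).1
      -- If the whole partner class of size `s + 1` has been played, the `s + 1` partners of its
      -- elements fill the class of `x`, by counting indices; then `x` itself has been played.
      by_contra hcon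
      have hall : ∀ i : Fin (s + 1), ∃ r ∈ m, r.2 = Nat.pair (cls q.2) i := by
        intro i
        by_contra hi
        push Not at hi
        refine hcon ⟨_, hV'.mem ⟨?_, ?_, ?_⟩, ?_, hi⟩
        · right
          rw [cls_pair, idx_pair, hsq.1, show (2 * s + 1) / 2 = s by omega]
          exact ⟨hsZ, by omega⟩
        · simp; omega
        · simp; omega
        · simp
      choose r hr hr' using hall
      have hc : ∀ i, cls (r i).1 = 2 * s + 1 := fun i => by
        rw [((h _ (hr i)).2 q hq).2.2 (by rw [hr']; simp), hqx, hsx.1]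
      have hlt : ∀ i, idx (r i).1 < s + 1 := fun i =>
        Nat.lt_succ_of_le (hmem (hV.sub (hm _ (hr i)).1) (hc i)).2
      have hinj : Function.Injective fun i => (⟨idx (r i).1, hlt i⟩ : Fin (s + 1)) := by
        intro i j e
        have e1 := ((h _ (hr i)).2 _ (hr j)).1.1
          (eq_of_cls_of_idx ((hc i).trans (hc j).symm) (Fin.mk.inj e))
        rw [hr', hr'] at e1
        exact Fin.ext (Nat.pair_eq_pair.1 e1).2
      obtain ⟨i, hi⟩ := Finite.injective_iff_surjective.1 hinj
        ⟨idx x, Nat.lt_succ_of_le (hmem (hV.sub hx) hsx.1).2⟩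
      exact h1 ⟨r i, hr i, eq_of_cls_of_idx ((hc i).trans hsx.1.symm) (Fin.mk.inj hi)⟩
  · push Not at h1 h2
    suffices ∃ x' ∈ V', clsSize T x = clsSize T x' ∧ ∀ r ∈ m, cls r.2 ≠ cls x' by
      obtain ⟨x', hx', hs, hne⟩ := this
      refine ⟨x', hx', h.cons hs fun r hr => ⟨?_, ?_⟩⟩
      · exact ⟨fun e => (h1 r hr e.symm).elim, fun e => (hne r hr (e ▸ rfl)).elim⟩
      · exact ⟨fun e => (h2 r hr e.symm).elim, fun e => (hne r hr e.symm).elim⟩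
    rcases hs : clsSize T x with _ | s
    · obtain ⟨j, hj, hne⟩ := exists_lt_notMem (l := m.map fun q => cls q.2) (by simpa using hT)
        (fun j => 2 * j) fun i j e => by simpa using e
      refine ⟨Nat.pair (2 * j) 0, hV'.mem ⟨Or.inl (by simp), by simpa, by simp; omega⟩, ?_, ?_⟩
      · rw [eq_comm, clsSize_eq_zero]; simp
      · intro r hr e
        rw [cls_pair] at e
        exact hne (e ▸ List.mem_map_of_mem (f := fun q : ℕ × ℕ => cls q.2) hr)
    · have hsx := clsSize_eq_succ.1 hs
      -- There is only one class of size `s + 1`; if it had been met on the right, its partner on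
      -- the left would be the class of `x`.
      refine ⟨x, hV'.mem ⟨hV.sub hx, by omega, ?_⟩, hs.symm, fun r hr e => ?_⟩
      · rcases hV.sub hx with h3 | h3 <;> omega
      · have := (h r hr).1
        rw [clsSize_congr e, hs, clsSize_eq_succ] at this
        exact h2 r hr (this.1.trans hsx.1.symm)

/-- Related lists have the same isomorphism type. -/
theorem IsPartialIso.pattern_eq {T d : ℕ} {m : List (ℕ × ℕ)} (h : IsPartialIso T m) (hd : d ≤ T)
    {l l' : List ℕ} (hl : List.Forall₂ (fun a b => (a, b) ∈ m) l l') :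
    pattern d l = pattern d l' := by
  have hs : ∀ a b, (a, b) ∈ m → clsSize d a = clsSize d b := by
    intro a b hab
    have := (h _ hab).1
    rcases hs : clsSize T b with _ | s
    · simp only [hs] at this
      rw [clsSize_eq_zero] at this hs
      rw [clsSize_eq_zero.2 (by omega), clsSize_eq_zero.2 (by omega)]
    · simp only [hs] at this
      exact clsSize_congr ((clsSize_eq_succ.1 this).1.trans (clsSize_eq_succ.1 hs).1.symm)
  have gen : ∀ {γ : Type} (f g : ℕ → γ) {k k' : List ℕ},
      List.Forall₂ (fun a b => (a, b) ∈ m) k k' → (∀ a b, (a, b) ∈ m → f a = g b) →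
      k.map f = k'.map g := by
    intro γ f g k k' hk hfg
    induction hk with
    | nil => rfl
    | cons h _ ih => simp [hfg _ _ h, ih]
  refine gen _ _ hl fun a b hab => ?_
  rw [hs a b hab, gen _ _ hl fun a' b' hab' => ?_]
  rw [decide_eq_decide.2 ((h _ hab).2 _ hab').1, decide_eq_decide.2 ((h _ hab).2 _ hab').2]

/-- Lists of the same isomorphism type are related by a partial isomorphism. -/
theorem isPartialIso_zip {T : ℕ} {l l' : List ℕ} (h : pattern T l = pattern T l') :
    l.length = l'.length ∧ IsPartialIso T (l.zip l') := by
  have hlen : l.length = l'.length := by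
    have := congrArg List.length h
    simpa [pattern] using this
  have key : ∀ i (hi : i < l.length) (hi' : i < l'.length), clsSize T l[i] = clsSize T l'[i] ∧
      ∀ j (hj : j < l.length) (hj' : j < l'.length), (l[i] = l[j] ↔ l'[i] = l'[j]) ∧
        (cls l[i] = cls l[j] ↔ cls l'[i] = cls l'[j]) := by
    intro i hi hi'
    have h1 : (pattern T l)[i]? = (pattern T l')[i]? := by rw [h]
    simp only [pattern, List.getElem?_map, List.getElem?_eq_getElem hi,
      List.getElem?_eq_getElem hi', Option.map_some, Option.some.injEq, Prod.mk.injEq] at h1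
    refine ⟨h1.2, fun j hj hj' => ?_⟩
    have h2 := congrArg (fun k => k[j]?) h1.1
    simp only [List.getElem?_map, List.getElem?_eq_getElem hj,
      List.getElem?_eq_getElem hj', Option.map_some, Option.some.injEq, Prod.mk.injEq,
      decide_eq_decide] at h2
    exact h2
  refine ⟨hlen, fun q hq => ?_⟩
  obtain ⟨i, hi, rfl⟩ := List.getElem_of_mem hq
  rw [List.length_zip] at hi
  simp only [List.getElem_zip]
  refine ⟨(key i (by omega) (by omega)).1, fun r hr => ?_⟩
  obtain ⟨j, hj, rfl⟩ := List.getElem_of_mem hr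
  rw [List.length_zip] at hj
  simp only [List.getElem_zip]
  exact (key i (by omega) (by omega)).2 j (by omega) (by omega)

/-! ### Transfer of formulas between described structures -/

/-- The domain of the structure described by `δ` over the universe `V`. -/
def InDom (δ : Desc) (V : Set ℕ) (u : El) : Prop :=
  u.1 ≤ δ.1 ∧ u.2.length ≤ δ.1 ∧ (∀ x ∈ u.2, x ∈ V) ∧ atom δ 0 [u] = true

/-- `u` and `u'` correspond to each other under `m`. -/
def ElRel (m : List (ℕ × ℕ)) (u u' : El) : Prop :=
  u.1 = u'.1 ∧ List.Forall₂ (fun a b => (a, b) ∈ m) u.2 u'.2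

theorem ElRel.mono {m m' : List (ℕ × ℕ)} (h : m ⊆ m') {u u' : El} (hu : ElRel m u u') :
    ElRel m' u u' := ⟨hu.1, hu.2.imp fun _ _ h' => h h'⟩

theorem forall₂_swap {m : List (ℕ × ℕ)} {l l' : List ℕ}
    (h : List.Forall₂ (fun a b => (a, b) ∈ m) l l') :
    List.Forall₂ (fun a b => (a, b) ∈ m.map Prod.swap) l' l := by
  induction h with
  | nil => exact .nil
  | cons h _ ih => exact .cons (List.mem_map.2 ⟨_, h, rfl⟩) ih

theorem ElRel.swap {m : List (ℕ × ℕ)} {u u' : El} (hu : ElRel m u u') :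
    ElRel (m.map Prod.swap) u' u := ⟨hu.1.symm, forall₂_swap hu.2⟩

theorem env_swap {m : List (ℕ × ℕ)} {x x' : List El} (h : List.Forall₂ (ElRel m) x x') :
    List.Forall₂ (ElRel (m.map Prod.swap)) x' x := by
  induction h with
  | nil => exact .nil
  | cons h _ ih => exact .cons h.swap ih

/-- A position in the game of length `T` between `V` and `V'` in which the parameters have been
played. -/
structure Position (Z : Set ℕ) (T : ℕ) (δ : Desc) (V V' : Set ℕ) (m : List (ℕ × ℕ)) : Prop where
  left : IsRich Z T V
  right : IsRich Z T V'
  iso : IsPartialIso T m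
  mem : ∀ q ∈ m, q.1 ∈ V ∧ q.2 ∈ V'
  param : ∀ x ∈ δ.2.2, (x, x) ∈ m
  le : δ.1 ≤ T

variable {Z : Set ℕ} {T : ℕ} {δ : Desc} {V V' : Set ℕ} {m : List (ℕ × ℕ)}

theorem Position.swap (h : Position Z T δ V V' m) : Position Z T δ V' V (m.map Prod.swap) where
  left := h.right
  right := h.left
  iso := h.iso.swap
  mem q hq := by
    obtain ⟨q, hq', rfl⟩ := List.mem_map.1 hq
    exact (h.mem q hq').symm
  param x hx := List.mem_map.2 ⟨_, h.param x hx, rfl⟩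
  le := h.le

/-- An atom is looked up by its key alone, and a partial isomorphism for sizes up to `T` preserves
patterns for the smaller bound `δ.1`. -/
theorem Position.atom_eq (h : Position Z T δ V V' m) {us us' : List El}
    (hu : List.Forall₂ (ElRel m) us us') (s : ℕ) : atom δ s us = atom δ s us' := by
  have h1 : us.map (fun u => u.1) = us'.map (fun u => u.1) := by
    induction hu with
    | nil => rfl
    | cons h _ ih => simp [h.1, ih]
  have h2 : List.Forall₂ (fun a b => (a, b) ∈ m) (us.flatMap fun u => u.2)
      (us'.flatMap fun u => u.2) := by
    clear h1
    induction hu with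
    | nil => exact .nil
    | cons h _ ih => exact List.rel_append h.2 ih
  have h3 : List.Forall₂ (fun a b => (a, b) ∈ m) δ.2.2 δ.2.2 :=
    List.forall₂_same.2 h.param
  rw [atom, atom, key, key, h1, h.iso.pattern_eq h.le (List.rel_append h3 h2)]

theorem Position.extend_list (h : Position Z T δ V V' m) {l : List ℕ} (hl : ∀ x ∈ l, x ∈ V)
    (hT : m.length + l.length ≤ T) : ∃ m' l', Position Z T δ V V' m' ∧ m ⊆ m' ∧
      m'.length = m.length + l.length ∧ List.Forall₂ (fun a b => (a, b) ∈ m') l l' := by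
  induction l generalizing m with
  | nil => exact ⟨m, [], h, fun _ h => h, rfl, .nil⟩
  | cons x l ih =>
    rw [List.length_cons] at hT
    obtain ⟨x', hx', hi⟩ := h.iso.extend h.left h.right h.mem (by omega) (hl x (by simp))
    have h' : Position Z T δ V V' ((x, x') :: m) :=
      ⟨h.left, h.right, hi, fun q hq => by
        rcases List.mem_cons.1 hq with rfl | hq
        · exact ⟨hl x (by simp), hx'⟩
        · exact h.mem q hq, fun y hy => List.mem_cons_of_mem _ (h.param y hy), h.le⟩
    obtain ⟨m', l', h1, h2, h3, h4⟩ := ih h' (fun y hy => hl y (by simp [hy])) (by simp; omega)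
    refine ⟨m', x' :: l', h1, fun q hq => h2 (List.mem_cons_of_mem _ hq), ?_,
      .cons (h2 (by simp)) h4⟩
    simp only [List.length_cons] at h3 ⊢
    omega

/-- An element of the described structure costs one round per coordinate, at most `δ.1` in all. The
reply lies in the domain because membership is itself an atom, with symbol `0`. -/
theorem Position.extend_el (h : Position Z T δ V V' m) {u : El} (hu : InDom δ V u)
    (hT : m.length + δ.1 ≤ T) : ∃ m' u', Position Z T δ V V' m' ∧ m ⊆ m' ∧
      m'.length ≤ m.length + δ.1 ∧ ElRel m' u u' ∧ InDom δ V' u' := by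
  have hd := hu.2.1
  obtain ⟨m', l', h1, h2, h3, h4⟩ := h.extend_list hu.2.2.1 (by omega)
  have hr : ElRel m' u (u.1, l') := ⟨rfl, h4⟩
  refine ⟨m', (u.1, l'), h1, h2, by omega, hr, hu.1, ?_, ?_, ?_⟩
  · rw [← h4.length_eq]; exact hd
  · intro x hx
    obtain ⟨i, hi, rfl⟩ := List.getElem_of_mem hx
    rw [List.forall₂_iff_get] at h4
    exact (h1.mem _ (h4.2 i (by rw [h4.1]; exact hi) hi)).2
  · rw [← h1.atom_eq (.cons hr .nil)]; exact hu.2.2.2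

theorem Position.extend_fin (h : Position Z T δ V V' m) {l : ℕ} {w : Fin l → El}
    (hw : ∀ i, InDom δ V (w i)) (hT : m.length + l * δ.1 ≤ T) :
    ∃ m', ∃ w' : Fin l → El, Position Z T δ V V' m' ∧ m ⊆ m' ∧
      m'.length ≤ m.length + l * δ.1 ∧ (∀ i, ElRel m' (w i) (w' i)) ∧ ∀ i, InDom δ V' (w' i) := by
  induction l generalizing m with
  | zero => exact ⟨m, Fin.elim0, h, fun _ h => h, by omega, fun i => i.elim0, fun i => i.elim0⟩
  | succ l ih =>
    rw [Nat.succ_mul] at hT ⊢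
    obtain ⟨m₁, u, h1, h2, h3, h4, h5⟩ := h.extend_el (hw 0) (by omega)
    obtain ⟨m', w', h6, h7, h8, h9, h10⟩ := ih h1 (fun i => hw i.succ) (by omega)
    exact ⟨m', Fin.cons u w', h6, fun q hq => h7 (h2 hq), by omega,
      fun i => Fin.cases (h4.mono h7) h9 i, fun i => Fin.cases h5 h10 i⟩

theorem Position.el_unique (h : Position Z T δ V V' m) {u v v' : El} (h1 : ElRel m u v)
    (h2 : ElRel m u v') : v = v' := by
  refine Prod.ext (h1.1.symm.trans h2.1) ?_
  obtain ⟨a, l⟩ := u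
  obtain ⟨b, k⟩ := v
  obtain ⟨c, k'⟩ := v'
  replace h1 := h1.2
  replace h2 := h2.2
  change k = k'
  dsimp only at h1 h2
  clear * - h h1 h2
  induction h1 generalizing k' with
  | nil => cases h2; rfl
  | cons hx _ ih =>
    cases h2 with
    | cons hy h2 => exact congrArg₂ List.cons (((h.iso _ hx).2 _ hy).1.1 rfl) (ih _ h2)

theorem forall₂_ofFn {α β : Type*} {R : α → β → Prop} {l : ℕ} {f : Fin l → α} {g : Fin l → β}
    (h : ∀ i, R (f i) (g i)) : List.Forall₂ R (List.ofFn f) (List.ofFn g) := by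
  rw [List.forall₂_iff_get]
  exact ⟨by simp, fun i hi hi' => by simpa using h _⟩

/-- Evaluating a term of arity `l` introduces `l` new elements. The budget `2 * δ.1 * termCode t`
covers them because `l + 2 * termCode (ts i)` is at most twice the Gödel number of the compound
term. -/
theorem Position.tm {S : Sig} {n : ℕ} (t : (lang S).Term (Empty ⊕ Fin n))
    (h : Position Z T δ V V' m) {x x' : List El} {v v' : El} (hx : List.Forall₂ (ElRel m) x x')
    (hv : ElRel m v v') (hT : m.length + 2 * δ.1 * termCode t ≤ T)
    (H : Tm (InDom δ V) (fun s us => atom δ s us = true) t x v) :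
    Tm (InDom δ V') (fun s us => atom δ s us = true) t x' v' := by
  induction t generalizing m v v' with
  | var y =>
    rcases y with ⟨⟨⟩⟩ | i
    simp only [Tm] at H ⊢
    obtain ⟨hi, rfl⟩ := List.getElem?_eq_some_iff.1 H
    rw [List.forall₂_iff_get] at hx
    have hi' : (i : ℕ) < x'.length := hx.1 ▸ hi
    rw [List.getElem?_eq_getElem hi', Option.some.injEq]
    exact h.el_unique (hx.2 i hi hi') hv
  | @func l f ts ih =>
    obtain ⟨w, hw, htm, hat⟩ := H
    have hlt := fun i => termCode_lt f ts i
    have hl : l + termCode (Term.func f ts) ≤ 2 * termCode (Term.func f ts) := by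
      have := length_le_encode (List.ofFn fun i => termCode (ts i))
      rw [List.length_ofFn] at this
      have := Nat.right_le_pair f.1 (Encodable.encode (List.ofFn fun i => termCode (ts i)))
      rw [termCode]
      omega
    have hlt' : ∀ i, l + 2 * termCode (ts i) ≤ 2 * termCode (Term.func f ts) := by
      intro i
      have := length_le_encode (List.ofFn fun i => termCode (ts i))
      rw [List.length_ofFn] at this
      have h1 : termCode (ts i) ∈ List.ofFn fun i => termCode (ts i) := by simp [List.mem_ofFn]
      have := lt_encode_of_mem h1
      have := Nat.right_le_pair f.1 (Encodable.encode (List.ofFn fun i => termCode (ts i)))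
      rw [termCode]
      omega
    have e1 : l * δ.1 ≤ 2 * δ.1 * termCode (Term.func f ts) := by
      nlinarith [Nat.zero_le δ.1]
    obtain ⟨m', w', h1, h2, h3, h4, h5⟩ := h.extend_fin hw (by omega)
    refine ⟨w', h5, fun i => ih i h1 (hx.imp fun _ _ h => h.mono h2) (h4 i) ?_ (htm i), ?_⟩
    · nlinarith [Nat.zero_le δ.1, hlt' i]
    · dsimp only
      rw [← h1.atom_eq (.cons (hv.mono h2) (forall₂_ofFn h4))]
      exact hat

/-- One direction suffices: both universes are generalized in the induction, and the premise of an
implication is transferred backwards by swapping the two sides. -/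
theorem Position.fm {S : Sig} {n : ℕ} (φ : (lang S).BoundedFormula Empty n)
    (h : Position Z T δ V V' m) {x x' : List El} (hx : List.Forall₂ (ElRel m) x x')
    (hT : m.length + 2 * δ.1 * formulaCode φ ≤ T)
    (H : Fm (InDom δ V) (fun s us => atom δ s us = true) φ x) :
    Fm (InDom δ V') (fun s us => atom δ s us = true) φ x' := by
  induction φ generalizing m V V' x x' with
  | falsum => exact H
  | equal t u =>
    obtain ⟨v, w, hv, hw, htv, htw, hat⟩ := H
    have hl := Nat.left_le_pair (termCode t) (termCode u)
    have hr := Nat.right_le_pair (termCode t) (termCode u)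
    have hl' : 2 + 2 * termCode t ≤ 2 * formulaCode (BoundedFormula.equal t u) := by
      rw [formulaCode]; omega
    have hr' : 2 + 2 * termCode u ≤ 2 * formulaCode (BoundedFormula.equal t u) := by
      rw [formulaCode]; omega
    obtain ⟨m₁, v', h1, h2, h3, h4, h5⟩ := h.extend_el hv (by nlinarith)
    obtain ⟨m₂, w', h6, h7, h8, h9, h10⟩ := h1.extend_el hw (by nlinarith)
    have hx₂ := hx.imp fun _ _ h => (ElRel.mono h2 h).mono h7
    have h4' := h4.mono h7
    refine ⟨v', w', h5, h10, h6.tm t hx₂ h4' (by nlinarith) htv, h6.tm u hx₂ h9 (by nlinarith) htw,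
      ?_⟩
    dsimp only
    rw [← h6.atom_eq (.cons h4' (.cons h9 .nil))]
    exact hat
  | @rel n l R ts =>
    obtain ⟨w, hw, htm, hat⟩ := H
    have hlt' : ∀ i, l + 2 * termCode (ts i) ≤ 2 * formulaCode (BoundedFormula.rel R ts) := by
      intro i
      have := length_le_encode (List.ofFn fun i => termCode (ts i))
      rw [List.length_ofFn] at this
      have h1 : termCode (ts i) ∈ List.ofFn fun i => termCode (ts i) := by simp [List.mem_ofFn]
      have := lt_encode_of_mem h1
      have := Nat.right_le_pair R.1 (Encodable.encode (List.ofFn fun i => termCode (ts i)))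
      rw [formulaCode]
      omega
    have hl : l ≤ 2 * formulaCode (BoundedFormula.rel R ts) := by
      have := length_le_encode (List.ofFn fun i => termCode (ts i))
      rw [List.length_ofFn] at this
      have := Nat.right_le_pair R.1 (Encodable.encode (List.ofFn fun i => termCode (ts i)))
      rw [formulaCode]
      omega
    obtain ⟨m', w', h1, h2, h3, h4, h5⟩ := h.extend_fin hw (by nlinarith)
    refine ⟨w', h5, fun i => h1.tm _ (hx.imp fun _ _ h => h.mono h2) (h4 i) ?_ (htm i), ?_⟩
    · nlinarith [Nat.zero_le δ.1, hlt' i]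
    · dsimp only
      rw [← h1.atom_eq (forall₂_ofFn h4)]
      exact hat
  | imp φ ψ ih₁ ih₂ =>
    have hl := Nat.left_le_pair (formulaCode φ) (formulaCode ψ)
    have hr := Nat.right_le_pair (formulaCode φ) (formulaCode ψ)
    have hl' : formulaCode φ ≤ formulaCode (BoundedFormula.imp φ ψ) := by rw [formulaCode]; omega
    have hr' : formulaCode ψ ≤ formulaCode (BoundedFormula.imp φ ψ) := by rw [formulaCode]; omega
    intro H'
    refine ih₂ h hx (by nlinarith) (H (ih₁ h.swap (env_swap hx) ?_ H'))
    rw [List.length_map]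
    nlinarith
  | all φ ih =>
    have hl' : 1 + 2 * formulaCode φ ≤ 2 * formulaCode (BoundedFormula.all φ) := by
      rw [formulaCode]; omega
    intro u hu
    -- The challenge `u` lies in `V'`, so the reply is sought in `V`, where `H` applies to it.
    obtain ⟨m', u', h1, h2, h3, h4, h5⟩ := h.swap.extend_el hu (by
      rw [List.length_map]; nlinarith)
    rw [List.length_map] at h3
    have h1' := h1.swap
    have hx' := env_swap ((env_swap hx).imp fun _ _ h => ElRel.mono h2 h)
    refine ih h1' (List.rel_append hx' (.cons h4.swap .nil)) ?_ (H u' h5)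
    rw [List.length_map]
    nlinarith

/-- The truth of a sentence in a described structure is determined by finite parts of the
universe. -/
theorem fm_iff {S : Sig} (φ : (lang S).Sentence) (hV : IsRich Z T V) (hV' : IsRich Z T V')
    (hp : ∀ x ∈ δ.2.2, x ∈ V ∧ x ∈ V') (hT : δ.1 + δ.2.2.length + 2 * δ.1 * formulaCode φ ≤ T) :
    Fm (InDom δ V) (fun s us => atom δ s us = true) φ [] ↔
      Fm (InDom δ V') (fun s us => atom δ s us = true) φ [] := by
  have h : Position Z T δ V V' (δ.2.2.map fun x => (x, x)) :=
    ⟨hV, hV', isPartialIso_diag _ _, fun q hq => by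
      obtain ⟨x, hx, rfl⟩ := List.mem_map.1 hq
      exact hp x hx, fun x hx => List.mem_map.2 ⟨x, hx, rfl⟩, by omega⟩
  exact ⟨h.fm φ .nil (by rw [List.length_map]; omega),
    h.swap.fm φ .nil (by rw [List.length_map, List.length_map]; omega)⟩

/-! ### The laws of identity as sentences -/

section Laws

variable {S : Sig} {n : ℕ}

/-- The `i`-th variable. -/
def vT (i : Fin n) : (lang S).Term (Empty ⊕ Fin n) := .var (.inr i)

def eqV (i j : Fin n) : (lang S).BoundedFormula Empty n := .equal (vT i) (vT j)

/-- The formula `x₀ = xₗ → x₁ = xₗ₊₁ → ⋯ → xₗ₋₁ = x₂ₗ₋₁ → ψ`. -/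
def eqChain {l : ℕ} (h : 2 * l ≤ n) (ψ : (lang S).BoundedFormula Empty n) :
    (lang S).BoundedFormula Empty n :=
  (List.finRange l).foldr (fun (i : Fin l) χ =>
    (eqV ⟨i, by have := i.2; omega⟩ ⟨l + i, by have := i.2; omega⟩).imp χ) ψ

variable (S) in
def lawNonempty : (lang S).Sentence := (BoundedFormula.all (n := 0) .falsum).imp .falsum

variable (S) in
def lawRefl : (lang S).Sentence := (eqV (n := 1) 0 0).alls

variable (S) in
def lawSymm : (lang S).Sentence := ((eqV (n := 2) 0 1).imp (eqV 1 0)).alls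

variable (S) in
def lawTrans : (lang S).Sentence :=
  ((eqV (n := 3) 0 1).imp ((eqV 1 2).imp (eqV 0 2))).alls

/-- Under the relational semantics `Fm`, the equation `f(x) = f(x)` states that `f` has a value at
`x`, though it is trivial in a genuine structure. -/
def lawTotal {l : ℕ} (f : (lang S).Functions l) : (lang S).Sentence :=
  (BoundedFormula.equal (n := l) (.func f fun i => vT (Fin.castLE (by omega) i))
    (.func f fun i => vT (Fin.castLE (by omega) i))).alls

/-- Values of `f` at identified arguments are identified; this expresses both single-valuedness and
congruence. -/
def lawFun {l : ℕ} (f : (lang S).Functions l) : (lang S).Sentence :=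
  (eqChain (n := 2 * l + 2) (l := l) (by omega)
    ((BoundedFormula.equal (.func f fun i => vT ⟨i, by omega⟩) (vT ⟨2 * l, by omega⟩)).imp
      ((BoundedFormula.equal (.func f fun i => vT ⟨l + i, by omega⟩)
        (vT ⟨2 * l + 1, by omega⟩)).imp
        (eqV ⟨2 * l, by omega⟩ ⟨2 * l + 1, by omega⟩)))).alls

def lawRel {l : ℕ} (R : (lang S).Relations l) : (lang S).Sentence :=
  (eqChain (n := 2 * l) (l := l) le_rfl
    ((BoundedFormula.rel R fun i => vT ⟨i, by omega⟩).imp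
      (BoundedFormula.rel R fun i => vT ⟨l + i, by omega⟩))).alls

/-! #### Their Gödel numbers -/

def eqCode (i j : ℕ) : ℕ := 4 * Nat.pair (2 * i) (2 * j) + 1

def impCode (a b : ℕ) : ℕ := 4 * Nat.pair a b + 3

def allsCode (n c : ℕ) : ℕ := (List.range n).foldr (fun _ c => 4 * c + 4) c

def varsCode (k l : ℕ) : ℕ := Encodable.encode ((List.range l).map fun i => 2 * (k + i))

def chainCode (l c : ℕ) : ℕ := (List.range l).foldr (fun i c => impCode (eqCode i (l + i)) c) c

def funEqCode (f k l z : ℕ) : ℕ := 4 * Nat.pair (2 * Nat.pair f (varsCode k l) + 1) z + 1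

def relCode (R k l : ℕ) : ℕ := 4 * Nat.pair R (varsCode k l) + 2

def lawTotalCode (f l : ℕ) : ℕ :=
  allsCode l (funEqCode f 0 l (2 * Nat.pair f (varsCode 0 l) + 1))

def lawFunCode (f l : ℕ) : ℕ :=
  allsCode (2 * l + 2) (chainCode l (impCode (funEqCode f 0 l (2 * (2 * l)))
    (impCode (funEqCode f l l (2 * (2 * l + 1))) (eqCode (2 * l) (2 * l + 1)))))

def lawRelCode (R l : ℕ) : ℕ :=
  allsCode (2 * l) (chainCode l (impCode (relCode R 0 l) (relCode R l l)))

/-- The Gödel numbers of the laws of identity for the signature `S`. -/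
def lawCodes (S : Sig) : List ℕ :=
  [impCode 4 0, allsCode 1 (eqCode 0 0), allsCode 2 (impCode (eqCode 0 1) (eqCode 1 0)),
    allsCode 3 (impCode (eqCode 0 1) (impCode (eqCode 1 2) (eqCode 0 2)))] ++
  ((List.range S.1.length).flatMap fun f =>
    (S.1[f]?).toList.flatMap fun l => [lawTotalCode f l, lawFunCode f l]) ++
  ((List.range S.2.length).flatMap fun R => (S.2[R]?).toList.flatMap fun l => [lawRelCode R l])

theorem primrec_lawCodes : Primrec lawCodes := by
  unfold lawCodes lawTotalCode lawFunCode lawRelCode relCode funEqCode chainCode varsCode allsCode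
    impCode eqCode
  fun_prop

theorem formulaCode_alls (φ : (lang S).BoundedFormula Empty n) :
    formulaCode φ.alls = allsCode n (formulaCode φ) := by
  induction n with
  | zero => rfl
  | succ n ih =>
    rw [BoundedFormula.alls, ih, formulaCode, allsCode, allsCode, List.range_succ,
      List.foldr_append]
    rfl

theorem formulaCode_eqV (i j : Fin n) :
    formulaCode (eqV i j : (lang S).BoundedFormula Empty n) = eqCode i j := by
  simp [eqV, formulaCode, eqCode, vT, termCode]

theorem formulaCode_eqChain {l : ℕ} (h : 2 * l ≤ n) (ψ : (lang S).BoundedFormula Empty n) :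
    formulaCode (eqChain h ψ) = chainCode l (formulaCode ψ) := by
  rw [chainCode, ← List.map_coe_finRange_eq_range, List.foldr_map, eqChain]
  induction List.finRange l with
  | nil => rfl
  | cons i k ih =>
    rw [List.foldr_cons, List.foldr_cons, ← ih, formulaCode, formulaCode_eqV]
    rfl

theorem encode_ofFn_vT {l k : ℕ} (g : Fin l → Fin n) (hg : ∀ i, (g i : ℕ) = k + i) :
    Encodable.encode (List.ofFn fun i => termCode (vT (S := S) (g i))) = varsCode k l := by
  rw [varsCode, ← List.map_coe_finRange_eq_range, List.map_map, List.ofFn_eq_map]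
  simp [vT, termCode, hg, Function.comp_def]

theorem termCode_func_vT {l k : ℕ} (f : (lang S).Functions l) (g : Fin l → Fin n)
    (hg : ∀ i, (g i : ℕ) = k + i) :
    termCode (.func f fun i => vT (g i)) = 2 * Nat.pair f.1 (varsCode k l) + 1 := by
  rw [termCode, encode_ofFn_vT g hg]

theorem formulaCode_rel_vT {l k : ℕ} (R : (lang S).Relations l) (g : Fin l → Fin n)
    (hg : ∀ i, (g i : ℕ) = k + i) :
    formulaCode (.rel R fun i => vT (g i)) = relCode R.1 k l := by
  rw [formulaCode, encode_ofFn_vT g hg, relCode]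

theorem formulaCode_lawTotal {l : ℕ} (f : (lang S).Functions l) :
    formulaCode (lawTotal f) = lawTotalCode f.1 l := by
  rw [lawTotal, formulaCode_alls, formulaCode, termCode_func_vT (k := 0) f _ (by simp)]
  rfl

theorem formulaCode_lawFun {l : ℕ} (f : (lang S).Functions l) :
    formulaCode (lawFun f) = lawFunCode f.1 l := by
  rw [lawFun, formulaCode_alls, formulaCode_eqChain, formulaCode, formulaCode, formulaCode,
    formulaCode, formulaCode_eqV, termCode_func_vT (k := 0) f _ (by simp),
    termCode_func_vT (k := l) f _ (by simp)]
  rfl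

theorem formulaCode_lawRel {l : ℕ} (R : (lang S).Relations l) :
    formulaCode (lawRel R) = lawRelCode R.1 l := by
  rw [lawRel, formulaCode_alls, formulaCode_eqChain, formulaCode,
    formulaCode_rel_vT (k := 0) R _ (by simp), formulaCode_rel_vT (k := l) R _ (by simp)]
  rfl

/-- Connects the computable list of numbers, used in the search, with the sentences, used in the
semantic arguments. -/
theorem mem_lawCodes {c : ℕ} : c ∈ lawCodes S ↔ c = formulaCode (lawNonempty S) ∨
    c = formulaCode (lawRefl S) ∨ c = formulaCode (lawSymm S) ∨ c = formulaCode (lawTrans S) ∨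
    (∃ l, ∃ f : (lang S).Functions l, c = formulaCode (lawTotal f) ∨ c = formulaCode (lawFun f)) ∨
    ∃ l, ∃ R : (lang S).Relations l, c = formulaCode (lawRel R) := by
  have h1 : formulaCode (lawNonempty S) = impCode 4 0 := rfl
  have h2 : formulaCode (lawRefl S) = allsCode 1 (eqCode 0 0) := rfl
  have h3 : formulaCode (lawSymm S) = allsCode 2 (impCode (eqCode 0 1) (eqCode 1 0)) := rfl
  have h4 : formulaCode (lawTrans S) =
    allsCode 3 (impCode (eqCode 0 1) (impCode (eqCode 1 2) (eqCode 0 2))) := rfl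
  rw [lawCodes, h1, h2, h3, h4]
  simp only [List.mem_append, List.mem_cons, List.mem_flatMap, List.not_mem_nil, or_false,
    List.mem_range, Option.mem_toList, or_assoc]
  refine or_congr_right (or_congr_right (or_congr_right (or_congr_right (or_congr ?_ ?_))))
  · constructor
    · rintro ⟨i, hi, l, hl, h⟩
      obtain ⟨hi, hl⟩ := List.getElem?_eq_some_iff.1 hl
      obtain ⟨f, rfl⟩ : ∃ f : (lang S).Functions l, (f.1 : ℕ) = i := ⟨⟨⟨i, hi⟩, hl⟩, rfl⟩
      refine ⟨l, f, ?_⟩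
      rwa [formulaCode_lawTotal, formulaCode_lawFun]
    · rintro ⟨l, f, h⟩
      rw [formulaCode_lawTotal, formulaCode_lawFun] at h
      exact ⟨f.1, f.1.2, l, List.getElem?_eq_some_iff.2 ⟨f.1.2, f.2⟩, h⟩
  · constructor
    · rintro ⟨i, hi, l, hl, h⟩
      obtain ⟨hi, hl⟩ := List.getElem?_eq_some_iff.1 hl
      obtain ⟨R, rfl⟩ : ∃ R : (lang S).Relations l, (R.1 : ℕ) = i := ⟨⟨⟨i, hi⟩, hl⟩, rfl⟩
      refine ⟨l, R, ?_⟩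
      rwa [formulaCode_lawRel]
    · rintro ⟨l, R, h⟩
      rw [formulaCode_lawRel] at h
      exact ⟨R.1, R.1.2, l, List.getElem?_eq_some_iff.2 ⟨R.1.2, R.2⟩, h⟩

/-! #### Their validity -/

section Validity

variable {M : Type} [(lang S).Structure M]

theorem realize_eqV (i j : Fin n) {v : Empty → M} {xs : Fin n → M} :
    (eqV i j : (lang S).BoundedFormula Empty n).Realize v xs ↔ xs i = xs j := Iff.rfl

theorem realize_eqChain {l : ℕ} (h : 2 * l ≤ n) (ψ : (lang S).BoundedFormula Empty n)
    {v : Empty → M} {xs : Fin n → M} : (eqChain h ψ).Realize v xs ↔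
      ((∀ i : Fin l, xs ⟨i, by omega⟩ = xs ⟨l + i, by omega⟩) → ψ.Realize v xs) := by
  have key : ∀ k : List (Fin l), (k.foldr (fun (i : Fin l) χ =>
      (eqV ⟨i, by have := i.2; omega⟩ ⟨l + i, by have := i.2; omega⟩).imp χ) ψ).Realize v xs ↔
      ((∀ i ∈ k, xs ⟨i, by omega⟩ = xs ⟨l + i, by omega⟩) → ψ.Realize v xs) := by
    intro k
    induction k with
    | nil => simp
    | cons i k ih =>
      rw [List.foldr_cons, BoundedFormula.realize_imp, ih, realize_eqV]
      simp only [List.mem_cons, forall_eq_or_imp, and_imp]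
  rw [eqChain, key]
  simp only [List.mem_finRange, forall_const]

/-- The laws are thus theorems of every theory, and a failing law refutes an interpretation just as
a failing axiom does. -/
theorem realize_of_mem_lawCodes [Nonempty M] {φ : (lang S).Sentence}
    (h : formulaCode φ ∈ lawCodes S) : M ⊨ φ := by
  rw [mem_lawCodes] at h
  rcases h with h | h | h | h | ⟨l, f, h | h⟩ | ⟨l, R, h⟩ <;> obtain rfl := formulaCode_injective h
  · exact fun h => h (Classical.arbitrary M)
  · exact BoundedFormula.realize_alls.2 fun xs => rfl
  · exact BoundedFormula.realize_alls.2 fun xs h => Eq.symm h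
  · exact BoundedFormula.realize_alls.2 fun xs h h' => Eq.trans h h'
  · exact BoundedFormula.realize_alls.2 fun xs => rfl
  · refine BoundedFormula.realize_alls.2 fun xs => (realize_eqChain _ _).2 fun h h1 h2 => ?_
    change Structure.funMap f (fun i : Fin l => xs ⟨i, by omega⟩) = xs _ at h1
    change Structure.funMap f (fun i : Fin l => xs ⟨l + i, by omega⟩) = xs _ at h2
    rw [realize_eqV, ← h1, ← h2]
    exact congrArg _ (funext h)
  · refine BoundedFormula.realize_alls.2 fun xs => (realize_eqChain _ _).2 fun h h1 => ?_
    change Structure.RelMap R (fun i : Fin l => xs ⟨i, by omega⟩) at h1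
    change Structure.RelMap R (fun i : Fin l => xs ⟨l + i, by omega⟩)
    rwa [← funext h]

end Validity

end Laws

/-! ### The quotient of a structure satisfying the laws of identity -/

section Quotient

variable {E : Type} {Dom : E → Prop} {At : ℕ → List E → Prop} {S : Sig} {n : ℕ}

theorem fm_alls (φ : (lang S).BoundedFormula Empty n) : Fm Dom At φ.alls [] ↔
    ∀ y : Fin n → {u // Dom u}, Fm Dom At φ (List.ofFn fun i => (y i).1) := by
  induction n with
  | zero => simp [BoundedFormula.alls]
  | succ n ih =>
    rw [BoundedFormula.alls, ih]
    simp only [Fm]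
    constructor
    · intro h y
      have := h (fun i => y i.castSucc) (y (Fin.last n)).1 (y (Fin.last n)).2
      rwa [List.ofFn_succ', List.concat_eq_append]
    · intro h y u hu
      have := h (Fin.snoc (α := fun _ => {u // Dom u}) y ⟨u, hu⟩)
      rw [List.ofFn_succ', List.concat_eq_append] at this
      simpa using this

theorem tm_vT {y : Fin n → {u // Dom u}} {i : Fin n} {v : E} :
    Tm Dom At (vT (S := S) i) (List.ofFn fun i => (y i).1) v ↔ v = (y i).1 := by
  simp [vT, Tm, eq_comm]

theorem fm_eqV {y : Fin n → {u // Dom u}} {i j : Fin n} :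
    Fm Dom At (eqV (S := S) i j) (List.ofFn fun i => (y i).1) ↔ At 1 [(y i).1, (y j).1] := by
  simp only [eqV, Fm, tm_vT]
  constructor
  · rintro ⟨v, w, _, _, rfl, rfl, h⟩; exact h
  · exact fun h => ⟨_, _, (y i).2, (y j).2, rfl, rfl, h⟩

theorem fm_eqChain {l : ℕ} (h : 2 * l ≤ n) (ψ : (lang S).BoundedFormula Empty n)
    {y : Fin n → {u // Dom u}} : Fm Dom At (eqChain h ψ) (List.ofFn fun i => (y i).1) ↔
      ((∀ i : Fin l, At 1 [(y ⟨i, by omega⟩).1, (y ⟨l + i, by omega⟩).1]) →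
        Fm Dom At ψ (List.ofFn fun i => (y i).1)) := by
  have key : ∀ k : List (Fin l), Fm Dom At (k.foldr (fun (i : Fin l) χ =>
      (eqV ⟨i, by have := i.2; omega⟩ ⟨l + i, by have := i.2; omega⟩).imp χ) ψ)
        (List.ofFn fun i => (y i).1) ↔
      ((∀ i ∈ k, At 1 [(y ⟨i, by omega⟩).1, (y ⟨l + i, by omega⟩).1]) →
        Fm Dom At ψ (List.ofFn fun i => (y i).1)) := by
    intro k
    induction k with
    | nil => simp
    | cons i k ih =>
      rw [List.foldr_cons, Fm, ih, fm_eqV]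
      simp only [List.mem_cons, forall_eq_or_imp, and_imp]
  rw [eqChain, key]
  simp only [List.mem_finRange, forall_const]

theorem tm_func_vT {l : ℕ} (f : (lang S).Functions l) (g : Fin l → Fin n)
    {y : Fin n → {u // Dom u}} {v : E} :
    Tm Dom At (.func f fun i => vT (g i)) (List.ofFn fun i => (y i).1) v ↔
      At (2 * f.1 + 3) (v :: List.ofFn fun i => (y (g i)).1) := by
  simp only [Tm, tm_vT]
  constructor
  · rintro ⟨w, _, hw, h⟩
    rwa [funext hw] at h
  · exact fun h => ⟨_, fun i => (y (g i)).2, fun i => rfl, h⟩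

theorem fm_rel_vT {l : ℕ} (R : (lang S).Relations l) (g : Fin l → Fin n)
    {y : Fin n → {u // Dom u}} :
    Fm Dom At (.rel R fun i => vT (g i)) (List.ofFn fun i => (y i).1) ↔
      At (2 * R.1 + 2) (List.ofFn fun i => (y (g i)).1) := by
  simp only [Fm, tm_vT]
  constructor
  · rintro ⟨w, _, hw, h⟩
    rwa [funext hw] at h
  · exact fun h => ⟨_, fun i => (y (g i)).2, fun i => rfl, h⟩

/-- A structure satisfying the laws of identity is equivalent to a genuine one. -/
theorem exists_structure_of_laws
    (h : ∀ φ : (lang S).Sentence, formulaCode φ ∈ lawCodes S → Fm Dom At φ []) :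
    ∃ (N : Type) (_ : (lang S).Structure N), Nonempty N ∧
      ∀ φ : (lang S).Sentence, N ⊨ φ ↔ Fm Dom At φ [] := by
  have hne : Nonempty {u // Dom u} := by
    by_contra hcon
    exact h (lawNonempty S) (mem_lawCodes.2 (.inl rfl)) fun u hu => hcon ⟨⟨u, hu⟩⟩
  let r : {u // Dom u} → {u // Dom u} → Prop := fun u v => At 1 [u.1, v.1]
  have hrefl : ∀ u, r u u := fun u => fm_eqV.1
    ((fm_alls _).1 (h (lawRefl S) (mem_lawCodes.2 (.inr (.inl rfl)))) ![u])
  have hsymm : ∀ {u v}, r u v → r v u := fun {u v} huv => by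
    have := (fm_alls _).1 (h (lawSymm S) (mem_lawCodes.2 (by simp))) ![u, v]
    rw [Fm, fm_eqV, fm_eqV] at this
    exact this huv
  have htrans : ∀ {u v w}, r u v → r v w → r u w := fun {u v w} huv hvw => by
    have := (fm_alls _).1 (h (lawTrans S) (mem_lawCodes.2 (by simp))) ![u, v, w]
    rw [Fm, Fm, fm_eqV, fm_eqV, fm_eqV] at this
    exact this huv hvw
  have htot : ∀ {l : ℕ} (f : (lang S).Functions l) (y : Fin l → {u // Dom u}),
      ∃ v : {u // Dom u}, At (2 * f.1 + 3) (v.1 :: List.ofFn fun i => (y i).1) := by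
    intro l f y
    have := (fm_alls _).1 (h (lawTotal f) (mem_lawCodes.2
      (.inr (.inr (.inr (.inr (.inl ⟨l, f, .inl rfl⟩))))))) y
    obtain ⟨v, w, hv, hw, h1, -, -⟩ := this
    rw [tm_func_vT] at h1
    exact ⟨⟨v, hv⟩, h1⟩
  have hfun : ∀ {l : ℕ} (f : (lang S).Functions l) (y z : Fin l → {u // Dom u})
      (v w : {u // Dom u}), (∀ i, r (y i) (z i)) →
      At (2 * f.1 + 3) (v.1 :: List.ofFn fun i => (y i).1) →
      At (2 * f.1 + 3) (w.1 :: List.ofFn fun i => (z i).1) → r v w := by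
    intro l f y z v w hyz hv hw
    -- The assignment `y, z, v, w`, in the order of the variables of `lawFun`.
    let x : Fin (2 * l + 2) → {u // Dom u} := fun i =>
      if h : i.1 < l then y ⟨i, h⟩ else if h' : i.1 < 2 * l then z ⟨i - l, by omega⟩ else
        if i.1 = 2 * l then v else w
    have hx1 : ∀ i : Fin l, x ⟨i, by omega⟩ = y i := fun i => by simp [x]
    have hx2 : ∀ i : Fin l, x ⟨l + i, by omega⟩ = z i := fun i => by
      have : l + i.1 < 2 * l := by omega
      simp [x, this]
    have hx3 : x ⟨2 * l, by omega⟩ = v := by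
      have : ¬ 2 * l < l := by omega
      simp [x, this]
    have hx4 : x ⟨2 * l + 1, by omega⟩ = w := by
      have h1 : ¬ 2 * l + 1 < l := by omega
      have h2 : ¬ 2 * l + 1 < 2 * l := by omega
      simp [x, h1, h2]
    have := (fm_eqChain _ _).1 ((fm_alls _).1 (h (lawFun f) (mem_lawCodes.2
      (.inr (.inr (.inr (.inr (.inl ⟨l, f, .inr rfl⟩))))))) x)
      (fun i => by rw [hx1, hx2]; exact hyz i)
      ⟨v, v, v.2, v.2, (tm_func_vT f _).2 (by simpa only [hx1] using hv),
        tm_vT.2 (by rw [hx3]), hrefl v⟩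
      ⟨w, w, w.2, w.2, (tm_func_vT f fun i => ⟨l + i, by omega⟩).2 (by simpa only [hx2] using hw),
        tm_vT.2 (by rw [hx4]), hrefl w⟩
    rwa [fm_eqV, hx3, hx4] at this
  have hrel : ∀ {l : ℕ} (R : (lang S).Relations l) (y z : Fin l → {u // Dom u}),
      (∀ i, r (y i) (z i)) → At (2 * R.1 + 2) (List.ofFn fun i => (y i).1) →
      At (2 * R.1 + 2) (List.ofFn fun i => (z i).1) := by
    intro l R y z hyz hy
    let x : Fin (2 * l) → {u // Dom u} := fun i =>
      if h : i.1 < l then y ⟨i, h⟩ else z ⟨i - l, by omega⟩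
    have hx1 : ∀ i : Fin l, x ⟨i, by omega⟩ = y i := fun i => by simp [x]
    have hx2 : ∀ i : Fin l, x ⟨l + i, by omega⟩ = z i := fun i => by simp [x]
    have := (fm_alls _).1 (h (lawRel R) (mem_lawCodes.2
      (.inr (.inr (.inr (.inr (.inr ⟨l, R, rfl⟩))))))) x
    rw [fm_eqChain, Fm, fm_rel_vT, fm_rel_vT R fun i => ⟨l + i, by omega⟩] at this
    simp only [hx1, hx2] at this
    exact this hyz hy
  let st : Setoid {u // Dom u} := ⟨r, hrefl, hsymm, htrans⟩
  choose F hF using @htot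
  let str : (lang S).Structure (Quotient st) :=
    { funMap := fun f q => Quotient.mk st (F f fun i => (q i).out)
      RelMap := fun R q => At (2 * R.1 + 2) (List.ofFn fun i => (q i).out.1) }
  -- A term may have several values, but all are identified with one another; its value in the
  -- quotient is their common class. Existence is stated together with uniqueness because both are
  -- needed for atomic formulas.
  have htm : ∀ {n : ℕ} (t : (lang S).Term (Empty ⊕ Fin n)) (y : Fin n → {u // Dom u}),
      (∀ v : {u // Dom u}, Tm Dom At t (List.ofFn fun i => (y i).1) v.1 →
        Quotient.mk st v = t.realize (Sum.elim default fun i => Quotient.mk st (y i))) ∧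
      ∃ v : {u // Dom u}, Tm Dom At t (List.ofFn fun i => (y i).1) v.1 := by
    intro n t y
    induction t with
    | var x =>
      rcases x with ⟨⟨⟩⟩ | i
      exact ⟨fun v hv => congrArg _ (Subtype.ext (tm_vT.1 hv)), y i, tm_vT.2 rfl⟩
    | @func l f ts ih =>
      constructor
      · rintro v ⟨w, hw, h1, h2⟩
        refine Quotient.sound (hfun f (fun i => ⟨w i, hw i⟩) _ _ _ (fun i => ?_) h2 (hF f _))
        exact Quotient.exact (((ih i).1 ⟨w i, hw i⟩ (h1 i)).trans (Quotient.out_eq _).symm)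
      · choose w hw using fun i => (ih i).2
        exact ⟨F f w, fun i => (w i).1, fun i => (w i).2, hw, hF f w⟩
  have hfm : ∀ {n : ℕ} (φ : (lang S).BoundedFormula Empty n) (y : Fin n → {u // Dom u}),
      φ.Realize default (fun i => Quotient.mk st (y i)) ↔
        Fm Dom At φ (List.ofFn fun i => (y i).1) := by
    intro n φ
    induction φ with
    | falsum => exact fun y => Iff.rfl
    | equal t u =>
      intro y
      change t.realize _ = u.realize _ ↔ _
      constructor
      · intro e
        obtain ⟨v, hv⟩ := (htm t y).2
        obtain ⟨w, hw⟩ := (htm u y).2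
        refine ⟨v, w, v.2, w.2, hv, hw, ?_⟩
        rw [← (htm t y).1 v hv, ← (htm u y).1 w hw] at e
        exact Quotient.exact e
      · rintro ⟨v, w, hv, hw, h1, h2, h3⟩
        rw [← (htm t y).1 ⟨v, hv⟩ h1, ← (htm u y).1 ⟨w, hw⟩ h2]
        exact Quotient.sound h3
    | @rel n l R ts =>
      intro y
      change At (2 * R.1 + 2) (List.ofFn fun i => (Quotient.out (s := st)
        ((ts i).realize (Sum.elim default fun i => Quotient.mk st (y i)))).1) ↔ _
      constructor
      · intro h1
        choose w hw using fun i => (htm (ts i) y).2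
        refine ⟨fun i => (w i).1, fun i => (w i).2, hw, hrel R _ _ (fun i => ?_) h1⟩
        exact Quotient.exact ((Quotient.out_eq _).trans ((htm (ts i) y).1 _ (hw i)).symm)
      · rintro ⟨w, hw, h1, h2⟩
        refine hrel R (fun i => ⟨w i, hw i⟩) _ (fun i => ?_) h2
        exact Quotient.exact (((htm (ts i) y).1 ⟨w i, hw i⟩ (h1 i)).trans (Quotient.out_eq _).symm)
    | imp φ ψ ih₁ ih₂ => exact fun y => imp_congr (ih₁ y) (ih₂ y)
    | @all n φ ih =>
      intro y
      have key : ∀ u : {u // Dom u}, φ.Realize default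
          (Fin.snoc (α := fun _ => Quotient st) (fun i => Quotient.mk st (y i)) (Quotient.mk st u)) ↔
          Fm Dom At φ ((List.ofFn fun i => (y i).1) ++ [u.1]) := by
        intro u
        have h1 := ih (Fin.snoc (α := fun _ => {u // Dom u}) y u)
        have h2 : (fun i => Quotient.mk st (Fin.snoc (α := fun _ => {u // Dom u}) y u i)) =
            Fin.snoc (α := fun _ => Quotient st) (fun i => Quotient.mk st (y i))
              (Quotient.mk st u) := by
          funext i
          refine Fin.lastCases ?_ (fun i => ?_) i <;> simp
        rw [h2, List.ofFn_succ', List.concat_eq_append] at h1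
        simpa using h1
      constructor
      · exact fun H u hu => (key ⟨u, hu⟩).1 (H _)
      · intro H q
        induction q using Quotient.ind with
        | _ u => exact (key u).2 (H u.1 u.2)
  refine ⟨Quotient st, str, hne.map (Quotient.mk st), fun φ => ?_⟩
  have := hfm φ Fin.elim0
  rw [show (fun i : Fin 0 => Quotient.mk st (Fin.elim0 i)) = default from
    Subsingleton.elim _ _] at this
  exact this

end Quotient

/-! ### Standard models of `J` -/

/-- The model of `J` whose finite classes have the sizes `s + 1` for `s ∈ Z`. -/
abbrev Pt (Z : Set ℕ) : Type := {x // x ∈ points Z}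

instance structurePt (Z : Set ℕ) : langJ.Structure (Pt Z) where
  funMap f := f.elim
  RelMap := fun {_} R xs => match R, xs with
    | .E, xs => cls (xs 0).1 = cls (xs 1).1

instance nonemptyPt (Z : Set ℕ) : Nonempty (Pt Z) := ⟨⟨Nat.pair 0 0, Or.inl (by simp)⟩⟩

section Model

variable {Z : Set ℕ} {α : Type}

theorem realize_eF {x y : α} {v : α → Pt Z} :
    (eF x y).Realize v ↔ cls (v x).1 = cls (v y).1 := by
  rw [eF, Relations.formula₂, Relations.formula, Formula.Realize, BoundedFormula.realize_rel]
  exact Iff.rfl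

/-- Within a class, elements are determined by their index, and in an odd class `c` the indices are
exactly those up to `c / 2`. -/
theorem exists_in_class_iff {n : ℕ} {y : Pt Z} :
    (∃ f : Fin n → Pt Z, (∀ i, cls y.1 = cls (f i).1) ∧ Function.Injective f) ↔
      cls y.1 % 2 = 0 ∨ n ≤ cls y.1 / 2 + 1 := by
  constructor
  · rintro ⟨f, hf, hinj⟩
    by_cases h : cls y.1 % 2 = 0
    · exact .inl h
    right
    have hidx : ∀ i, idx (f i).1 < cls y.1 / 2 + 1 := fun i => by
      rcases (f i).2 with h' | h' <;> rw [← hf i] at h' <;> omega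
    have hg : Function.Injective fun i => (⟨idx (f i).1, hidx i⟩ : Fin (cls y.1 / 2 + 1)) :=
      fun i j e => hinj (Subtype.ext (eq_of_cls_of_idx ((hf i).symm.trans (hf j)) (Fin.mk.inj e)))
    simpa using Fintype.card_le_of_injective _ hg
  · intro h
    refine ⟨fun i => ⟨Nat.pair (cls y.1) i, ?_⟩, fun i => by simp, fun i j e => ?_⟩
    · rcases h with h | h
      · left; simpa using h
      · rcases y.2 with h' | h'
        · left; simpa using h'
        · right; simpa using ⟨h'.1, by omega⟩
    · exact Fin.ext (Nat.pair_eq_pair.1 (Subtype.mk.inj e)).2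

theorem realize_classGe {n : ℕ} {x : α} {v : α → Pt Z} :
    (classGe n x).Realize v ↔ cls (v x).1 % 2 = 0 ∨ n ≤ cls (v x).1 / 2 + 1 := by
  rw [← exists_in_class_iff, classGe, Formula.realize_iExs]
  refine exists_congr fun f => ?_
  simp only [Formula.realize_inf, Formula.realize_iInf, realize_eF, Formula.realize_not,
    Formula.realize_equal, Term.realize_var, Sum.elim_inl, Sum.elim_inr]
  refine and_congr_right fun _ => ⟨fun h i j e => ?_, fun h q e => q.2 (h e)⟩
  by_contra hne
  exact h ⟨(i, j), hne⟩ e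

theorem realize_classEq {n : ℕ} {x : α} {v : α → Pt Z} :
    (classEq n x).Realize v ↔ cls (v x).1 % 2 = 1 ∧ n = cls (v x).1 / 2 + 1 := by
  rw [classEq, Formula.realize_inf, Formula.realize_not, realize_classGe, realize_classGe]
  omega

theorem models_J (Z : Set ℕ) : Pt Z ⊨ J := by
  rw [J, Theory.model_iff]
  rintro φ ((h | ⟨n, rfl⟩) | ⟨n, rfl⟩)
  · rcases h with rfl | rfl | rfl
    · rw [Relations.realize_reflexive]; exact ⟨fun x => rfl⟩
    · rw [Relations.realize_symmetric]; exact ⟨fun x y h => Eq.symm h⟩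
    · rw [Relations.realize_transitive]; exact ⟨fun x y z h h' => Eq.trans h h'⟩
  · rw [axJ2, Sentence.Realize, Formula.realize_iAlls]
    intro v
    simp only [Formula.realize_imp, realize_classEq, realize_eF, Sum.elim_inr]
    omega
  · rw [axJ3, Sentence.Realize, Formula.realize_iExs]
    -- The even classes are infinite, so they serve for every `n`.
    refine ⟨fun i => ⟨Nat.pair (2 * i) 0, Or.inl (by simp)⟩, ?_⟩
    simp only [Formula.realize_inf, Formula.realize_iInf, realize_classGe, Formula.realize_not,
      realize_eF, Sum.elim_inr, cls_pair]
    refine ⟨fun i => .inl (by simp), fun q e => q.2 (Fin.ext ?_)⟩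
    omega

theorem models_A {s : ℕ} : Pt Z ⊨ A s ↔ s ∈ Z := by
  rw [A, Sentence.Realize, Formula.realize_iExs]
  simp only [realize_classEq, Sum.elim_inr]
  constructor
  · rintro ⟨f, h1, h2⟩
    rcases (f 0).2 with h | h
    · omega
    · convert h.1 using 1; omega
  · intro h
    have h' : (2 * s + 1) / 2 = s := by omega
    refine ⟨fun _ => ⟨Nat.pair (2 * s + 1) 0, Or.inr ?_⟩, ?_⟩
    · simpa [h'] using h
    · simp only [cls_pair]; omega

/-- Every consistent `J,X`-theory has a standard model whose finite classes have sizes `s + 1` with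
`s ∈ X`. -/
theorem exists_standard_model {X : Set ℕ} {W : langJ.Theory} (hW : IsJTheory X W)
    (hs : W.IsSatisfiable) : ∃ Z ⊆ X, Pt Z ⊨ W := by
  obtain ⟨B, hB, hWB⟩ := hW
  have hcon : ¬ (J ∪ B : langJ.Theory) ⊨ᵇ (⊥ : langJ.Sentence) := by
    rw [← hWB]
    obtain ⟨M⟩ := hs
    exact fun h => h M default default
  rw [Theory.ModelsBoundedFormula] at hcon
  push Not at hcon
  obtain ⟨M, v, xs, -⟩ := hcon
  have hM : ∀ φ ∈ B, M ⊨ φ := fun φ hφ => M.is_model.realize_of_mem φ (.inr hφ)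
  -- `M` may have finite classes of sizes not indexed by `X`; they are dropped, since `B` only
  -- speaks of `A s` with `s ∈ X`.
  let Z : Set ℕ := {s | s ∈ X ∧ M ⊨ A s}
  have hbc : ∀ φ, IsBoolComb X φ → (Pt Z ⊨ φ ↔ M ⊨ φ) := by
    intro φ hφ
    induction hφ with
    | atom hs => exact models_A.trans ⟨fun h => h.2, fun h => ⟨hs, h⟩⟩
    | falsum => exact Iff.rfl
    | imp _ _ ih₁ ih₂ => exact imp_congr ih₁ ih₂
  have hJB : Pt Z ⊨ (J ∪ B : langJ.Theory) := by
    rw [Theory.model_iff]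
    rintro φ (h | h)
    · exact (models_J Z).realize_of_mem φ h
    · exact (hbc φ (hB φ h)).2 (hM φ h)
  refine ⟨Z, fun s h => h.1, ?_⟩
  rw [Theory.model_iff]
  intro φ hφ
  have h1 : W ⊨ᵇ φ := Theory.models_sentence_of_mem hφ
  have h2 := (hWB φ).1 h1
  exact h2.realize_sentence (Pt Z)

end Model

/-! ### Formulas over the standard models -/

/-- The quantifier depth. -/
def depth {α : Type} : {n : ℕ} → langJ.BoundedFormula α n → ℕ
  | _, .falsum => 0
  | _, .equal _ _ => 0
  | _, .rel _ _ => 0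
  | _, .imp φ ψ => max (depth φ) (depth ψ)
  | _, .all φ => depth φ + 1

/-- The Ehrenfeucht–Fraïssé argument for formulas of `langJ` within one standard model: `T` must
leave one round per nested quantifier beyond the pairs already in `m`. As there are no function
symbols, terms are variables. -/
theorem realize_of_isPartialIso {Z : Set ℕ} {T : ℕ} {α : Type} {n : ℕ}
    (φ : langJ.BoundedFormula α n) {m : List (ℕ × ℕ)} (hi : IsPartialIso T m)
    (hm : ∀ q ∈ m, q.1 ∈ points Z ∧ q.2 ∈ points Z) {v v' : α → Pt Z} {xs xs' : Fin n → Pt Z}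
    (hv : ∀ a, ((v a).1, (v' a).1) ∈ m) (hxs : ∀ i, ((xs i).1, (xs' i).1) ∈ m)
    (hT : m.length + depth φ ≤ T) (h : φ.Realize v xs) : φ.Realize v' xs' := by
  have hterm : ∀ {n : ℕ} (t : langJ.Term (α ⊕ Fin n)) {m : List (ℕ × ℕ)} {v v' : α → Pt Z}
      {xs xs' : Fin n → Pt Z}, (∀ a, ((v a).1, (v' a).1) ∈ m) →
      (∀ i, ((xs i).1, (xs' i).1) ∈ m) →
      ((t.realize (Sum.elim v xs)).1, (t.realize (Sum.elim v' xs')).1) ∈ m := by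
    intro n t m v v' xs xs' hv hxs
    rcases t with (a | i) | f
    · exact hv a
    · exact hxs i
    · exact f.elim
  induction φ generalizing m v v' with
  | falsum => exact h
  | equal t u =>
    have := ((hi _ (hterm t hv hxs)).2 _ (hterm u hv hxs)).1
    exact Subtype.ext (this.1 (congrArg Subtype.val h))
  | @rel n l R ts =>
    cases R
    exact ((hi _ (hterm (ts 0) hv hxs)).2 _ (hterm (ts 1) hv hxs)).2.1 h
  | imp φ ψ ih₁ ih₂ =>
    rw [depth] at hT
    intro h'
    refine ih₂ hi hm hv hxs (by omega) (h (ih₁ hi.swap ?_ ?_ ?_ ?_ h'))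
    · intro q hq
      obtain ⟨q, hq', rfl⟩ := List.mem_map.1 hq
      exact (hm q hq').symm
    · exact fun a => List.mem_map.2 ⟨_, hv a, rfl⟩
    · exact fun i => List.mem_map.2 ⟨_, hxs i, rfl⟩
    · rw [List.length_map]; omega
  | all φ ih =>
    rw [depth] at hT
    intro y
    obtain ⟨y', hy', hi'⟩ := hi.swap.extend (isRich_points Z T) (isRich_points Z T) (x := y.1)
      (fun q hq => by
        obtain ⟨q, hq', rfl⟩ := List.mem_map.1 hq
        exact (hm q hq').symm) (by rw [List.length_map]; omega) y.2
    have hi'' : IsPartialIso T ((y', y.1) :: m) := by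
      have := hi'.swap
      rwa [List.map_cons, List.map_map, Prod.swap_swap_eq, List.map_id] at this
    refine ih (m := (y', y.1) :: m) (xs := Fin.snoc xs ⟨y', hy'⟩) hi'' ?_ ?_ ?_ ?_ (h ⟨y', hy'⟩)
    · intro q hq
      rcases List.mem_cons.1 hq with rfl | hq
      · exact ⟨hy', y.2⟩
      · exact hm q hq
    · exact fun a => List.mem_cons_of_mem _ (hv a)
    · intro i
      refine Fin.lastCases ?_ (fun i => ?_) i
      · simp
      · simpa using .inr (hxs i)
    · rw [List.length_cons]; omega

/-! ### Semantics of translations -/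

section TranslationSemantics

variable {L L' : FirstOrder.Language.{0, 0}} {τ : Translation L L'} {M : Type} [L'.Structure M]

theorem realize_domF {β : Type} {p : Fin τ.params → β} {u : τ.Tup β} {σ : β → M} :
    (τ.domF p u).Realize σ ↔ (τ.dom (u.map σ).1).Realize (Sum.elim (σ ∘ p) (u.map σ).2) := by
  rw [Translation.domF, Formula.realize_relabel, Sum.comp_elim]
  rfl

/-- By `hK` the truth of `K` depends only on the elements of `M` that the new variables denote; the
disjunction over pieces and the block of quantifiers then merge into one quantifier over tuples of
elements. -/
theorem realize_exF {β : Type} {p : Fin τ.params → β} {n : ℕ}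
    {K : (γ : Type) → (β → γ) → (Fin n → τ.Tup γ) → L'.Formula γ} {σ : β → M}
    {Q : (Fin n → τ.Tup M) → Prop}
    (hK : ∀ (γ : Type) (g : β → γ) (ρ : γ → M) (u : Fin n → τ.Tup γ), ρ ∘ g = σ →
      ((K γ g u).Realize ρ ↔ Q fun i => (u i).map ρ)) :
    (τ.exF p n K).Realize σ ↔ ∃ w : Fin n → τ.Tup M,
      (∀ i, (τ.dom (w i).1).Realize (Sum.elim (σ ∘ p) (w i).2)) ∧ Q w := by
  rw [Translation.exF, Formula.realize_iSup]
  simp only [Formula.realize_iExs, Formula.realize_inf, Formula.realize_iInf, realize_domF]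
  constructor
  · rintro ⟨a, y, h1, h2⟩
    rw [hK _ _ (Sum.elim σ y) _ (Sum.elim_comp_inl _ _)] at h2
    exact ⟨_, h1, h2⟩
  · rintro ⟨w, h1, h2⟩
    refine ⟨fun i => (w i).1, fun q => (w q.1).2 q.2, h1, ?_⟩
    rw [hK _ _ (Sum.elim σ _) _ (Sum.elim_comp_inl _ _)]
    exact h2

theorem realize_allF {β : Type} {p : Fin τ.params → β}
    {K : (γ : Type) → (β → γ) → τ.Tup γ → L'.Formula γ} {σ : β → M} {Q : τ.Tup M → Prop}
    (hK : ∀ (γ : Type) (g : β → γ) (ρ : γ → M) (u : τ.Tup γ), ρ ∘ g = σ →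
      ((K γ g u).Realize ρ ↔ Q (u.map ρ))) :
    (τ.allF p K).Realize σ ↔ ∀ w : τ.Tup M,
      (τ.dom w.1).Realize (Sum.elim (σ ∘ p) w.2) → Q w := by
  rw [Translation.allF, Formula.realize_iInf]
  simp only [Formula.realize_iAlls, Formula.realize_imp, realize_domF]
  constructor
  · rintro h ⟨a, y⟩ h1
    have := h a y h1
    rwa [hK _ _ (Sum.elim σ y) _ (Sum.elim_comp_inl _ _)] at this
  · intro h a y h1
    have := h ⟨a, y⟩ h1
    exact (hK _ _ (Sum.elim σ y) ⟨a, Sum.inr⟩ (Sum.elim_comp_inl _ _)).2 this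

theorem realize_sameF {β : Type} {u v : τ.Tup β} {σ : β → M} :
    (τ.sameF u v).Realize σ ↔ u.map σ = v.map σ := by
  obtain ⟨a, x⟩ := u
  obtain ⟨b, y⟩ := v
  by_cases h : a = b
  · subst h
    simp only [Translation.sameF, dif_pos, Formula.realize_iInf, Formula.realize_equal,
      Term.realize_var, Translation.Tup.map, Sigma.mk.injEq, heq_eq_eq, true_and]
    exact ⟨fun h => funext h, fun h i => congrFun h i⟩
  · simp only [Translation.sameF, h, dif_neg, not_false_eq_true, Translation.Tup.map,
      Sigma.mk.injEq, false_and, iff_false]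
    exact id

end TranslationSemantics

/-! ### The table of a translation over a standard model -/

section Table

variable {S : Sig} {τ : Translation (lang S) langJ} {Z : Set ℕ} {p : Fin τ.params → Pt Z}

/-- The element of the interpreted structure given by a tuple. -/
def elOf (u : τ.Tup (Pt Z)) : El := (u.1, List.ofFn fun j => (u.2 j).1)

theorem elOf_injective : Function.Injective (elOf : τ.Tup (Pt Z) → El) := by
  rintro ⟨a, x⟩ ⟨b, y⟩ h
  simp only [elOf, Prod.mk.injEq] at h
  obtain ⟨h1, h2⟩ := h
  obtain rfl := Fin.ext h1
  have := List.ofFn_injective h2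
  rw [show x = y from funext fun j => Subtype.ext (congrFun this j)]

variable (τ p) in
/-- The atomic formulas that hold in the interpreted structure, with the conventions of `Tm`. -/
inductive Holds : ℕ → List (τ.Tup (Pt Z)) → Prop
  | dom (u : τ.Tup (Pt Z)) : (τ.dom u.1).Realize (Sum.elim p u.2) → Holds 0 [u]
  | eq (u v : τ.Tup (Pt Z)) : (τ.eq u.1 v.1).Realize (Sum.elim p (Sum.elim u.2 v.2)) →
      Holds 1 [u, v]
  | rel {n : ℕ} (R : (lang S).Relations n) (u : Fin n → τ.Tup (Pt Z)) :
      (τ.rel R fun i => (u i).1).Realize (Sum.elim p fun x => (u x.1).2 x.2) →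
      Holds (2 * R.1 + 2) (List.ofFn u)
  | graph {n : ℕ} (f : (lang S).Functions n) (u : Fin n → τ.Tup (Pt Z)) (v : τ.Tup (Pt Z)) :
      (τ.graph f (fun i => (u i).1) v.1).Realize
        (Sum.elim p (Sum.elim (fun x => (u x.1).2 x.2) v.2)) →
      Holds (2 * f.1 + 3) (v :: List.ofFn u)

/-- Inversion of `Holds`: the number of the symbol leaves only one constructor possible. -/
theorem holds_dom {us : List (τ.Tup (Pt Z))} (h : Holds τ p 0 us) :
    ∃ u, us = [u] ∧ (τ.dom u.1).Realize (Sum.elim p u.2) := by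
  generalize hs : 0 = s at h
  cases h with
  | dom u h => exact ⟨u, rfl, h⟩
  | eq | rel | graph => omega

theorem holds_eq {u v : τ.Tup (Pt Z)} (h : Holds τ p 1 [u, v]) :
    (τ.eq u.1 v.1).Realize (Sum.elim p (Sum.elim u.2 v.2)) := by
  generalize hs : 1 = s at h
  generalize hu : [u, v] = us at h
  cases h with
  | eq u' v' h => cases hu; exact h
  | dom | rel | graph => omega

theorem holds_rel {n : ℕ} {R : (lang S).Relations n} {u : Fin n → τ.Tup (Pt Z)}
    (h : Holds τ p (2 * R.1 + 2) (List.ofFn u)) :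
    (τ.rel R fun i => (u i).1).Realize (Sum.elim p fun x => (u x.1).2 x.2) := by
  generalize hs : 2 * (R.1 : ℕ) + 2 = s at h
  generalize hu : List.ofFn u = us at h
  cases h with
  | @rel n' R' u' h =>
    obtain ⟨i, rfl⟩ := R
    obtain ⟨i', rfl⟩ := R'
    obtain rfl : i = i' := Fin.ext (by dsimp only at hs; omega)
    obtain rfl := List.ofFn_injective hu
    exact h
  | dom | eq | graph => omega

theorem holds_graph {n : ℕ} {f : (lang S).Functions n} {u : Fin n → τ.Tup (Pt Z)}
    {v : τ.Tup (Pt Z)} (h : Holds τ p (2 * f.1 + 3) (v :: List.ofFn u)) :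
    (τ.graph f (fun i => (u i).1) v.1).Realize
        (Sum.elim p (Sum.elim (fun x => (u x.1).2 x.2) v.2)) := by
  generalize hs : 2 * (f.1 : ℕ) + 3 = s at h
  generalize hu : v :: List.ofFn u = us at h
  cases h with
  | @graph n' f' u' v' h =>
    obtain ⟨i, rfl⟩ := f
    obtain ⟨i', rfl⟩ := f'
    obtain rfl : i = i' := Fin.ext (by dsimp only at hs; omega)
    obtain ⟨rfl, hu'⟩ := List.cons.inj hu
    obtain rfl := List.ofFn_injective hu'
    exact h
  | dom | eq | rel => omega

/-- The coordinates of a list of tuples. -/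
def coords (us : List (τ.Tup (Pt Z))) : List ℕ := (us.map elOf).flatMap fun u => u.2

variable (p) in
def paramList : List ℕ := List.ofFn fun i => (p i).1

/-- The tuples `u` and `u'` correspond to each other under `m`. -/
def TupRel (m : List (ℕ × ℕ)) (u u' : τ.Tup (Pt Z)) : Prop :=
  ∃ a, ∃ x x' : Fin (τ.dim a) → Pt Z, u = ⟨a, x⟩ ∧ u' = ⟨a, x'⟩ ∧ ∀ j, ((x j).1, (x' j).1) ∈ m

theorem forall₂_append_split {α β : Type*} {R : α → β → Prop} {a : List α} {a' : List β}
    {b : List α} {b' : List β} (h : a.length = a'.length)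
    (H : List.Forall₂ R (a ++ b) (a' ++ b')) : List.Forall₂ R a a' ∧ List.Forall₂ R b b' := by
  induction a generalizing a' with
  | nil =>
    obtain rfl := List.eq_nil_of_length_eq_zero h.symm
    exact ⟨.nil, H⟩
  | cons x a ih =>
    obtain _ | ⟨x', a'⟩ := a'
    · simp at h
    · obtain ⟨hx, H⟩ := List.forall₂_cons.1 H
      obtain ⟨h1, h2⟩ := ih (by simpa using h) H
      exact ⟨.cons hx h1, h2⟩

theorem forall₂_zip {α β : Type*} {l : List α} {l' : List β} (h : l.length = l'.length) :
    List.Forall₂ (fun a b => (a, b) ∈ l.zip l') l l' := by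
  rw [List.forall₂_iff_get]
  refine ⟨h, fun i hi hi' => ?_⟩
  rw [List.get_eq_getElem, List.get_eq_getElem, ← List.getElem_zip (h := by simp; omega)]
  exact List.getElem_mem _

theorem exists_ofFn_of_forall₂ {α β : Type*} {R : α → β → Prop} {n : ℕ} {u : Fin n → α}
    {l : List β} (h : List.Forall₂ R (List.ofFn u) l) :
    ∃ u' : Fin n → β, l = List.ofFn u' ∧ ∀ i, R (u i) (u' i) := by
  rw [List.forall₂_iff_get] at h
  obtain rfl : n = l.length := by simpa using h.1
  exact ⟨l.get, (List.ofFn_get l).symm, fun i => by simpa using h.2 i (by simp) i.2⟩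

/-- Equal pieces have equal dimensions, so the two concatenated lists of coordinates are cut at the
same places. -/
theorem forall₂_tupRel {m : List (ℕ × ℕ)} {us us' : List (τ.Tup (Pt Z))}
    (h : (us.map elOf).map (fun u => u.1) = (us'.map elOf).map fun u => u.1)
    (hm : List.Forall₂ (fun a b => (a, b) ∈ m) (coords us) (coords us')) :
    List.Forall₂ (TupRel m) us us' := by
  induction us generalizing us' with
  | nil =>
    rw [List.map_nil, List.map_nil, eq_comm, List.map_eq_nil_iff, List.map_eq_nil_iff] at h
    subst h
    exact .nil
  | cons u us ih =>
    obtain _ | ⟨u', us'⟩ := us'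
    · simp at h
    obtain ⟨a, x⟩ := u
    obtain ⟨a', x'⟩ := u'
    simp only [List.map_cons, List.cons.injEq] at h
    obtain rfl := Fin.ext h.1
    simp only [coords, List.map_cons, List.flatMap_cons] at hm
    obtain ⟨h1, h2⟩ := forall₂_append_split (by simp [elOf]) hm
    refine .cons ⟨a, x, x', rfl, rfl, fun j => ?_⟩ (ih h.2 h2)
    rw [List.forall₂_iff_get] at h1
    simpa [elOf] using h1.2 j (by simp [elOf]) (by simp [elOf])

/-! ### Finiteness of the table of a translation -/

variable (τ) in
/-- `d` is large enough for truth in the interpreted structure to depend on isomorphism types up to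
`d` only. -/
structure IsBound (q D : ℕ) (d : ℕ) : Prop where
  pieces : τ.pieces ≤ d
  dim_le : ∀ a, τ.dim a ≤ D
  le : D ≤ d
  dom : ∀ a, q + 1 * D + depth (τ.dom a) + 2 ≤ d
  eq : ∀ a b, q + 2 * D + depth (τ.eq a b) + 4 ≤ d
  rel : ∀ {n : ℕ} (R : (lang S).Relations n) a, q + n * D + depth (τ.rel R a) +
    (2 * R.1 + 2) + (n + 1) ≤ d
  graph : ∀ {n : ℕ} (f : (lang S).Functions n) a b, q + (n + 1) * D + depth (τ.graph f a b) +
    (2 * f.1 + 3) + (n + 2) ≤ d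

variable (τ) in
theorem exists_isBound (q : ℕ) : ∃ D d, IsBound τ q D d := by
  obtain ⟨D, hD⟩ := Finite.exists_le τ.dim
  obtain ⟨d₁, h₁⟩ := Finite.exists_le fun a => q + 1 * D + depth (τ.dom a) + 2
  obtain ⟨d₂, h₂⟩ := Finite.exists_le fun a : Fin τ.pieces × Fin τ.pieces =>
    q + 2 * D + depth (τ.eq a.1 a.2) + 4
  -- Indexing the symbols by their positions, with the arity read off the signature, makes the index
  -- type finite.
  obtain ⟨d₃, h₃⟩ := Finite.exists_le
    fun a : Σ i : Fin S.2.length, Fin (S.2.get i) → Fin τ.pieces =>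
      q + S.2.get a.1 * D + depth (τ.rel (⟨a.1, rfl⟩ : (lang S).Relations (S.2.get a.1)) a.2) +
        (2 * a.1 + 2) + (S.2.get a.1 + 1)
  obtain ⟨d₄, h₄⟩ := Finite.exists_le
    fun a : (Σ i : Fin S.1.length, Fin (S.1.get i) → Fin τ.pieces) × Fin τ.pieces =>
      q + (S.1.get a.1.1 + 1) * D +
        depth (τ.graph (⟨a.1.1, rfl⟩ : (lang S).Functions (S.1.get a.1.1)) a.1.2 a.2) +
        (2 * a.1.1 + 3) + (S.1.get a.1.1 + 2)
  refine ⟨D, τ.pieces + D + d₁ + d₂ + d₃ + d₄, by omega, hD, by omega, fun a => ?_, fun a b => ?_,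
    ?_, ?_⟩
  · have := h₁ a; omega
  · have := h₂ (a, b); dsimp only at this; omega
  · rintro n ⟨i, rfl⟩ a
    have := h₃ ⟨i, a⟩; dsimp only at this ⊢; omega
  · rintro n ⟨i, rfl⟩ a b
    have := h₄ (⟨i, a⟩, b); dsimp only at this ⊢; omega

theorem length_coords_le {D : ℕ} (hD : ∀ a, τ.dim a ≤ D) (us : List (τ.Tup (Pt Z))) :
    (coords us).length ≤ us.length * D := by
  induction us with
  | nil => simp [coords]
  | cons u us ih =>
    simp only [coords, List.map_cons, List.flatMap_cons, List.length_append, List.length_cons] at *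
    rw [Nat.succ_mul]
    have := hD u.1
    simp only [elOf, List.length_ofFn]
    omega

theorem IsBound.holds_le {D d : ℕ} (hb : IsBound τ τ.params D d) {s : ℕ}
    {us : List (τ.Tup (Pt Z))} (h : Holds τ p s us) :
    s ≤ d ∧ us.length + 1 ≤ d ∧ (paramList p ++ coords us).length ≤ d := by
  have hc := length_coords_le hb.dim_le us
  rw [List.length_append, paramList, List.length_ofFn]
  cases h with
  | dom u h => have := hb.dom u.1; simp at hc ⊢; omega
  | eq u v h => have := hb.eq u.1 v.1; simp at hc ⊢; omega
  | rel R u h => have := hb.rel R fun i => (u i).1; simp at hc ⊢; omega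
  | graph f u v h => have := hb.graph f (fun i => (u i).1) v.1; simp at hc ⊢; omega

/-- Lists with equal patterns are matched by a partial isomorphism fixing the parameters. The bound
`d` leaves enough rounds for the depth of every formula of the translation. -/
theorem IsBound.holds_congr {D d : ℕ} (hb : IsBound τ τ.params D d) {s : ℕ}
    {us us' : List (τ.Tup (Pt Z))} (h : Holds τ p s us)
    (hk : key d (paramList p) s (us.map elOf) = key d (paramList p) s (us'.map elOf)) :
    Holds τ p s us' := by
  simp only [key, Prod.mk.injEq, List.cons.injEq, true_and] at hk
  obtain ⟨hk1, hk2⟩ := hk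
  change pattern d (paramList p ++ coords us) = pattern d (paramList p ++ coords us') at hk2
  obtain ⟨hlen, hiso⟩ := isPartialIso_zip hk2
  have hmlen : ((paramList p ++ coords us).zip (paramList p ++ coords us')).length =
      τ.params + (coords us).length := by
    rw [List.length_zip, ← hlen, min_self, List.length_append, paramList, List.length_ofFn]
  obtain ⟨hp, hc⟩ := forall₂_append_split rfl (forall₂_zip hlen)
  have hmem : ∀ q ∈ (paramList p ++ coords us).zip (paramList p ++ coords us'),
      q.1 ∈ points Z ∧ q.2 ∈ points Z := by
    have key : ∀ vs : List (τ.Tup (Pt Z)), ∀ x ∈ paramList p ++ coords vs, x ∈ points Z := by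
      intro vs x hx
      rcases List.mem_append.1 hx with hx | hx
      · obtain ⟨i, rfl⟩ := (List.mem_ofFn' _ _).1 hx
        exact (p i).2
      · obtain ⟨u, hu, hx⟩ := List.mem_flatMap.1 hx
        obtain ⟨v, hv, rfl⟩ := List.mem_map.1 hu
        obtain ⟨j, rfl⟩ := (List.mem_ofFn' _ _).1 hx
        exact (v.2 j).2
    exact fun q hq => ⟨key _ _ (List.of_mem_zip hq).1, key _ _ (List.of_mem_zip hq).2⟩
  have ht := forall₂_tupRel hk1 hc
  have hlc := length_coords_le hb.dim_le us
  generalize (paramList p ++ coords us).zip (paramList p ++ coords us') = m at *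
  have hp' : ∀ i, ((p i).1, (p i).1) ∈ m := by
    intro i
    rw [List.forall₂_iff_get] at hp
    simpa [paramList] using hp.2 i (by simp [paramList]) (by simp [paramList])
  have tr : ∀ {γ : Type} (ψ : langJ.Formula (Fin τ.params ⊕ γ)) {y y' : γ → Pt Z},
      (∀ c, ((y c).1, (y' c).1) ∈ m) → m.length + depth ψ ≤ d → ψ.Realize (Sum.elim p y) →
      ψ.Realize (Sum.elim p y') := fun {γ} ψ {y y'} hy hd H =>
    realize_of_isPartialIso ψ hiso hmem (fun c => by
      rcases c with i | c
      · exact hp' i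
      · exact hy c) (fun i => i.elim0) hd H
  cases h with
  | dom u h =>
    cases ht with
    | cons h1 h2 =>
      cases h2
      obtain ⟨a, x, x', rfl, rfl, hx⟩ := h1
      have hb' := hb.dom a
      simp only [List.length_singleton] at hlc
      exact .dom _ (tr (τ.dom a) hx (by omega) h)
  | eq u v h =>
    cases ht with
    | cons h1 h2 =>
      cases h2 with
      | cons h2 h3 =>
        cases h3
        obtain ⟨a, x, x', rfl, rfl, hx⟩ := h1
        obtain ⟨b, y, y', rfl, rfl, hy⟩ := h2
        have hb' := hb.eq a b
        simp only [List.length_cons, List.length_nil] at hlc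
        exact .eq _ _ (tr (τ.eq a b) (fun c => by
          rcases c with i | i
          · exact hx i
          · exact hy i) (by omega) h)
  | rel R u h =>
    obtain ⟨u', rfl, hu⟩ := exists_ofFn_of_forall₂ ht
    choose a x x' hx hx' hm using hu
    obtain rfl := funext hx
    obtain rfl := funext hx'
    have hb' := hb.rel R a
    rw [List.length_ofFn] at hlc
    exact .rel _ _ (tr (τ.rel R a) (fun c => hm c.1 c.2) (by omega) h)
  | graph f u v h =>
    cases ht with
    | cons h1 h2 =>
      obtain ⟨b, y, y', rfl, rfl, hy⟩ := h1
      obtain ⟨u', rfl, hu⟩ := exists_ofFn_of_forall₂ h2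
      choose a x x' hx hx' hm using hu
      obtain rfl := funext hx
      obtain rfl := funext hx'
      have hb' := hb.graph f a b
      rw [List.length_cons, List.length_ofFn] at hlc
      exact .graph _ _ _ (tr (τ.graph f a b) (fun c => by
        rcases c with c | i
        · exact hm c.1 c.2
        · exact hy i) (by omega) h)

theorem finite_lists {α : Type*} {s : Set α} (hs : s.Finite) (N : ℕ) :
    {l : List α | l.length ≤ N ∧ ∀ x ∈ l, x ∈ s}.Finite := by
  induction N with
  | zero =>
    refine (Set.finite_singleton []).subset fun l hl => ?_
    exact List.eq_nil_of_length_eq_zero (Nat.le_zero.1 hl.1)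
  | succ N ih =>
    refine ((hs.image2 List.cons ih).insert []).subset fun l hl => ?_
    rcases l with _ | ⟨x, l⟩
    · exact .inl rfl
    · refine .inr ⟨x, hl.2 x (by simp), l, ⟨?_, fun y hy => hl.2 y (by simp [hy])⟩, rfl⟩
      have := hl.1
      rw [List.length_cons] at this
      omega

theorem clsSize_le (d x : ℕ) : clsSize d x ≤ d := by
  rw [clsSize]
  by_cases h : cls x % 2 = 1 <;> by_cases h' : cls x / 2 < d <;> simp [h, h']

/-- All entries and all lengths occurring in such keys are bounded by `d`. -/
theorem finite_keys (d : ℕ) (p : List ℕ) : {k | ∃ s us, (s ≤ d ∧ us.length + 1 ≤ d ∧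
    (p ++ us.flatMap fun u => u.2).length ≤ d ∧ ∀ u ∈ us, u.1 ≤ d) ∧ k = key d p s us}.Finite := by
  have h1 := finite_lists (Set.finite_Iic d) d
  have h2 := finite_lists (Set.finite_univ (α := Bool × Bool)) d
  have h3 := finite_lists (h2.prod (Set.finite_Iic d)) d
  refine (h1.prod h3).subset ?_
  rintro _ ⟨s, us, ⟨hs, hl, hc, hu⟩, rfl⟩
  refine ⟨⟨by simpa [key] using hl, fun x hx => ?_⟩, by simpa [key, pattern] using hc,
    fun x hx => ?_⟩
  · rcases List.mem_cons.1 hx with rfl | hx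
    · exact hs
    · obtain ⟨u, hu', rfl⟩ := List.mem_map.1 hx
      exact hu u hu'
  · obtain ⟨y, -, rfl⟩ := List.mem_map.1 hx
    exact ⟨⟨by simpa using hc, fun _ _ => trivial⟩, clsSize_le _ _⟩

variable (p) in
/-- Every translation, with parameters from a standard model, has a description. -/
theorem exists_desc : ∃ δ : Desc, δ.2.2 = paramList p ∧ τ.pieces ≤ δ.1 ∧ (∀ a, τ.dim a ≤ δ.1) ∧
    (∀ x ∈ paramList p, x < δ.1) ∧
    (∀ s us, atom δ s (us.map elOf) = true ↔ Holds τ p s us) ∧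
    ∀ s us, atom δ s us = true → ∃ us', Holds τ p s us' ∧
      key δ.1 δ.2.2 s us = key δ.1 δ.2.2 s (us'.map elOf) := by
  obtain ⟨D, d₀, hb₀⟩ := exists_isBound τ τ.params
  -- The sum puts every parameter below `d`; enlarging a bound is harmless.
  let d := d₀ + (paramList p).sum + 1
  have hb : IsBound τ τ.params D d :=
    ⟨by have := hb₀.pieces; omega, hb₀.dim_le, by have := hb₀.le; omega,
      fun a => (hb₀.dom a).trans (by omega), fun a b => (hb₀.eq a b).trans (by omega),
      fun R a => (hb₀.rel R a).trans (by omega), fun f a b => (hb₀.graph f a b).trans (by omega)⟩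
  have hfin : {k | ∃ s us, Holds τ p s us ∧ k = key d (paramList p) s (us.map elOf)}.Finite := by
    refine (finite_keys d (paramList p)).subset ?_
    rintro _ ⟨s, us, h, rfl⟩
    obtain ⟨h1, h2, h3⟩ := hb.holds_le h
    refine ⟨s, us.map elOf, ⟨h1, by simpa using h2, h3, fun u hu => ?_⟩, rfl⟩
    obtain ⟨v, -, rfl⟩ := List.mem_map.1 hu
    exact v.1.2.le.trans hb.pieces
  have hmem : ∀ s us, atom (d, hfin.toFinset.toList, paramList p) s us = true ↔
      ∃ us', Holds τ p s us' ∧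
        key d (paramList p) s us = key d (paramList p) s (us'.map elOf) := by
    intro s us
    simp only [atom, inList_iff, Finset.mem_toList, Set.Finite.mem_toFinset, Set.mem_ofPred_eq]
    constructor
    · rintro ⟨s', us', h, hk⟩
      -- The symbol heads the key, so equal keys belong to the same symbol.
      obtain rfl : s = s' := by
        have := congrArg (fun k : Key => k.1.head?) hk
        simpa [key] using this
      exact ⟨us', h, hk⟩
    · rintro ⟨us', h, hk⟩
      exact ⟨s, us', h, hk⟩
  refine ⟨(d, hfin.toFinset.toList, paramList p), rfl, hb.pieces,
    fun a => (hb.dim_le a).trans hb.le, fun x hx => ?_, fun s us => ?_,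
    fun s us h => (hmem s us).1 h⟩
  · have := List.single_le_sum (l := paramList p) (by simp) x hx
    change x < d
    omega
  · rw [hmem]
    exact ⟨fun ⟨us', h, hk⟩ => hb.holds_congr h hk.symm, fun h => ⟨us, h, rfl⟩⟩

end Table

section Describes

variable {S : Sig} {τ : Translation (lang S) langJ} {Z : Set ℕ}

/-- `δ` describes the structure that `τ` interprets in the standard model, with parameters `p`. -/
structure Describes (τ : Translation (lang S) langJ) (p : Fin τ.params → Pt Z) (δ : Desc) :
    Prop where
  param : δ.2.2 = paramList p
  lt : ∀ x ∈ paramList p, x < δ.1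
  inDom_iff : ∀ u, InDom δ (points Z) u ↔ ∃ w : τ.Tup (Pt Z), u = elOf w ∧
    (τ.dom w.1).Realize (Sum.elim p w.2)
  atom_iff : ∀ s us, atom δ s (us.map elOf) = true ↔ Holds τ p s us

/-- The delicate point is that the described domain has no spurious elements: an entry of the table
comes from a genuine tuple, whose key fixes the piece and the number of coordinates. -/
theorem exists_describes (p : Fin τ.params → Pt Z) : ∃ δ, Describes τ p δ := by
  obtain ⟨δ, h1, h2, h3, h4, h5, h6⟩ := exists_desc p
  refine ⟨δ, h1, h4, fun u => ⟨?_, ?_⟩, h5⟩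
  · rintro ⟨-, -, hV, ha⟩
    obtain ⟨us', hh, hk⟩ := h6 _ _ ha
    obtain ⟨⟨a, x⟩, rfl, -⟩ := holds_dom hh
    simp only [key, List.map_cons, List.map_nil, elOf, Prod.mk.injEq, List.cons.injEq, and_true,
      true_and, List.flatMap_cons, List.flatMap_nil, List.append_nil] at hk
    obtain ⟨b, l⟩ := u
    obtain ⟨rfl, hk⟩ := hk
    -- The parameters contribute equally to both patterns, so the length of `l` is the dimension of
    -- the piece `a`.
    have hlen := congrArg List.length hk
    simp only [pattern, List.length_map, List.length_append, List.length_ofFn,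
      Nat.add_left_cancel_iff] at hlen
    dsimp only at hlen hV
    have hw : ((a : ℕ), l) =
        elOf (⟨a, fun j => ⟨l[j], hV _ (List.getElem_mem _)⟩⟩ : τ.Tup (Pt Z)) := by
      simp only [elOf, Prod.mk.injEq, true_and]
      exact List.ext_getElem (by simpa using hlen) fun i _ _ => by simp
    refine ⟨_, hw, ?_⟩
    rw [hw] at ha
    obtain ⟨w, hw', hr⟩ := holds_dom ((h5 0 [_]).1 ha)
    rw [List.cons.injEq] at hw'
    rw [hw'.1]
    exact hr
  · rintro ⟨w, rfl, hw⟩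
    refine ⟨w.1.2.le.trans h2, by simpa [elOf] using h3 w.1, fun x hx => ?_, ?_⟩
    · obtain ⟨j, rfl⟩ := (List.mem_ofFn' _ _).1 hx
      exact (w.2 j).2
    · exact (h5 0 [w]).2 (.dom w hw)

variable {p : Fin τ.params → Pt Z} {δ : Desc}

theorem map_elOf_ofFn {n : ℕ} (w : Fin n → τ.Tup (Pt Z)) :
    (List.ofFn fun i => elOf (w i)) = (List.ofFn w).map elOf := by
  simp [List.map_ofFn, Function.comp_def]

theorem Describes.realize_termF (h : Describes τ p δ) {n : ℕ}
    (t : (lang S).Term (Empty ⊕ Fin n)) {β : Type} {q : Fin τ.params → β} {x : Fin n → τ.Tup β}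
    {v : τ.Tup β} {σ : β → Pt Z} (hq : σ ∘ q = p) :
    (τ.termF t β q x v).Realize σ ↔ Tm (InDom δ (points Z)) (fun s us => atom δ s us = true) t
      (List.ofFn fun i => elOf ((x i).map σ)) (elOf (v.map σ)) := by
  induction t generalizing β with
  | var y =>
    rcases y with ⟨⟨⟩⟩ | i
    rw [Translation.termF, realize_sameF, Tm]
    simp [elOf_injective.eq_iff]
  | @func l f ts ih =>
    rw [Translation.termF, realize_exF (Q := fun w =>
      (∀ i, Tm (InDom δ (points Z)) (fun s us => atom δ s us = true) (ts i)
        (List.ofFn fun i => elOf ((x i).map σ)) (elOf (w i))) ∧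
      atom δ (2 * f.1 + 3) (elOf (v.map σ) :: List.ofFn fun i => elOf (w i)) = true), hq, Tm]
    · constructor
      · rintro ⟨w, hw, h1, h2⟩
        exact ⟨_, fun i => (h.inDom_iff _).2 ⟨w i, rfl, hw i⟩, h1, h2⟩
      · rintro ⟨w, hw, h1, h2⟩
        choose w' hw' hd using fun i => (h.inDom_iff _).1 (hw i)
        obtain rfl := funext hw'
        exact ⟨w', hd, h1, h2⟩
    · rintro γ g ρ u rfl
      rw [Formula.realize_inf, Formula.realize_iInf]
      refine and_congr (forall_congr' fun i => ?_) ?_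
      · exact ih i hq
      · rw [map_elOf_ofFn fun i => (u i).map ρ, ← List.map_cons, h.atom_iff,
          Translation.graphF, Formula.realize_relabel, Sum.comp_elim, Sum.comp_elim,
          ← Function.comp_assoc, hq]
        exact ⟨fun h' => .graph f _ _ h', holds_graph⟩

/-- The translated quantifiers run over tuples in the domain, which `inDom_iff` matches with the
described domain; atomic formulas agree by `atom_iff`. -/
theorem Describes.realize_formulaF (h : Describes τ p δ) {n : ℕ}
    (φ : (lang S).BoundedFormula Empty n) {β : Type} {q : Fin τ.params → β} {x : Fin n → τ.Tup β}
    {σ : β → Pt Z} (hq : σ ∘ q = p) :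
    (τ.formulaF φ β q x).Realize σ ↔ Fm (InDom δ (points Z)) (fun s us => atom δ s us = true) φ
      (List.ofFn fun i => elOf ((x i).map σ)) := by
  induction φ generalizing β with
  | falsum => exact Iff.rfl
  | equal t u =>
    rw [Translation.formulaF, realize_exF (Q := fun w =>
      Tm (InDom δ (points Z)) (fun s us => atom δ s us = true) t
        (List.ofFn fun i => elOf ((x i).map σ)) (elOf (w 0)) ∧
      Tm (InDom δ (points Z)) (fun s us => atom δ s us = true) u
        (List.ofFn fun i => elOf ((x i).map σ)) (elOf (w 1)) ∧
      atom δ 1 [elOf (w 0), elOf (w 1)] = true), hq, Fm]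
    · constructor
      · rintro ⟨w, hw, h1, h2, h3⟩
        exact ⟨_, _, (h.inDom_iff _).2 ⟨w 0, rfl, hw 0⟩, (h.inDom_iff _).2 ⟨w 1, rfl, hw 1⟩,
          h1, h2, h3⟩
      · rintro ⟨v, w, hv, hw, h1, h2, h3⟩
        obtain ⟨v, rfl, hv'⟩ := (h.inDom_iff _).1 hv
        obtain ⟨w, rfl, hw'⟩ := (h.inDom_iff _).1 hw
        exact ⟨![v, w], Fin.forall_fin_two.2 ⟨hv', hw'⟩, h1, h2, h3⟩
    · rintro γ g ρ w rfl
      rw [Formula.realize_inf, Formula.realize_inf]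
      refine and_congr (h.realize_termF t hq) (and_congr (h.realize_termF u hq) ?_)
      have := h.atom_iff 1 [(w 0).map ρ, (w 1).map ρ]
      rw [List.map_cons, List.map_cons, List.map_nil] at this
      rw [this, Translation.eqF, Formula.realize_relabel, Sum.comp_elim, Sum.comp_elim,
          ← Function.comp_assoc, hq]
      exact ⟨fun h' => .eq _ _ h', holds_eq⟩
  | @rel n l R ts =>
    rw [Translation.formulaF, realize_exF (Q := fun w =>
      (∀ i, Tm (InDom δ (points Z)) (fun s us => atom δ s us = true) (ts i)
        (List.ofFn fun i => elOf ((x i).map σ)) (elOf (w i))) ∧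
      atom δ (2 * R.1 + 2) (List.ofFn fun i => elOf (w i)) = true), hq, Fm]
    · constructor
      · rintro ⟨w, hw, h1, h2⟩
        exact ⟨_, fun i => (h.inDom_iff _).2 ⟨w i, rfl, hw i⟩, h1, h2⟩
      · rintro ⟨w, hw, h1, h2⟩
        choose w' hw' hd using fun i => (h.inDom_iff _).1 (hw i)
        obtain rfl := funext hw'
        exact ⟨w', hd, h1, h2⟩
    · rintro γ g ρ u rfl
      rw [Formula.realize_inf, Formula.realize_iInf]
      refine and_congr (forall_congr' fun i => h.realize_termF (ts i) hq) ?_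
      rw [map_elOf_ofFn fun i => (u i).map ρ, h.atom_iff,
          Translation.relF, Formula.realize_relabel, Sum.comp_elim,
          ← Function.comp_assoc, hq]
      exact ⟨fun h' => .rel R _ h', holds_rel⟩
  | imp φ ψ ih₁ ih₂ =>
    rw [Translation.formulaF, Formula.realize_imp, Fm, ih₁ hq, ih₂ hq]
  | @all n φ ih =>
    rw [Translation.formulaF, realize_allF (Q := fun w =>
      Fm (InDom δ (points Z)) (fun s us => atom δ s us = true) φ
        ((List.ofFn fun i => elOf ((x i).map σ)) ++ [elOf w])), hq, Fm]
    · constructor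
      · intro H u hu
        obtain ⟨w, rfl, hw⟩ := (h.inDom_iff _).1 hu
        exact H w hw
      · exact fun H w hw => H _ ((h.inDom_iff _).2 ⟨w, rfl, hw⟩)
    · rintro γ g ρ u rfl
      rw [ih (q := g ∘ q) (σ := ρ) hq, List.ofFn_succ', List.concat_eq_append]
      simp only [Fin.snoc_castSucc, Fin.snoc_last]
      rfl

theorem Describes.realize_sentenceF (h : Describes τ p δ) (φ : (lang S).Sentence) :
    (τ.sentenceF φ).Realize p ↔
      Fm (InDom δ (points Z)) (fun s us => atom δ s us = true) φ [] := by
  rw [Translation.sentenceF, h.realize_formulaF φ (Function.comp_id p)]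
  simp

end Describes

/-! ### Evaluation of sentences in described structures -/

/-- The finite set with the characteristic number `z`. -/
def bitSet (z : ℕ) : Set ℕ := {s | z / 2 ^ s % 2 = 1}

theorem exists_bitSet_eq (Z : Set ℕ) (y : ℕ) :
    ∃ z < 2 ^ (y + 1), bitSet z = {s | s ∈ Z ∧ s ≤ y} := by
  classical
  refine ⟨Nat.ofBits fun i : Fin (y + 1) => decide ((i : ℕ) ∈ Z), Nat.ofBits_lt_two_pow _, ?_⟩
  ext s
  have h := Nat.testBit_eq_decide_div_mod_eq
    (x := Nat.ofBits fun i : Fin (y + 1) => decide ((i : ℕ) ∈ Z)) (i := s)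
  simp only [bitSet, Set.mem_ofPred_eq]
  by_cases hs : s < y + 1
  · rw [Nat.testBit_ofBits_lt _ _ hs, decide_eq_decide] at h
    rw [← h]
    simp [Nat.lt_succ_iff.1 hs]
  · rw [Nat.testBit_ofBits_ge _ _ (by omega)] at h
    simp only [Bool.false_eq, decide_eq_false_iff_not] at h
    simp only [h, false_iff]
    omega

/-- Whether `x` lies in `points (bitSet z)`. -/
def isPoint (z x : ℕ) : Bool :=
  decide (cls x % 2 = 0) || decide (z / 2 ^ (cls x / 2) % 2 = 1) && decide (idx x ≤ cls x / 2)

theorem isPoint_iff {z x : ℕ} : isPoint z x = true ↔ x ∈ points (bitSet z) := by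
  simp [isPoint, points, bitSet]

/-- The elements of `truncation (bitSet z) T`. -/
def truncList (z T : ℕ) : List ℕ :=
  (List.range ((2 * T + 1) * (2 * T + 1))).filter fun x =>
    isPoint z x && (decide (cls x < 2 * T) && decide (idx x < T))

theorem mem_truncList {z T x : ℕ} : x ∈ truncList z T ↔ x ∈ truncation (bitSet z) T := by
  simp only [truncList, List.mem_filter, List.mem_range, Bool.and_eq_true, decide_eq_true_eq,
    isPoint_iff, truncation, Set.mem_ofPred_eq, and_iff_right_iff_imp]
  rintro ⟨_, h1, h2⟩
  -- A pair with both components at most `2 * T` is below `(2 * T + 1) ^ 2`, so the search range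
  -- misses nothing.
  have h := Nat.pair_lt_max_add_one_sq (cls x) (idx x)
  rw [cls, idx, Nat.pair_unpair] at h
  have h3 : max (Nat.unpair x).1 (Nat.unpair x).2 + 1 ≤ 2 * T + 1 := by
    rw [cls] at h1; rw [idx] at h2; omega
  have h4 := Nat.mul_le_mul h3 h3
  rw [sq] at h
  omega

/-- The elements of the domain of the structure described by `δ` over the universe `V`. -/
def elList (δ : Desc) (V : List ℕ) : List El :=
  ((List.range (δ.1 + 1)).flatMap fun a => (assignments V δ.1).map fun l => (a, l)).filter
    fun u => atom δ 0 [u]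

theorem mem_elList {δ : Desc} {V : List ℕ} {u : El} :
    u ∈ elList δ V ↔ InDom δ {x | x ∈ V} u := by
  simp only [elList, List.mem_filter, List.mem_flatMap, List.mem_map, List.mem_range,
    mem_assignments, InDom, Set.mem_ofPred_eq]
  constructor
  · rintro ⟨⟨a, ha, l, hl, rfl⟩, h⟩
    exact ⟨Nat.lt_succ_iff.1 ha, hl.1, hl.2, h⟩
  · rintro ⟨h1, h2, h3, h4⟩
    exact ⟨⟨u.1, Nat.lt_succ_iff.2 h1, u.2, ⟨h2, h3⟩, rfl⟩, h4⟩

/-- The truth value of the sentence with Gödel number `c` in the structure described by `δ` over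
`truncation (bitSet z) T`. -/
def evalSentence (z : ℕ) (δ : Desc) (T c : ℕ) : Bool :=
  inList [] (sat (elList δ (truncList z T)) δ c c)

theorem evalSentence_iff {S : Sig} (z : ℕ) (δ : Desc) (T : ℕ) (φ : (lang S).Sentence) :
    evalSentence z δ T (formulaCode φ) = true ↔
      Fm (InDom δ (truncation (bitSet z) T)) (fun s us => atom δ s us = true) φ [] := by
  rw [evalSentence, inList_iff, mem_sat _ _ φ (by simp) rfl (by omega)]
  have h : (fun u => u ∈ elList δ (truncList z T)) = InDom δ (truncation (bitSet z) T) := by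
    funext u
    rw [mem_elList]
    simp only [mem_truncList, Set.ofPred_mem_eq]
  rw [h]

/-- A size of universe sufficient to evaluate the sentence with Gödel number `c`. -/
def level (δ : Desc) (c : ℕ) : ℕ := δ.1 + δ.2.2.length + 2 * δ.1 * c

/-- Whether the parameters of `δ` are elements of `points (bitSet z)` below the bound. -/
def validParams (z : ℕ) (δ : Desc) : Bool :=
  δ.2.2.all fun x => decide (x < δ.1) && isPoint z x

theorem mem_truncation_of_lt {Z : Set ℕ} {T x : ℕ} (hx : x ∈ points Z) (hT : x < T) :
    x ∈ truncation Z T := by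
  have h1 := Nat.unpair_left_le x
  have h2 := Nat.unpair_right_le x
  exact ⟨hx, by rw [cls]; omega, by rw [idx]; omega⟩

/-- Both universes are rich enough for `level` many rounds; parameters below `δ.1` already lie in
the truncation, so they can be played at the start. -/
theorem fm_truncation_iff {S : Sig} {Z : Set ℕ} {δ : Desc} (φ : (lang S).Sentence)
    (hp : ∀ x ∈ δ.2.2, x < δ.1 ∧ x ∈ points Z) {T : ℕ} (hT : level δ (formulaCode φ) ≤ T) :
    Fm (InDom δ (truncation Z T)) (fun s us => atom δ s us = true) φ [] ↔
      Fm (InDom δ (points Z)) (fun s us => atom δ s us = true) φ [] :=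
  fm_iff φ (isRich_truncation Z T) (isRich_points Z T)
    (fun x hx => ⟨mem_truncation_of_lt (hp x hx).2 ((hp x hx).1.trans_le (by
      rw [level] at hT; omega)), (hp x hx).2⟩) hT

section Computability

variable {α : Type*} [Primcodable α] {z T c : α → ℕ} {δ : α → Desc}

@[fun_prop] theorem primrec_isPoint {x : α → ℕ} (hz : Primrec z) (hx : Primrec x) :
    Primrec fun a => isPoint (z a) (x a) := by
  unfold isPoint idx
  fun_prop

@[fun_prop] theorem primrec_evalSentence (hz : Primrec z) (hδ : Primrec δ) (hT : Primrec T)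
    (hc : Primrec c) : Primrec fun a => evalSentence (z a) (δ a) (T a) (c a) := by
  unfold evalSentence elList truncList idx
  fun_prop

@[fun_prop] theorem primrec_level (hδ : Primrec δ) (hc : Primrec c) :
    Primrec fun a => level (δ a) (c a) := by
  unfold level
  fun_prop

@[fun_prop] theorem primrec_validParams (hz : Primrec z) (hδ : Primrec δ) :
    Primrec fun a => validParams (z a) (δ a) := by
  unfold validParams
  fun_prop

@[fun_prop] theorem primrec_evaln {k n : α → ℕ} {e : α → Nat.Partrec.Code} (hk : Primrec k)
    (he : Primrec e) (hn : Primrec n) : Primrec fun a => Nat.Partrec.Code.evaln (k a) (e a) (n a) :=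
  Nat.Partrec.Code.primrec_evaln.comp ((hk.pair he).pair hn)

@[fun_prop] theorem primrec_decode_desc {i : α → ℕ} (hi : Primrec i) :
    Primrec fun a => Encodable.decode (α := Desc) (i a) := Primrec.decode.comp hi

end Computability

/-! ### The search for a failure -/

/-- The description with the number `i`. -/
def descOf (i : ℕ) : Desc := (Encodable.decode (α := Desc) i).getD (0, [], [])

/-- Whether `s` witnesses that the `i`-th description does not yield, over `points (bitSet z)`, a
model of the theory with signature and index `a`. -/
def fails (a : Sig × Nat.Partrec.Code) (z i s : ℕ) : Bool :=
  !validParams z (descOf i) ||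
    ((inList (Nat.unpair (Nat.unpair s).2).1 (lawCodes a.1) ||
        (isSentence a.1 (Nat.unpair (Nat.unpair s).2).1 &&
          (Nat.Partrec.Code.evaln (Nat.unpair s).1 a.2 (Nat.unpair (Nat.unpair s).2).1).isSome)) &&
      (decide (level (descOf i) (Nat.unpair (Nat.unpair s).2).1 ≤ (Nat.unpair (Nat.unpair s).2).2)
        && !evalSentence z (descOf i) (Nat.unpair (Nat.unpair s).2).2
          (Nat.unpair (Nat.unpair s).2).1))

@[fun_prop] theorem primrec_fails {α : Type*} [Primcodable α] {a : α → Sig × Nat.Partrec.Code}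
    {z i s : α → ℕ} (ha : Primrec a) (hz : Primrec z) (hi : Primrec i) (hs : Primrec s) :
    Primrec fun q => fails (a q) (z q) (i q) (s q) := by
  have h : Primrec fun q => lawCodes (a q).1 := primrec_lawCodes.comp (Primrec.fst.comp ha)
  unfold fails descOf
  fun_prop

theorem validParams_iff {z : ℕ} {δ : Desc} : validParams z δ = true ↔
    ∀ x ∈ δ.2.2, x < δ.1 ∧ x ∈ points (bitSet z) := by
  simp [validParams, isPoint_iff]

/-- Without a failure, the described structure satisfies the laws and the axioms, and its quotient
is a model of the theory. Evaluation over truncations would decide the complete theory of this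
model, a consistent extension. -/
theorem exists_fails {S : Sig} {e : Nat.Partrec.Code}
    (hU : EssentiallyUndecidable (reTheory S e)) (z i : ℕ) : ∃ s, fails (S, e) z i s = true := by
  by_contra! hf
  have hv : validParams z (descOf i) = true := by
    have := hf 0
    simp only [fails] at this
    by_contra h
    simp [h] at this
  have hp := validParams_iff.1 hv
  have hF : ∀ φ : (lang S).Sentence, (formulaCode φ ∈ lawCodes S ∨ φ ∈ reTheory S e) →
      Fm (InDom (descOf i) (points (bitSet z))) (fun s us => atom (descOf i) s us = true) φ [] := by
    intro φ hφ
    obtain ⟨k, hk⟩ : ∃ k, formulaCode φ ∈ lawCodes S ∨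
        (Nat.Partrec.Code.evaln k e (formulaCode φ)).isSome = true := by
      rcases hφ with h | h
      · exact ⟨0, .inl h⟩
      · obtain ⟨y, hy⟩ := Part.dom_iff_mem.1 h
        obtain ⟨k, hk⟩ := Nat.Partrec.Code.evaln_complete.1 hy
        exact ⟨k, .inr (Option.isSome_iff_exists.2 ⟨y, hk⟩)⟩
    -- A witness packs a step bound for recognising axioms, a Gödel number and a truncation size.
    have h := hf (Nat.pair k (Nat.pair (formulaCode φ) (level (descOf i) (formulaCode φ))))
    have hs : isSentence S (formulaCode φ) = true := isSentence_iff.2 ⟨φ, rfl⟩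
    have hE : evalSentence z (descOf i) (level (descOf i) (formulaCode φ)) (formulaCode φ) = true := by
      by_contra hE
      rw [Bool.not_eq_true] at hE
      apply h
      simp only [fails, Nat.unpair_pair, hs, hE, hv, Bool.true_and, le_refl, decide_true,
        Bool.not_false, Bool.and_true, Bool.not_true, Bool.false_or, Bool.or_eq_true, inList_iff]
      exact hk
    rw [evalSentence_iff] at hE
    exact (fm_truncation_iff φ hp le_rfl).1 hE
  obtain ⟨N, _, _, hN⟩ := exists_structure_of_laws fun φ hφ => hF φ (.inl hφ)
  have hmod : N ⊨ reTheory S e :=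
    Theory.model_iff _ |>.2 fun φ hφ => (hN φ).2 (hF φ (.inr hφ))
  have hiff : ∀ φ : (lang S).Sentence, ((lang S).completeTheory N) ⊨ᵇ φ ↔ N ⊨ φ := fun φ =>
    ⟨fun h => by
      have := (Theory.models_sentence_iff.1 h) (Theory.ModelType.of _ N)
      exact this, fun h => Theory.models_sentence_of_mem h⟩
  refine hU ((lang S).completeTheory N) (fun φ hφ => (hiff φ).2 ?_)
    (completeTheory.isSatisfiable _ N)
    -- Here `z` and `i` are fixed, so evaluation at the sufficient level is a decision procedure.
    ⟨fun n => evalSentence z (descOf i) (level (descOf i) n) n, ?_, fun φ => ?_⟩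
  · exact Theory.models_sentence_iff.1 hφ (Theory.ModelType.of _ N)
  · exact Primrec.to_comp (by fun_prop)
  · rw [evalSentence_iff, fm_truncation_iff φ hp le_rfl, hiff, hN]

/-! ### A computable sequence of searches -/

/-- The sequence starts at `0` and moves from `x` to `x + 1 + w`, for the least `w` with `P a x w`.
Being strictly increasing, it passes `n` within `n` steps, which decides whether `n` occurs. For bad
`a` the searches may diverge, so `c` is partial. -/
theorem exists_partrec_char {α : Type*} [Primcodable α] {P : α → ℕ → ℕ → Bool}
    (hP : Computable fun q : (α × ℕ) × ℕ => P q.1.1 q.1.2 q.2) :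
    ∃ c : α → ℕ →. ℕ, Partrec₂ c ∧ ∀ a, (∀ y, ∃ w, P a y w = true) →
      ∃ xs : ℕ → ℕ, StrictMono xs ∧ (∀ k, ∃ w < xs (k + 1), P a (xs k) w = true) ∧
        ∀ n, (n ∈ Set.range xs → c a n = Part.some 1) ∧ (n ∉ Set.range xs → c a n = Part.some 0) := by
  -- Once the target `q.2` is reached, the test succeeds at `w = 0` and the walk stays in place.
  let step : (α × ℕ) → ℕ →. ℕ := fun q x =>
    (Nat.rfind fun w => Part.some (decide (q.2 ≤ x) || P q.1 x w)).map fun w =>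
      bif decide (q.2 ≤ x) then x else x + 1 + w
  have hstep : Partrec₂ step := by
    have hle : Computable fun q : (α × ℕ) × ℕ => decide (q.1.2 ≤ q.2) :=
      Primrec.to_comp (by fun_prop)
    refine Partrec.map (Partrec.rfind (p := fun (q : (α × ℕ) × ℕ) w =>
      Part.some (decide (q.1.2 ≤ q.2) || P q.1.1 q.2 w)) ?_) ?_
    · refine Computable.partrec ?_
      exact (Primrec.or.to_comp).comp (hle.comp Computable.fst)
        (hP.comp (Computable.pair (Computable.pair
          (Computable.fst.comp (Computable.fst.comp Computable.fst))
          (Computable.snd.comp Computable.fst)) Computable.snd))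
    · exact Primrec.to_comp (show Primrec fun q : ((α × ℕ) × ℕ) × ℕ =>
        bif decide (q.1.1.2 ≤ q.1.2) then q.1.2 else q.1.2 + 1 + q.2 by fun_prop)
  let walk : (α × ℕ) → ℕ → Part ℕ := fun q k =>
    Nat.rec (Part.some 0) (fun _ IH => IH.bind fun x => step q x) k
  have hwalk : Partrec fun q : α × ℕ => walk q q.2 :=
    Partrec.nat_rec (f := fun q : α × ℕ => q.2) (g := fun _ => Part.some 0)
      (h := fun q (r : ℕ × ℕ) => step q r.2) Computable.snd (Computable.const 0).partrec
      (hstep.comp Computable.fst (Computable.snd.comp Computable.snd))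
  refine ⟨fun a n => (walk (a, n) n).map fun y => bif decide (y = n) then 1 else 0, ?_, ?_⟩
  · exact Partrec.map hwalk (Primrec.to_comp (show Primrec fun q : (α × ℕ) × ℕ =>
      (bif decide (q.2 = q.1.2) then 1 else 0 : ℕ) by fun_prop))
  intro a ha
  let xs : ℕ → ℕ := fun k => Nat.rec 0 (fun _ x => x + 1 + Nat.find (ha x)) k
  have hxs : ∀ k, xs (k + 1) = xs k + 1 + Nat.find (ha (xs k)) := fun k => rfl
  have hmono : StrictMono xs := strictMono_nat_of_lt_succ fun k => by rw [hxs]; omega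
  have hge : ∀ k, k ≤ xs k := fun k => hmono.le_apply
  have hdone : ∀ n x, n ≤ x → step (a, n) x = Part.some x := by
    intro n x h
    refine Part.eq_some_iff.2 ((Part.mem_map_iff _).2 ⟨0, Nat.mem_rfind.2 ?_, by simp [h]⟩)
    simp [h]
  have hgo : ∀ n x, x < n → step (a, n) x = Part.some (x + 1 + Nat.find (ha x)) := by
    intro n x h
    have h' : ¬ n ≤ x := by omega
    refine Part.eq_some_iff.2 ((Part.mem_map_iff _).2 ⟨Nat.find (ha x), Nat.mem_rfind.2 ?_,
      by simp [h']⟩)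
    simp only [h', decide_false, Bool.false_or, Part.mem_some_iff]
    exact ⟨(Nat.find_spec (ha x)).symm, fun {m} hm => by
      have := Nat.find_min (ha x) hm
      simpa using this⟩
  -- The walk has either stopped at or beyond `n` or advanced at every step; no earlier point of the
  -- sequence reaches `n`.
  have hw : ∀ n k, ∃ j, walk (a, n) k = Part.some (xs j) ∧ (n ≤ xs j ∨ j = k) ∧
      ∀ i < j, xs i < n := by
    intro n k
    induction k with
    | zero => exact ⟨0, rfl, .inr rfl, fun i hi => by omega⟩
    | succ k ih =>
      obtain ⟨j, h1, h2, h3⟩ := ih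
      have h4 : walk (a, n) (k + 1) = step (a, n) (xs j) := by
        change (walk (a, n) k).bind _ = _
        rw [h1, Part.bind_some]
      rcases le_or_gt n (xs j) with h | h
      · exact ⟨j, h4.trans (hdone _ _ h), .inl h, h3⟩
      · obtain rfl := h2.resolve_left h.not_ge
        refine ⟨j + 1, h4.trans (hgo _ _ h), .inr rfl, fun i hi => ?_⟩
        rcases Nat.lt_succ_iff_lt_or_eq.1 hi with hi | rfl
        · exact h3 i hi
        · exact h
  refine ⟨xs, hmono, fun k => ⟨_, by rw [hxs]; omega, Nat.find_spec (ha (xs k))⟩, fun n => ?_⟩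
  obtain ⟨j, h1, h2, h3⟩ := hw n n
  have h4 : n ≤ xs j := h2.elim id fun h => h ▸ hge j
  simp only [h1, Part.map_some]
  constructor
  · rintro ⟨i, rfl⟩
    have h5 : j ≤ i := not_lt.1 fun h => (h3 i h).false
    have h6 : xs i = xs j := le_antisymm h4 (hmono.monotone h5)
    simp [h6]
  · intro h
    have h5 : xs j ≠ n := fun h' => h ⟨j, h'⟩
    simp [h5]

/-- Indices of the sections of a partial recursive function can be computed. -/
theorem exists_computable_curry {α : Type*} [Primcodable α] {c : α → ℕ →. ℕ} (hc : Partrec₂ c) :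
    ∃ F : α → Nat.Partrec.Code, Computable F ∧ ∀ a n, (F a).eval n = c a n := by
  have hc' : Partrec fun n : ℕ =>
      (↑(Encodable.decode (α := α × ℕ) n) : Part (α × ℕ)).bind fun q => c q.1 q.2 :=
    Partrec.bind Computable.decode.ofOption (Partrec₂.comp hc (Computable.fst.comp Computable.snd)
      (Computable.snd.comp Computable.snd))
  obtain ⟨c₀, hc₀⟩ := Nat.Partrec.Code.exists_code.1 (Partrec.nat_iff.1 hc')
  refine ⟨fun a => c₀.curry (Encodable.encode a),
    (Nat.Partrec.Code.primrec₂_curry.comp (Primrec.const c₀) Primrec.encode).to_comp,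
    fun a n => ?_⟩
  have h : Nat.pair (Encodable.encode a) n = Encodable.encode (a, n) := rfl
  rw [Nat.Partrec.Code.eval_curry, hc₀]
  simp only [h, Encodable.encodek, Part.coe_some, Part.bind_some]

/-! ### Gaps that contain all failures -/

/-- Whether, for every set of numbers up to `y` and every description with number up to `y`, a
failure is found in fewer than `w` steps. -/
def allFail (a : Sig × Nat.Partrec.Code) (y w : ℕ) : Bool :=
  (List.range (2 ^ (y + 1))).all fun z => (List.range (y + 1)).all fun i =>
    (List.range w).any fun s => fails a z i s

theorem primrec_allFail :
    Primrec fun q : ((Sig × Nat.Partrec.Code) × ℕ) × ℕ => allFail q.1.1 q.1.2 q.2 := by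
  unfold allFail
  fun_prop

theorem allFail_iff {a : Sig × Nat.Partrec.Code} {y w : ℕ} : allFail a y w = true ↔
    ∀ z < 2 ^ (y + 1), ∀ i < y + 1, ∃ s < w, fails a z i s = true := by
  simp [allFail]

/-- Finitely many pairs have to be served, and the sum of their witnesses dominates each of them. -/
theorem exists_allFail {a : Sig × Nat.Partrec.Code} (h : ∀ z i, ∃ s, fails a z i s = true) (y : ℕ) :
    ∃ w, allFail a y w = true := by
  choose s hs using h
  refine ⟨(∑ z ∈ Finset.range (2 ^ (y + 1)), ∑ i ∈ Finset.range (y + 1), s z i) + 1, ?_⟩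
  rw [allFail_iff]
  intro z hz i hi
  refine ⟨s z i, Nat.lt_succ_iff.2 ?_, hs z i⟩
  exact (Finset.single_le_sum (f := fun i => s z i) (fun _ _ => Nat.zero_le _)
    (Finset.mem_range.2 hi)).trans
    (Finset.single_le_sum (f := fun z => ∑ i ∈ Finset.range (y + 1), s z i)
      (fun _ _ => Nat.zero_le _) (Finset.mem_range.2 hz))

/-- If failures of all descriptions are found within the gaps of the sequence `xs`, then no theory
axiomatised by sentences `A s` with `s` in the sequence interprets the given theory. -/
theorem not_interprets {S : Sig} {e : Nat.Partrec.Code} {xs : ℕ → ℕ} (hxs : StrictMono xs)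
    (hf : ∀ k, ∃ w < xs (k + 1), allFail (S, e) (xs k) w = true) {W : langJ.Theory}
    (hW : IsJTheory (Set.range xs) W) (hs : W.IsSatisfiable) :
    ¬ Interprets W (reTheory S e) := by
  rintro ⟨τ, hτ, hτ'⟩
  obtain ⟨Z, hZ, hmod⟩ := exists_standard_model hW hs
  have hN : ∀ φ : langJ.Sentence, W ⊨ᵇ φ → Pt Z ⊨ φ := fun φ h =>
    Theory.models_sentence_iff.1 h (Theory.ModelType.of _ (Pt Z))
  obtain ⟨p, hp⟩ : ∃ p : Fin τ.params → Pt Z, τ.param.Realize p := by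
    have h := hN _ hτ
    rw [Sentence.Realize, Formula.realize_iExs] at h
    obtain ⟨p, h⟩ := h
    rw [Formula.realize_relabel] at h
    exact ⟨p, h⟩
  have hU : ∀ φ : (lang S).Sentence, reTheory S e ⊨ᵇ φ → (τ.sentenceF φ).Realize p := by
    intro φ h
    have h' := (Theory.models_formula_iff.1 (hτ' φ h)) (Theory.ModelType.of _ (Pt Z)) p
    exact (Formula.realize_imp.1 h') hp
  obtain ⟨δ, hδ⟩ := exists_describes p
  -- The first summand puts `δ` among the descriptions tested at stage `k`; the second puts its
  -- parameters below `xs (k + 1)`.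
  let k := Encodable.encode δ + δ.1
  have hk : k ≤ xs k := hxs.le_apply
  obtain ⟨w, hw, hall⟩ := hf k
  obtain ⟨z, hz, hzZ⟩ := exists_bitSet_eq Z (xs k)
  obtain ⟨s, hsw, hs⟩ := allFail_iff.1 hall z hz (Encodable.encode δ) (by omega)
  have hδi : descOf (Encodable.encode δ) = δ := by simp [descOf]
  have hsub : bitSet z ⊆ Z := fun s hs => (hzZ ▸ hs : s ∈ {s | s ∈ Z ∧ s ≤ xs k}).1
  -- Elements of `Z` are terms of the sequence, and none lies strictly between `xs k` and `xs (k +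
  -- 1)`.
  have hgap : ∀ s ∈ Z, s < xs (k + 1) → s ∈ bitSet z := by
    intro s hs hlt
    rw [hzZ]
    obtain ⟨j, rfl⟩ := hZ hs
    exact ⟨hs, hxs.monotone (Nat.lt_succ_iff.1 (hxs.lt_iff_lt.1 hlt))⟩
  have hpar : ∀ x ∈ δ.2.2, x < δ.1 ∧ x ∈ points Z := by
    rw [hδ.param]
    intro x hx
    refine ⟨hδ.lt x hx, ?_⟩
    rw [paramList, List.mem_ofFn] at hx
    obtain ⟨i, rfl⟩ := hx
    exact (p i).2
  -- A truncation of size `T` only consults the set at numbers below `T`.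
  have htr : ∀ T ≤ xs (k + 1), truncation (bitSet z) T = truncation Z T := by
    intro T hT
    ext x
    simp only [truncation, points, Set.mem_ofPred_eq]
    refine and_congr_left fun h => or_congr_right (and_congr_left fun _ => ⟨fun h => hsub h,
      fun h' => hgap _ h' (by omega)⟩)
  have hparz : validParams z δ = true := by
    rw [validParams_iff]
    intro x hx
    obtain ⟨h1, h2⟩ := hpar x hx
    have hlt := hxs (show k < k + 1 by omega)
    have := mem_truncation_of_lt h2 (T := xs (k + 1)) (by omega)
    rw [← htr _ le_rfl] at this
    exact ⟨h1, this.1⟩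
  -- The truncation size is a component of the witness `s`, hence at most `s`, which lies below `xs
  -- (k + 1)`.
  have hT := ((Nat.unpair_right_le (Nat.unpair s).2).trans (Nat.unpair_right_le s)).trans
    (by omega : s ≤ xs (k + 1))
  simp only [fails, hδi, hparz, Bool.not_true, Bool.false_or, Bool.and_eq_true, Bool.or_eq_true,
    inList_iff, decide_eq_true_eq, Bool.not_eq_true', isSentence_iff] at hs
  obtain ⟨h1, h2, h3⟩ := hs
  obtain ⟨φ, hφ, hφU⟩ : ∃ φ : (lang S).Sentence,
      formulaCode φ = (Nat.unpair (Nat.unpair s).2).1 ∧ reTheory S e ⊨ᵇ φ := by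
    rcases h1 with h1 | ⟨⟨φ, hφ⟩, h1⟩
    · obtain ⟨φ, hφ⟩ : ∃ φ : (lang S).Sentence,
          formulaCode φ = (Nat.unpair (Nat.unpair s).2).1 := by
        rcases mem_lawCodes.1 h1 with h | h | h | h | ⟨l, f, h | h⟩ | ⟨l, R, h⟩ <;>
          exact ⟨_, h.symm⟩
      refine ⟨φ, hφ, Theory.models_sentence_iff.2 fun M => ?_⟩
      exact realize_of_mem_lawCodes (hφ ▸ h1)
    · refine ⟨φ, hφ, Theory.models_sentence_of_mem ?_⟩
      obtain ⟨y, hy⟩ := Option.isSome_iff_exists.1 h1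
      exact Part.dom_iff_mem.2 ⟨y, hφ ▸ Nat.Partrec.Code.evaln_sound hy⟩
  rw [← hφ] at h2 h3
  -- The failure passes from `bitSet z` to `Z` on the common truncation, then to all of `points Z`,
  -- and there it is falsity of the translated sentence.
  rw [← Bool.not_eq_true, evalSentence_iff, htr _ hT, fm_truncation_iff φ hpar h2,
    ← hδ.realize_sentenceF] at h3
  exact h3 (hU φ hφU)

end EssUndec

end

/-! ### The theorem -/

theorem mainTheorem3 :
    ∃ F : EssUndec.Sig × Nat.Partrec.Code → Nat.Partrec.Code, Computable F ∧
      ∀ (S : EssUndec.Sig) (e : Nat.Partrec.Code),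
        EssUndec.EssentiallyUndecidable (EssUndec.reTheory S e) →
        ∃ X : Set ℕ, X.Infinite ∧ EssUndec.IsRecursiveIndex (F (S, e)) X ∧
          ∀ W : EssUndec.langJ.Theory, EssUndec.IsJTheory X W → W.IsSatisfiable →
            ¬ EssUndec.Interprets W (EssUndec.reTheory S e) := by
  obtain ⟨c, hc, h⟩ := EssUndec.exists_partrec_char EssUndec.primrec_allFail.to_comp
  -- Although `c` may diverge, the code of its section is always computed, so `F` is total.
  obtain ⟨F, hF, hFc⟩ := EssUndec.exists_computable_curry hc
  refine ⟨F, hF, fun S e hU => ?_⟩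
  obtain ⟨xs, hxs, hf, hX⟩ :=
    h (S, e) fun y => EssUndec.exists_allFail (EssUndec.exists_fails hU) y
  refine ⟨Set.range xs, Set.infinite_range_of_injective hxs.injective, fun n => ?_,
    fun W hW hs => EssUndec.not_interprets hxs hf hW hs⟩
  rw [hFc]
  exact hX n
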